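/- Conventions. A pregeometry over a set $I$ of types is a set of elements with a type function to $I$ and a reflexive symmetric incidence relation in which distinct elements of the same type are not incident. A flag is a set of pairwise incident elements, a chamber is a flag containing elements of all types, and the pregeometry is a geometry if every flag is contained in a chamber. It is simply connected if any two elements can be joined by a path (a finite sequence of consecutively incident elements), and every closed path can be reduced to the trivial path at its base element by inserting and deleting repetitions $(x,x)$, returns $(x,y,x)$ and triangles $(x,y,z,x)$ of incident elements (i.e. its flag complex is connected with trivial fundamental group). A group acting on it by type-preserving automorphisms is flag-transitive if it is transitive on the flags of each given type. Let $K$ be a field. Let $\mathsf Q(6,K)$ be the quadric $X_0X_4+X_1X_5+X_2X_6=X_3^2$ in $\mathrm{PG}(6,K)$. A line of $\mathrm{PG}(6,K)$ contained in $\mathsf Q(6,K)$, with Grassmannian coordinates $p_{ij}$, is a hexagon line if $p_{12}=p_{34}$, $p_{56}=p_{03}$, $p_{45}=p_{23}$, $p_{01}=p_{36}$, $p_{02}=-p_{35}$ and $p_{46}=-p_{13}$; the points of $\mathsf Q(6,K)$ and the hexagon lines form the split Cayley hexagon $\mathsf H(K)$. The other lines of $\mathsf Q(6,K)$ are called ideal,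 and the planes on $\mathsf Q(6,K)$ that contain no hexagon line are called ideal planes. Let $\mathsf G_2(K)$ be the Chevalley group of type $\mathsf G_2$ over $K$, realised as the automorphism group of the split octonion algebra over $K$. The octonions of trace $0$ are identified with $K^7$ so that the norm becomes $X_0X_4+X_1X_5+X_2X_6-X_3^2$: namely $(X_0,\dots,X_6)$ corresponds to the Zorn vector matrix with diagonal entries $-X_3,X_3$ and off-diagonal vectors $(X_0,X_1,X_2)$ and $-(X_4,X_5,X_6)$. If $K$ is perfect of characteristic $2$, project from the point $(0,0,0,1,0,0,0)$ (the unit octonion) onto the hyperplane $\mathrm{PG}(5,K)$ with equation $X_3=0$. The images of hexagon lines are again called hexagon lines, and $\mathsf G_2(K)$ acts on $\mathrm{PG}(5,K)$. A line of $\mathrm{PG}(5,K)$ is non-symplectic if it is not totally isotropic for the alternating form obtained from the quadratic form of $\mathsf Q(6,K)$ by polarisation. A plane of $\mathrm{PG}(5,K)$ is nonsingular if its non-symplectic lines form a dual affine plane, i.e. if they are exactly the lines of the plane missing some given point of it; a nonsingular plane is special if it contains a hexagon line. The rank $3$ geometries $\Gamma_0$, $\Gamma_1$, $\Gamma_2$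 have as points all points of $\mathrm{PG}(5,K)$, as lines all non-symplectic lines of $\mathrm{PG}(5,K)$, and as planes, respectively, all nonsingular planes, all nonspecial nonsingular planes, and all special nonsingular planes. Incidence of points with lines, and of lines with planes, is containment; a point $p$ and a plane $\pi$ are incident if some non-symplectic line is incident with both. For any field $K$, the rank $3$ geometry $\Gamma_3$ consists of the points of $\mathsf H(K)$, the ideal lines and the ideal planes, with containment as incidence. Theorem. Let $K$ be a field. (a) Suppose that $K$ is perfect of characteristic $2$. Then $\Gamma_0$, $\Gamma_1$ and $\Gamma_2$ are geometries, and (i) $\Gamma_0$ is simply connected; (ii) the action of $\mathsf G_2(K)$ on $\mathrm{PG}(5,K)$ induces an action on $\Gamma_1$ by automorphisms, which is flag-transitive; moreover $\Gamma_1$ is simply connected whenever $|K|>2$; (iii) $\Gamma_2$ is simply connected. (b) For every field $K$, $\Gamma_3$ is a geometry and is simply connected. -/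

import Mathlib

universe u

/-! ### Pregeometries, flags, simple connectivity -/

/-- A pregeometry over the type set `I`: elements with a type function and a reflexive, symmetric
incidence relation such that distinct elements of the same type are never incident. -/
structure Pregeometry (I : Type) where
  /-- the elements -/
  X : Type u
  /-- the type function -/
  typ : X → I
  /-- incidence -/
  inc : X → X → Prop
  inc_refl : ∀ x, inc x x
  inc_symm : ∀ x y, inc x y → inc y x
  eq_of_inc : ∀ x y, inc x y → typ x = typ y → x = y

namespace Pregeometry

variable {I : Type} (Γ : Pregeometry.{u} I)

/-- A flag is a set of pairwise incident elements. -/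
def IsFlag (F : Set Γ.X) : Prop := ∀ x ∈ F, ∀ y ∈ F, Γ.inc x y

/-- A pregeometry is a geometry if every flag lies in a chamber, i.e. in a flag that contains
elements of all types. -/
def IsGeometry : Prop :=
  ∀ F : Set Γ.X, Γ.IsFlag F → ∃ C : Set Γ.X, Γ.IsFlag C ∧ F ⊆ C ∧ Γ.typ '' C = Set.univ

/-- A path is a finite sequence of elements in which consecutive elements are incident. -/
def IsPath (l : List Γ.X) : Prop := l.IsChain Γ.inc

/-- The elementary homotopies (in the inserting direction): insertion of a repetition, of a return,
or of a triangle of pairwise incident elements. -/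
inductive ElementaryHomotopy : List Γ.X → List Γ.X → Prop
  | repetition (l r : List Γ.X) (x : Γ.X) :
      ElementaryHomotopy (l ++ x :: r) (l ++ x :: x :: r)
  | backtrack (l r : List Γ.X) (x y : Γ.X) (hxy : Γ.inc x y) :
      ElementaryHomotopy (l ++ x :: r) (l ++ x :: y :: x :: r)
  | triangle (l r : List Γ.X) (x y z : Γ.X)
      (hxy : Γ.inc x y) (hyz : Γ.inc y z) (hzx : Γ.inc z x) :
      ElementaryHomotopy (l ++ x :: r) (l ++ x :: y :: z :: x :: r)

/-- Two paths are homotopic if one arises from the other by finitely many insertions and deletions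
of repetitions, returns and triangles. Homotopy classes of closed paths at `x` are the elements of
the fundamental group of the flag complex at `x`. -/
def Homotopic (p q : List Γ.X) : Prop := Relation.EqvGen Γ.ElementaryHomotopy p q

/-- Any two elements are joined by a path (and there is an element). -/
def Connected : Prop := Nonempty Γ.X ∧ ∀ x y, Relation.ReflTransGen Γ.inc x y

/-- Connected, and every closed path is homotopic to the trivial path at its base element: the
flag complex is connected with trivial fundamental group. -/
def SimplyConnected : Prop :=
  Γ.Connected ∧
    ∀ (x : Γ.X) (l : List Γ.X), Γ.IsPath (x :: (l ++ [x])) → Γ.Homotopic (x :: (l ++ [x])) [x]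

/-- The group of (type preserving) automorphisms. -/
def Aut : Subgroup (Equiv.Perm Γ.X) where
  carrier := {φ | (∀ x, Γ.typ (φ x) = Γ.typ x) ∧ ∀ x y, Γ.inc (φ x) (φ y) ↔ Γ.inc x y}
  one_mem' := by simp
  mul_mem' := by
    rintro a b ⟨ha, ha'⟩ ⟨hb, hb'⟩
    exact ⟨fun x => by simp [ha, hb], fun x y => by simp [ha', hb']⟩
  inv_mem' := by
    rintro a ⟨ha, ha'⟩
    refine ⟨fun x => ?_, fun x y => ?_⟩
    · simpa using (ha (a⁻¹ x)).symm
    · simpa using (ha' (a⁻¹ x) (a⁻¹ y)).symm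

/-- A group acting by automorphisms is flag-transitive if it is transitive on the flags of each
given type. -/
def FlagTransitive {G : Type*} [Group G] (ρ : G →* Γ.Aut) : Prop :=
  ∀ F F' : Set Γ.X, Γ.IsFlag F → Γ.IsFlag F' → Γ.typ '' F = Γ.typ '' F' →
    ∃ g : G, (ρ g : Equiv.Perm Γ.X) '' F = F'

end Pregeometry

namespace Cayley

/-- Rank three pregeometry of subspaces. The sets `P`, `L`, `E` are the points, lines and planes
(types `0`, `1`, `2`). Incidence of a point with a line and of a line with a plane is containment,
incidence of a point with a plane is given by `R`. -/
def subspacePregeometry {K V : Type u} [Field K] [AddCommGroup V] [Module K V]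
    (P L E : Set (Submodule K V)) (R : Submodule K V → Submodule K V → Prop) :
    Pregeometry.{u} (Fin 3) where
  X := Σ i : Fin 3, (![P, L, E] i : Set (Submodule K V))
  typ x := x.1
  inc x y :=
    let below : (Σ i : Fin 3, (![P, L, E] i : Set (Submodule K V))) →
        (Σ i : Fin 3, (![P, L, E] i : Set (Submodule K V))) → Prop := fun a b =>
      a.1 < b.1 ∧ if a.1 = 0 ∧ b.1 = 2 then R a.2.1 b.2.1 else a.2.1 ≤ b.2.1
    x = y ∨ below x y ∨ below y x
  inc_refl x := Or.inl rfl
  inc_symm x y h := by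
    rcases h with h | h | h
    · exact Or.inl h.symm
    · exact Or.inr (Or.inr h)
    · exact Or.inr (Or.inl h)
  eq_of_inc x y h ht := by
    rcases h with h | h | h
    · exact h
    · exact absurd ht (ne_of_lt h.1)
    · exact absurd ht.symm (ne_of_lt h.1)

variable (K : Type u) [Field K]

/-! ### The quadric `Q(6, K)`, the split Cayley hexagon, and `PG(5, K)` -/

/-- Coordinates `X₀, …, X₆`. -/
abbrev V := Fin 7 → K

variable {K}

/-- The quadratic form of `Q(6, K) : X₀X₄ + X₁X₅ + X₂X₆ = X₃²`. -/
def quad (x : V K) : K := x 0 * x 4 + x 1 * x 5 + x 2 * x 6 - x 3 ^ 2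

/-- The polar form of `quad`; in characteristic two its restriction to `X₃ = 0` is the
nondegenerate alternating form of the symplectic space `W(5, K)`. -/
def form (x y : V K) : K := quad (x + y) - quad x - quad y

/-- Subspaces all of whose points are on the quadric. -/
def OnQuadric (U : Submodule K (V K)) : Prop := ∀ x ∈ U, quad x = 0

/-- Grassmannian coordinates of the line through `x` and `y`. -/
def grass (x y : V K) (i j : Fin 7) : K := x i * y j - x j * y i

/-- A hexagon line in `PG(6, K)`. -/
def IsHexagonLine (U : Submodule K (V K)) : Prop :=
  Module.finrank K U = 2 ∧ OnQuadric U ∧ ∀ x ∈ U, ∀ y ∈ U,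
    grass x y 1 2 = grass x y 3 4 ∧ grass x y 5 6 = grass x y 0 3 ∧
    grass x y 4 5 = grass x y 2 3 ∧ grass x y 0 1 = grass x y 3 6 ∧
    grass x y 0 2 = -grass x y 3 5 ∧ grass x y 4 6 = -grass x y 1 3

/-- A point of the split Cayley hexagon: any point of the quadric. -/
def IsHexagonPoint (U : Submodule K (V K)) : Prop :=
  Module.finrank K U = 1 ∧ OnQuadric U

/-- An ideal line: a line of the quadric that is not a hexagon line. -/
def IsIdealLine (U : Submodule K (V K)) : Prop :=
  Module.finrank K U = 2 ∧ OnQuadric U ∧ ¬ IsHexagonLine U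

/-- An ideal plane: a plane of the quadric that contains no hexagon line. -/
def IsIdealPlane (U : Submodule K (V K)) : Prop :=
  Module.finrank K U = 3 ∧ OnQuadric U ∧ ∀ W ≤ U, ¬ IsHexagonLine W

variable (K)

/-- The hyperplane `X₃ = 0`; its subspaces form `PG(5, K)`. -/
def hyp : Submodule K (V K) := LinearMap.ker (LinearMap.proj 3 : V K →ₗ[K] K)

/-- The projection from the point `(0,0,0,1,0,0,0)` onto `X₃ = 0`. -/
def proj₃ : V K →ₗ[K] V K :=
  LinearMap.pi fun i => if i = 3 then 0 else LinearMap.proj i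

variable {K}

/-- A subspace of projective dimension `d - 1` of `PG(5, K)`. -/
def IsPG (d : ℕ) (U : Submodule K (V K)) : Prop := U ≤ hyp K ∧ Module.finrank K U = d

/-- A line of `PG(5, K)` that is not totally isotropic. -/
def IsNonsymplecticLine (U : Submodule K (V K)) : Prop :=
  IsPG 2 U ∧ ∃ x ∈ U, ∃ y ∈ U, form x y ≠ 0

/-- A plane of `PG(5, K)` in which the non-symplectic lines form a dual affine plane, i.e. they are
the lines of the plane that miss a certain point of the plane. -/
def IsNonsingularPlane (U : Submodule K (V K)) : Prop :=
  IsPG 3 U ∧ ∃ p ≤ U, IsPG 1 p ∧ ∀ l ≤ U, IsPG 2 l → (IsNonsymplecticLine l ↔ ¬ p ≤ l)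

/-- A nonsingular plane that contains a (projected) hexagon line. -/
def IsSpecialPlane (U : Submodule K (V K)) : Prop :=
  IsNonsingularPlane U ∧ ∃ h, IsHexagonLine h ∧ h.map (proj₃ K) ≤ U

variable (K)

/-! ### The geometries -/

/-- Points and non-symplectic lines of `PG(5, K)` with a given set of planes. A point and a plane
are incident if some non-symplectic line is incident with both. -/
def symplecticPregeometry (E : Set (Submodule K (V K))) : Pregeometry.{u} (Fin 3) :=
  subspacePregeometry {U | IsPG 1 U} {U | IsNonsymplecticLine U} E
    fun p e => ∃ l, IsNonsymplecticLine l ∧ p ≤ l ∧ l ≤ e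

/-- All nonsingular planes. -/
def Gamma0 : Pregeometry.{u} (Fin 3) := symplecticPregeometry K {U | IsNonsingularPlane U}

/-- The nonsingular planes that are not special. -/
def Gamma1 : Pregeometry.{u} (Fin 3) :=
  symplecticPregeometry K {U | IsNonsingularPlane U ∧ ¬ IsSpecialPlane U}

/-- The special nonsingular planes. -/
def Gamma2 : Pregeometry.{u} (Fin 3) := symplecticPregeometry K {U | IsSpecialPlane U}

/-- Hexagon points, ideal lines and ideal planes with containment. -/
def Gamma3 : Pregeometry.{u} (Fin 3) :=
  subspacePregeometry {U : Submodule K (V K) | IsHexagonPoint U} {U | IsIdealLine U}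
    {U | IsIdealPlane U} fun p e => p ≤ e

/-- The subspace underlying an element of `Γ₁`. -/
def Gamma1.subspace (x : (Gamma1 K).X) : Submodule K (V K) := x.2.1

/-! ### The group `G₂(K)` -/

/-- The underlying vector space of the split octonion (Cayley) algebra: Zorn vector matrices
`(a, v, w, b)` with scalars `a, b` on the diagonal and vectors `v, w` off the diagonal. -/
abbrev Zorn := K × (Fin 3 → K) × (Fin 3 → K) × K

variable {K}

/-- Zorn's multiplication; the unit element is `(1, 0, 0, 1)`, the trace `a + b`, the norm
`a b - v ⬝ w`. -/
def zornMul : Zorn K → Zorn K → Zorn K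
  | (a, v, w, b), (a', v', w', b') =>
    (a * a' + v ⬝ᵥ w', a • v' + b' • v - crossProduct w w',
      a' • w + b • w' + crossProduct v v', b * b' + w ⬝ᵥ v')

variable (K)

/-- `G₂(K)`: the automorphism group of the split octonion algebra over `K`. -/
def G2 : Subgroup (Zorn K ≃ₗ[K] Zorn K) where
  carrier := {g | ∀ x y, g (zornMul x y) = zornMul (g x) (g y)}
  one_mem' := fun _ _ => rfl
  mul_mem' := by
    intro a b ha hb x y
    simp only [LinearEquiv.mul_apply]
    rw [hb, ha]
  inv_mem' := by
    intro a ha x y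
    apply a.injective
    rw [ha]
    simp

/-- The identification of `K⁷` with the octonions of trace `0`. The norm becomes `quad`, and the
hexagon lines are the two-dimensional subspaces on which the multiplication vanishes. -/
def toZorn : V K →ₗ[K] Zorn K where
  toFun x := (-x 3, ![x 0, x 1, x 2], -![x 4, x 5, x 6], x 3)
  map_add' x y := by
    ext i <;> (try fin_cases i) <;> simp <;> ring
  map_smul' c x := by
    ext i <;> (try fin_cases i) <;> simp

/-- The coordinates `X₀, X₁, X₂, X₄, X₅, X₆` of an octonion, with `X₃` replaced by `0`. -/
def ofZorn : Zorn K →ₗ[K] V K where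
  toFun z := ![z.2.1 0, z.2.1 1, z.2.1 2, 0, -z.2.2.1 0, -z.2.2.1 1, -z.2.2.1 2]
  map_add' x y := by
    ext i; fin_cases i <;> simp <;> ring
  map_smul' c x := by
    ext i; fin_cases i <;> simp

variable {K}

/-- The action of `G₂(K)` on `PG(5, K)` in characteristic two: apply an automorphism to a trace `0`
octonion with `X₃ = 0` and project the result from `(0,0,0,1,0,0,0)` (which is the unit
octonion) onto `X₃ = 0`. -/
def G2.map (g : G2 K) : V K →ₗ[K] V K :=
  ofZorn K ∘ₗ (g : Zorn K ≃ₗ[K] Zorn K).toLinearMap ∘ₗ toZorn K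

end Cayley

/-!
A connected pregeometry is simply connected as soon as every group-valued cocycle on its flag
complex is a coboundary: the cocycle to test takes values in the fundamental group itself
(`Pregeometry.simplyConnected_of_cocycle`). For a rank three geometry of points, lines and planes it
suffices to consider pairs of collinear points and functions that multiply correctly along triangles
in lines and planes (`IsRankThree.simplyConnected`). So in each of the geometries all triangles have
to be filled by triangles in elements, and then a potential has to be constructed.

Computations are reduced to standard position by the transitivity of `G₂(K)`. Two singular octonions
of trace zero with inner product one generate a quaternion algebra; the octonions are obtained from
it by doubling with a unit vector orthogonal to it, and any two such configurations are conjugate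
(`exists_mem_G2`, `exists_act_eq`). This yields transitivity on hyperbolic pairs, on points of the
quadric and on bases of ideal lines (`exists_act_pair`, `exists_act_point`, `exists_act_ideal`).

For `Γ₃`, three points that are pairwise on ideal lines span a line, an ideal plane or a plane on
which the trilinear form vanishes. In the last case they form one face of an octahedron whose other
faces lie in ideal planes (`fills_octahedron`, `fills_of_ideal`). A cocycle can then be extended to
the hexagon lines by paths of length two; the extension is well defined (`samePath_of_hex`) and
multiplies correctly on all planes of the quadric (`IdealCocycle.hat_mul`). The collinearity graph
of the polar space of the quadric has diameter two, and the paths of length two from a base point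
define the potential (`IdealCocycle.exists_potential`).

In characteristic two the same is done for the symplectic space, where the graph to consider is that
of non-perpendicular points (`exists_symp_potential`). Every point of `PG(5, K)` is the image of a
unique point of the quadric since `K` is perfect. If `x`, `y`, `z` are singular vectors that are
pairwise non-perpendicular, then the radical of the plane that they span is represented by
`altitude x y z`, and the plane is special if and only if this vector is singular, i.e. if and only
if `disc x y z = 0` (`IsPlaneFrame.isSpecialPlane_iff`, `quad_altitude`). All triangles in planes of
the wrong kind are filled by coning from a fourth point such that the three new planes are of the
right kind (`exists_fan_special`, `exists_fan_nonspecial`, `mul_of_isFan`); for nonspecial planes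
this needs an element of `K` other than `0` and `1`. Finally, a chamber of `Γ₁` is the same as a
hyperbolic pair with a unit vector orthogonal to its quaternion algebra, up to scalars, so that
flag-transitivity is the transitivity stated above (`exists_act_chamber`).
-/

/-! ### Simple connectivity and group-valued cocycles -/

namespace Pregeometry

variable {I : Type} (Γ : Pregeometry.{u} I)

/-- A cocycle on the flag complex with values in a group: a function on incident pairs that
multiplies to `1` around repetitions, returns and triangles. -/
structure IsCocycle {G : Type*} [Group G] (φ : Γ.X → Γ.X → G) : Prop where
  self : ∀ x, φ x x = 1
  symm : ∀ x y, Γ.inc x y → φ x y * φ y x = 1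
  tri : ∀ x y z, Γ.inc x y → Γ.inc y z → Γ.inc z x → φ x y * φ y z * φ z x = 1

variable {Γ}

theorem IsCocycle.mul_eq {G : Type*} [Group G] {φ : Γ.X → Γ.X → G} (h : Γ.IsCocycle φ)
    {x y z : Γ.X} (hxy : Γ.inc x y) (hyz : Γ.inc y z) (hxz : Γ.inc x z) :
    φ x y * φ y z = φ x z := by
  rw [eq_inv_of_mul_eq_one_left (h.tri x y z hxy hyz (Γ.inc_symm _ _ hxz))]
  exact inv_eq_of_mul_eq_one_left (h.symm x z hxz)

variable (Γ)

theorem ElementaryHomotopy.append {Γ : Pregeometry.{u} I} {p q : List Γ.X}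
    (h : Γ.ElementaryHomotopy p q) (a b : List Γ.X) :
    Γ.ElementaryHomotopy (a ++ p ++ b) (a ++ q ++ b) := by
  cases h with
  | repetition l r x => simpa using ElementaryHomotopy.repetition (a ++ l) (r ++ b) x
  | backtrack l r x y h => simpa using ElementaryHomotopy.backtrack (a ++ l) (r ++ b) x y h
  | triangle l r x y z h1 h2 h3 =>
    simpa using ElementaryHomotopy.triangle (a ++ l) (r ++ b) x y z h1 h2 h3

theorem Homotopic.append {Γ : Pregeometry.{u} I} {p q : List Γ.X} (h : Γ.Homotopic p q)
    (a b : List Γ.X) : Γ.Homotopic (a ++ p ++ b) (a ++ q ++ b) := by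
  induction h with
  | rel x y h => exact .rel _ _ (h.append a b)
  | refl => exact .refl _
  | symm x y _ ih => exact ih.symm
  | trans x y z _ _ h1 h2 => exact h1.trans _ _ _ h2

/-- Homotopy is a congruence for concatenation of lists, so that homotopy classes of arbitrary
lists form a monoid; a path from `x` to `y` followed by a path from `y` to `z` represents the
composite, the repetition of `y` being harmless. -/
def homotopyCon : Con (FreeMonoid Γ.X) where
  r p q := Γ.Homotopic p.toList q.toList
  iseqv := ⟨fun _ => .refl _, fun h => h.symm, fun h1 h2 => h1.trans _ _ _ h2⟩
  mul' {a b c d} h1 h2 := by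
    have h3 := h1.append [] c.toList
    have h4 := h2.append b.toList []
    simp only [List.nil_append, List.append_nil] at h3 h4
    exact h3.trans _ _ _ h4

/-- The monoid of homotopy classes of lists. -/
abbrev HMonoid : Type u := Γ.homotopyCon.Quotient

variable {Γ}

/-- The homotopy class of a list. -/
def cls (p : List Γ.X) : Γ.HMonoid := ((FreeMonoid.ofList p : FreeMonoid Γ.X) : Γ.HMonoid)

theorem cls_eq {p q : List Γ.X} : cls p = cls q ↔ Γ.Homotopic p q :=
  Γ.homotopyCon.eq

theorem cls_append (p q : List Γ.X) : cls (p ++ q) = cls p * cls q := rfl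

theorem cls_cons (x : Γ.X) (q : List Γ.X) : cls (x :: q) = cls [x] * cls q := rfl

theorem cls_self (x : Γ.X) : cls [x] * cls [x] = cls [x] :=
  (cls_eq.2 (.rel _ _ (ElementaryHomotopy.repetition [] [] x))).symm

theorem cls_self_mul (x : Γ.X) (m : Γ.HMonoid) : cls [x] * (cls [x] * m) = cls [x] * m := by
  rw [← mul_assoc, cls_self]

theorem cls_back {x y : Γ.X} (h : Γ.inc x y) : cls [x] * (cls [y] * cls [x]) = cls [x] :=
  (cls_eq.2 (.rel _ _ (ElementaryHomotopy.backtrack [] [] x y h))).symm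

theorem cls_tri {x y z : Γ.X} (h : Γ.inc x y) (h2 : Γ.inc y z) (h3 : Γ.inc z x) :
    cls [x] * (cls [y] * (cls [z] * cls [x])) = cls [x] :=
  (cls_eq.2 (.rel _ _ (ElementaryHomotopy.triangle [] [] x y z h h2 h3))).symm

/-- `Joins x y p`: the list `p` is a path from `x` to `y`. -/
def Joins (x y : Γ.X) (p : List Γ.X) : Prop :=
  Γ.IsPath p ∧ p.head? = some x ∧ p.getLast? = some y

theorem Joins.single (x : Γ.X) : Joins x x [x] := ⟨List.isChain_singleton x, rfl, rfl⟩

theorem Joins.reverse {x y : Γ.X} {p : List Γ.X} (h : Joins x y p) : Joins y x p.reverse := by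
  refine ⟨?_, by simpa using h.2.2, by simpa using h.2.1⟩
  exact List.isChain_reverse.2 (h.1.imp fun a b => Γ.inc_symm a b)

theorem Joins.append {x y z w : Γ.X} {p q : List Γ.X} (h : Joins x y p) (h2 : Joins z w q)
    (hyz : Γ.inc y z) : Joins x w (p ++ q) := by
  refine ⟨List.isChain_append.2 ⟨h.1, h2.1, ?_⟩, ?_, ?_⟩
  · intro a ha b hb
    rw [h.2.2] at ha
    rw [h2.2.1] at hb
    cases ha; cases hb; exact hyz
  · simp [List.head?_append, h.2.1]
  · simp [List.getLast?_append, h2.2.2]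

/-- A repetition of the first vertex of a path can be deleted. -/
theorem Joins.left {x y : Γ.X} {p : List Γ.X} (h : Joins x y p) (m : Γ.HMonoid) :
    cls [x] * (cls p * m) = cls p * m := by
  obtain ⟨a, l, rfl⟩ : ∃ a l, p = a :: l := by
    cases p with
    | nil => simpa using h.2.1
    | cons a l => exact ⟨a, l, rfl⟩
  have : a = x := by simpa using h.2.1
  subst this
  rw [cls_cons a l, mul_assoc, cls_self_mul]

theorem Joins.left' {x y : Γ.X} {p : List Γ.X} (h : Joins x y p) :
    cls [x] * cls p = cls p := by simpa using h.left 1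

/-- A repetition of the last vertex of a path can be deleted. -/
theorem Joins.right {x y : Γ.X} {p : List Γ.X} (h : Joins x y p) (m : Γ.HMonoid) :
    cls p * (cls [y] * m) = cls p * m := by
  obtain ⟨l, a, rfl⟩ : ∃ l a, p = l ++ [a] := by
    rcases List.eq_nil_or_concat p with rfl | ⟨l, a, rfl⟩
    · simpa using h.2.1
    · exact ⟨l, a, by simp⟩
  have : a = y := by simpa using h.2.2
  subst this
  rw [cls_append, mul_assoc, cls_self_mul, mul_assoc]

theorem Joins.right' {x y : Γ.X} {p : List Γ.X} (h : Joins x y p) :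
    cls p * cls [y] = cls p := by simpa using h.right 1

/-- A path followed by its reverse is homotopic to the trivial path. -/
theorem Joins.mul_reverse {x y : Γ.X} {p : List Γ.X} (h : Joins x y p) :
    cls p * cls p.reverse = cls [x] := by
  induction p generalizing x with
  | nil => simpa using h.2.1
  | cons a l ih =>
    have hax : a = x := by simpa using h.2.1
    subst hax
    cases l with
    | nil => simpa using cls_self a
    | cons b l =>
      have hp := h.1
      unfold IsPath at hp
      rw [List.isChain_cons_cons] at hp
      have hb : Joins b y (b :: l) := ⟨hp.2, rfl, by simpa using h.2.2⟩
      have := ih hb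
      rw [List.reverse_cons, cls_append, cls_cons a, mul_assoc, ← mul_assoc _ _ (cls [a]), this,
        cls_back hp.1]

theorem Joins.reverse_mul {x y : Γ.X} {p : List Γ.X} (h : Joins x y p) :
    cls p.reverse * cls p = cls [y] := by
  simpa using h.reverse.mul_reverse

theorem Joins.reverse_mul_assoc {x y : Γ.X} {p : List Γ.X} (h : Joins x y p) (m : Γ.HMonoid) :
    cls p.reverse * (cls p * m) = cls [y] * m := by
  rw [← mul_assoc, h.reverse_mul]

/-- The fundamental group at `o`: homotopy classes of closed paths. -/
def Loops (o : Γ.X) : Type u := {m : Γ.HMonoid // ∃ p, Joins o o p ∧ m = cls p}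

/-- The class of a closed path. -/
def Loops.mk {o : Γ.X} (p : List Γ.X) (hp : Joins o o p) : Loops o := ⟨cls p, p, hp, rfl⟩

/-- Composition of closed paths is concatenation, and the inverse path is the reversed list. -/
noncomputable instance (o : Γ.X) : Group (Loops o) :=
  letI : Mul (Loops o) := ⟨fun a b => ⟨a.1 * b.1, by
    obtain ⟨p, hp, ha⟩ := a.2
    obtain ⟨q, hq, hb⟩ := b.2
    exact ⟨p ++ q, hp.append hq (Γ.inc_refl o), by rw [ha, hb, cls_append]⟩⟩⟩
  letI : One (Loops o) := ⟨⟨cls [o], [o], Joins.single o, rfl⟩⟩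
  letI : Inv (Loops o) := ⟨fun a => ⟨cls a.2.choose.reverse, _,
    a.2.choose_spec.1.reverse, rfl⟩⟩
  Group.ofLeftAxioms (fun a b c => Subtype.ext (mul_assoc _ _ _))
    (fun a => Subtype.ext (by
      obtain ⟨p, hp, ha⟩ := a.2
      change cls [o] * a.1 = a.1
      rw [ha, hp.left']))
    (fun a => Subtype.ext (by
      change cls a.2.choose.reverse * a.1 = cls [o]
      exact (congrArg _ a.2.choose_spec.2).trans a.2.choose_spec.1.reverse_mul))

theorem Loops.val_mul {o : Γ.X} (a b : Loops o) : (a * b).1 = a.1 * b.1 := rfl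
theorem Loops.val_one {o : Γ.X} : (1 : Loops o).1 = cls [o] := rfl

theorem exists_joins {x y : Γ.X} (h : Relation.ReflTransGen Γ.inc x y) : ∃ p, Joins x y p := by
  induction h with
  | refl => exact ⟨_, Joins.single x⟩
  | tail _ hbc ih =>
    obtain ⟨p, hp⟩ := ih
    exact ⟨_, hp.append (Joins.single _) hbc⟩

/-- A connected pregeometry is simply connected as soon as every group-valued cocycle is a
coboundary. The cocycle to look at sends `(x, y)` to the class of a fixed path from the base point
to `x` followed by the reverse of the fixed path to `y`. -/
theorem simplyConnected_of_cocycle (hc : Γ.Connected)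
    (h : ∀ (G : Type u) [Group G] (φ : Γ.X → Γ.X → G), Γ.IsCocycle φ →
      ∃ g : Γ.X → G, ∀ x y, Γ.inc x y → φ x y = (g x)⁻¹ * g y) : Γ.SimplyConnected := by
  classical
  obtain ⟨⟨o⟩, hconn⟩ := hc
  choose γ hγ using fun x => exists_joins (hconn o x)
  let φ : Γ.X → Γ.X → Loops o := fun x y =>
    if hxy : Γ.inc x y then Loops.mk _ ((hγ x).append (hγ y).reverse hxy)
    else 1
  have hφ : ∀ x y, Γ.inc x y → (φ x y).1 = cls (γ x) * cls (γ y).reverse := by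
    intro x y hxy
    simp only [φ]
    rw [dif_pos hxy]
    rfl
  have hmid : ∀ x m, cls (γ x) * (cls [x] * m) = cls (γ x) * m := fun x m => (hγ x).right m
  have hcoc : Γ.IsCocycle φ := by
    refine ⟨fun x => Subtype.ext ?_, fun x y hxy => Subtype.ext ?_,
      fun x y z hxy hyz hzx => Subtype.ext ?_⟩
    · rw [hφ x x (Γ.inc_refl x), (hγ x).mul_reverse]; rfl
    · rw [Loops.val_mul, hφ x y hxy, hφ y x (Γ.inc_symm _ _ hxy), Loops.val_one,
        mul_assoc, (hγ y).reverse_mul_assoc, ← (hγ x).mul_reverse, ← (hγ x).reverse.left',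
        ← hmid x, ← mul_assoc (cls [y]), ← mul_assoc (cls [x]), cls_back hxy, hmid]
    · rw [Loops.val_mul, Loops.val_mul, hφ x y hxy, hφ y z hyz, hφ z x hzx, Loops.val_one,
        mul_assoc, mul_assoc, mul_assoc, (hγ y).reverse_mul_assoc, (hγ z).reverse_mul_assoc,
        ← (hγ x).mul_reverse, ← (hγ x).reverse.left', ← hmid x]
      have := cls_tri hxy hyz hzx
      have h2 := congrArg (fun m => cls (γ x) * (m * cls (γ x).reverse)) this
      simpa only [mul_assoc] using h2
  obtain ⟨g, hg⟩ := h _ φ hcoc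
  -- The potential computes the class of a path that is closed up through the base point.
  have key : ∀ (l : List Γ.X) (a b : Γ.X), Joins a b (a :: l) →
      cls (γ a) * (cls (a :: l) * cls (γ b).reverse) = ((g a)⁻¹ * g b).1 := by
    intro l
    induction l with
    | nil =>
      intro a b hab
      have : a = b := by simpa using hab.2.2
      subst this
      rw [inv_mul_cancel, (hγ a).reverse.left', (hγ a).mul_reverse]; rfl
    | cons c l ih =>
      intro a b hab
      have hp := hab.1
      unfold IsPath at hp
      rw [List.isChain_cons_cons] at hp
      have hcb : Joins c b (c :: l) := ⟨hp.2, rfl, by simpa using hab.2.2⟩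
      have h1 := ih c b hcb
      have h2 : (g a)⁻¹ * g b = φ a c * ((g c)⁻¹ * g b) := by rw [hg a c hp.1]; group
      rw [h2, Loops.val_mul, ← h1, hφ a c hp.1, mul_assoc, (hγ c).reverse_mul_assoc,
        hcb.left, cls_cons a, mul_assoc, hmid]
  refine ⟨⟨⟨o⟩, hconn⟩, fun x l hl => ?_⟩
  rw [← cls_eq]
  have hj : Joins x x (x :: (l ++ [x])) := by
    refine ⟨hl, rfl, ?_⟩
    rw [← List.cons_append, List.getLast?_append]
    rfl
  -- The closed path is conjugate to one at the base point, which is trivial by `key`.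
  have h1 := key _ x x hj
  rw [inv_mul_cancel, Loops.val_one] at h1
  rw [← hj.right', ← hj.left', ← (hγ x).reverse_mul]
  have h2 := congrArg (fun m => cls (γ x).reverse * (m * cls (γ x))) h1
  simp only [mul_assoc, (hγ x).left'] at h2 ⊢
  exact h2

end Pregeometry

/-! ### Rank three geometries of subspaces -/

namespace Cayley

section RankThree

variable {K V : Type u} [Field K] [AddCommGroup V] [Module K V]

/-- The hypotheses on points, lines and planes that make `subspacePregeometry P L E R` a geometry:
dimensions are `1, 2, 3`, lines are full sets of points, no element is isolated, and a point and a
plane are incident exactly if some line is incident with both. -/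
structure IsRankThree (P L E : Set (Submodule K V))
    (R : Submodule K V → Submodule K V → Prop) : Prop where
  dimP : ∀ p ∈ P, Module.finrank K p = 1
  dimL : ∀ l ∈ L, Module.finrank K l = 2
  dimE : ∀ e ∈ E, Module.finrank K e = 3
  point_mem : ∀ l ∈ L, ∀ x ∈ l, x ≠ 0 → K ∙ x ∈ P
  exists_line : ∀ p ∈ P, ∃ l ∈ L, p ≤ l
  exists_plane : ∀ l ∈ L, ∃ e ∈ E, l ≤ e
  exists_line_le : ∀ e ∈ E, ∃ l ∈ L, l ≤ e
  rel_iff : ∀ p ∈ P, ∀ e ∈ E, R p e ↔ ∃ l ∈ L, p ≤ l ∧ l ≤ e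
  nonempty : P.Nonempty

variable {P L E : Set (Submodule K V)} {R : Submodule K V → Submodule K V → Prop}

/-- A point, as an element of the pregeometry. -/
def pt {p : Submodule K V} (hp : p ∈ P) : (subspacePregeometry P L E R).X := ⟨0, ⟨p, hp⟩⟩
/-- A line, as an element of the pregeometry. -/
def ln {l : Submodule K V} (hl : l ∈ L) : (subspacePregeometry P L E R).X := ⟨1, ⟨l, hl⟩⟩
/-- A plane, as an element of the pregeometry. -/
def pl {e : Submodule K V} (he : e ∈ E) : (subspacePregeometry P L E R).X := ⟨2, ⟨e, he⟩⟩

theorem elt_cases (x : (subspacePregeometry P L E R).X) :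
    (∃ p, ∃ hp : p ∈ P, x = pt hp) ∨ (∃ l, ∃ hl : l ∈ L, x = ln hl) ∨
      ∃ e, ∃ he : e ∈ E, x = pl he := by
  obtain ⟨i, U, hU⟩ := x
  match i, hU with
  | 0, hU => exact Or.inl ⟨U, hU, rfl⟩
  | 1, hU => exact Or.inr (Or.inl ⟨U, hU, rfl⟩)
  | 2, hU => exact Or.inr (Or.inr ⟨U, hU, rfl⟩)

/-- The subspace underlying an element. -/
def sub (x : (subspacePregeometry P L E R).X) : Submodule K V := x.2.1

theorem inc_pt_pt {p q : Submodule K V} (hp : p ∈ P) (hq : q ∈ P) :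
    (subspacePregeometry P L E R).inc (pt hp) (pt hq) ↔ p = q := by
  constructor
  · rintro (h | h | h)
    · exact congrArg sub h
    · exact absurd (show (0 : Fin 3) < 0 from h.1) (by decide)
    · exact absurd (show (0 : Fin 3) < 0 from h.1) (by decide)
  · rintro rfl; exact Or.inl rfl

theorem inc_ln_ln {p q : Submodule K V} (hp : p ∈ L) (hq : q ∈ L) :
    (subspacePregeometry P L E R).inc (ln hp) (ln hq) ↔ p = q := by
  constructor
  · rintro (h | h | h)
    · exact congrArg sub h
    · exact absurd (show (1 : Fin 3) < 1 from h.1) (by decide)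
    · exact absurd (show (1 : Fin 3) < 1 from h.1) (by decide)
  · rintro rfl; exact Or.inl rfl

theorem inc_pl_pl {p q : Submodule K V} (hp : p ∈ E) (hq : q ∈ E) :
    (subspacePregeometry P L E R).inc (pl hp) (pl hq) ↔ p = q := by
  constructor
  · rintro (h | h | h)
    · exact congrArg sub h
    · exact absurd (show (2 : Fin 3) < 2 from h.1) (by decide)
    · exact absurd (show (2 : Fin 3) < 2 from h.1) (by decide)
  · rintro rfl; exact Or.inl rfl

theorem inc_pt_ln {p q : Submodule K V} (hp : p ∈ P) (hq : q ∈ L) :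
    (subspacePregeometry P L E R).inc (pt hp) (ln hq) ↔ p ≤ q := by
  constructor
  · rintro (h | h | h)
    · exact absurd (show (0 : Fin 3) = 1 from congrArg (subspacePregeometry P L E R).typ h)
        (by decide)
    · exact h.2
    · exact absurd (show (1 : Fin 3) < 0 from h.1) (by decide)
  · intro h; exact Or.inr (Or.inl ⟨show (0 : Fin 3) < 1 by decide, h⟩)

theorem inc_ln_pl {p q : Submodule K V} (hp : p ∈ L) (hq : q ∈ E) :
    (subspacePregeometry P L E R).inc (ln hp) (pl hq) ↔ p ≤ q := by
  constructor
  · rintro (h | h | h)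
    · exact absurd (show (1 : Fin 3) = 2 from congrArg (subspacePregeometry P L E R).typ h)
        (by decide)
    · exact h.2
    · exact absurd (show (2 : Fin 3) < 1 from h.1) (by decide)
  · intro h; exact Or.inr (Or.inl ⟨show (1 : Fin 3) < 2 by decide, h⟩)

theorem inc_pt_pl {p q : Submodule K V} (hp : p ∈ P) (hq : q ∈ E) :
    (subspacePregeometry P L E R).inc (pt hp) (pl hq) ↔ R p q := by
  constructor
  · rintro (h | h | h)
    · exact absurd (show (0 : Fin 3) = 2 from congrArg (subspacePregeometry P L E R).typ h)
        (by decide)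
    · exact h.2
    · exact absurd (show (2 : Fin 3) < 0 from h.1) (by decide)
  · intro h; exact Or.inr (Or.inl ⟨show (0 : Fin 3) < 2 by decide, h⟩)

theorem inc_comm' {x y : (subspacePregeometry P L E R).X} :
    (subspacePregeometry P L E R).inc x y ↔ (subspacePregeometry P L E R).inc y x :=
  ⟨(subspacePregeometry P L E R).inc_symm _ _, (subspacePregeometry P L E R).inc_symm _ _⟩

/-- The values of a cocycle on pairs of collinear points: functions that multiply correctly along
triangles of pairwise collinear points lying on a common line or in a common plane. -/
structure IsEdgeCocycle (P L E : Set (Submodule K V)) {G : Type*} [Group G]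
    (Ψ : Submodule K V → Submodule K V → G) : Prop where
  self : ∀ p, Ψ p p = 1
  symm : ∀ p q, Ψ p q * Ψ q p = 1
  tri : ∀ p ∈ P, ∀ q ∈ P, ∀ r ∈ P, p ⊔ q ∈ L → q ⊔ r ∈ L → p ⊔ r ∈ L →
    (∃ U, (U ∈ L ∨ U ∈ E) ∧ p ≤ U ∧ q ≤ U ∧ r ≤ U) → Ψ p q * Ψ q r = Ψ p r

variable (h : IsRankThree P L E R)
include h

namespace IsRankThree

theorem exists_point {l : Submodule K V} (hl : l ∈ L) : ∃ p ∈ P, p ≤ l := by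
  have : l ≠ ⊥ := by
    rintro rfl
    simpa using h.dimL _ hl
  obtain ⟨x, hx, hx0⟩ := l.exists_mem_ne_zero_of_ne_bot this
  exact ⟨K ∙ x, h.point_mem l hl x hx hx0, by simpa⟩

theorem isFlag_chamber {p l e : Submodule K V} (hp : p ∈ P) (hl : l ∈ L) (he : e ∈ E)
    (hpl : p ≤ l) (hle : l ≤ e) : (subspacePregeometry P L E R).IsFlag {pt hp, ln hl, pl he} := by
  have h1 := (inc_pt_ln (E := E) (R := R) hp hl).2 hpl
  have h2 := (inc_ln_pl (P := P) (R := R) hl he).2 hle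
  have h3 := (inc_pt_pl (L := L) (R := R) hp he).2 ((h.rel_iff p hp e he).2 ⟨l, hl, hpl, hle⟩)
  rintro x (rfl | rfl | rfl) y (rfl | rfl | rfl)
  exacts [Or.inl rfl, h1, h3, inc_comm'.1 h1, Or.inl rfl, h2, inc_comm'.1 h3, inc_comm'.1 h2,
    Or.inl rfl]

/-- Every flag lies in one of the form `{p, l, e}` with `p ≤ l ≤ e`. -/
theorem exists_chamber (F : Set (subspacePregeometry P L E R).X)
    (hF : (subspacePregeometry P L E R).IsFlag F) :
    ∃ p l e, ∃ (hp : p ∈ P) (hl : l ∈ L) (he : e ∈ E), p ≤ l ∧ l ≤ e ∧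
      F ⊆ {pt hp, ln hl, pl he} := by
  -- The chamber is found by distinguishing which types occur in the flag.
  have key : ∃ p l e, p ∈ P ∧ l ∈ L ∧ e ∈ E ∧ p ≤ l ∧ l ≤ e ∧
      (∀ p' (hp' : p' ∈ P), pt hp' ∈ F → p' = p) ∧ (∀ p' (hp' : p' ∈ L), ln hp' ∈ F → p' = l) ∧
      (∀ p' (hp' : p' ∈ E), pl hp' ∈ F → p' = e) := by
    have uP : ∀ {p} (hp : p ∈ P), pt hp ∈ F → ∀ p' (hp' : p' ∈ P), pt hp' ∈ F → p' = p :=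
      fun hp h1 p' hp' h2 => (inc_pt_pt hp' hp).1 (hF _ h2 _ h1)
    have uL : ∀ {p} (hp : p ∈ L), ln hp ∈ F → ∀ p' (hp' : p' ∈ L), ln hp' ∈ F → p' = p :=
      fun hp h1 p' hp' h2 => (inc_ln_ln hp' hp).1 (hF _ h2 _ h1)
    have uE : ∀ {p} (hp : p ∈ E), pl hp ∈ F → ∀ p' (hp' : p' ∈ E), pl hp' ∈ F → p' = p :=
      fun hp h1 p' hp' h2 => (inc_pl_pl hp' hp).1 (hF _ h2 _ h1)
    by_cases h0 : ∃ p, ∃ hp : p ∈ P, pt hp ∈ F <;> by_cases h1 : ∃ p, ∃ hp : p ∈ L, ln hp ∈ F <;>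
      by_cases h2 : ∃ p, ∃ hp : p ∈ E, pl hp ∈ F
    · obtain ⟨p, hp, h0⟩ := h0
      obtain ⟨l, hl, h1⟩ := h1
      obtain ⟨e, he, h2⟩ := h2
      exact ⟨p, l, e, hp, hl, he, (inc_pt_ln hp hl).1 (hF _ h0 _ h1),
        (inc_ln_pl hl he).1 (hF _ h1 _ h2), uP hp h0, uL hl h1, uE he h2⟩
    · obtain ⟨p, hp, h0⟩ := h0
      obtain ⟨l, hl, h1⟩ := h1
      obtain ⟨e, he, hle⟩ := h.exists_plane l hl
      exact ⟨p, l, e, hp, hl, he, (inc_pt_ln hp hl).1 (hF _ h0 _ h1), hle, uP hp h0, uL hl h1,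
        fun p' hp' h' => absurd ⟨p', hp', h'⟩ h2⟩
    · obtain ⟨p, hp, h0⟩ := h0
      obtain ⟨e, he, h2⟩ := h2
      obtain ⟨l, hl, hpl, hle⟩ := (h.rel_iff p hp e he).1 ((inc_pt_pl hp he).1 (hF _ h0 _ h2))
      exact ⟨p, l, e, hp, hl, he, hpl, hle, uP hp h0, fun p' hp' h' => absurd ⟨p', hp', h'⟩ h1,
        uE he h2⟩
    · obtain ⟨p, hp, h0⟩ := h0
      obtain ⟨l, hl, hpl⟩ := h.exists_line p hp
      obtain ⟨e, he, hle⟩ := h.exists_plane l hl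
      exact ⟨p, l, e, hp, hl, he, hpl, hle, uP hp h0, fun p' hp' h' => absurd ⟨p', hp', h'⟩ h1,
        fun p' hp' h' => absurd ⟨p', hp', h'⟩ h2⟩
    · obtain ⟨l, hl, h1⟩ := h1
      obtain ⟨e, he, h2⟩ := h2
      obtain ⟨p, hp, hpl⟩ := h.exists_point hl
      exact ⟨p, l, e, hp, hl, he, hpl, (inc_ln_pl hl he).1 (hF _ h1 _ h2),
        fun p' hp' h' => absurd ⟨p', hp', h'⟩ h0, uL hl h1, uE he h2⟩
    · obtain ⟨l, hl, h1⟩ := h1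
      obtain ⟨e, he, hle⟩ := h.exists_plane l hl
      obtain ⟨p, hp, hpl⟩ := h.exists_point hl
      exact ⟨p, l, e, hp, hl, he, hpl, hle, fun p' hp' h' => absurd ⟨p', hp', h'⟩ h0, uL hl h1,
        fun p' hp' h' => absurd ⟨p', hp', h'⟩ h2⟩
    · obtain ⟨e, he, h2⟩ := h2
      obtain ⟨l, hl, hle⟩ := h.exists_line_le e he
      obtain ⟨p, hp, hpl⟩ := h.exists_point hl
      exact ⟨p, l, e, hp, hl, he, hpl, hle, fun p' hp' h' => absurd ⟨p', hp', h'⟩ h0,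
        fun p' hp' h' => absurd ⟨p', hp', h'⟩ h1, uE he h2⟩
    · obtain ⟨p, hp⟩ := h.nonempty
      obtain ⟨l, hl, hpl⟩ := h.exists_line p hp
      obtain ⟨e, he, hle⟩ := h.exists_plane l hl
      exact ⟨p, l, e, hp, hl, he, hpl, hle, fun p' hp' h' => absurd ⟨p', hp', h'⟩ h0,
        fun p' hp' h' => absurd ⟨p', hp', h'⟩ h1, fun p' hp' h' => absurd ⟨p', hp', h'⟩ h2⟩
  obtain ⟨p, l, e, hp, hl, he, hpl, hle, Hp, Hl, He⟩ := key
  refine ⟨p, l, e, hp, hl, he, hpl, hle, fun x hx => ?_⟩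
  rcases elt_cases x with ⟨q, hq, rfl⟩ | ⟨q, hq, rfl⟩ | ⟨q, hq, rfl⟩
  · obtain rfl := Hp q hq hx
    exact Or.inl rfl
  · obtain rfl := Hl q hq hx
    exact Or.inr (Or.inl rfl)
  · obtain rfl := He q hq hx
    exact Or.inr (Or.inr rfl)

theorem isGeometry : (subspacePregeometry P L E R).IsGeometry := by
  intro F hF
  obtain ⟨p, l, e, hp, hl, he, hpl, hle, hsub⟩ := h.exists_chamber F hF
  refine ⟨_, h.isFlag_chamber hp hl he hpl hle, hsub, ?_⟩
  ext i
  simp only [Set.mem_univ, iff_true]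
  fin_cases i
  · exact ⟨pt hp, by simp, rfl⟩
  · exact ⟨ln hl, by simp, rfl⟩
  · exact ⟨pl he, by simp, rfl⟩

theorem finite_of_mem {l : Submodule K V} (hl : l ∈ L) : Module.Finite K l :=
  Module.finite_of_finrank_pos (by rw [h.dimL l hl]; norm_num)

theorem sup_eq {p q l : Submodule K V} (hp : p ∈ P) (hq : q ∈ P) (hl : l ∈ L) (hpq : p ≠ q)
    (h1 : p ≤ l) (h2 : q ≤ l) : p ⊔ q = l := by
  have := h.finite_of_mem hl
  refine Submodule.eq_of_le_of_finrank_le (sup_le h1 h2) ?_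
  have hf : Module.Finite K ↥(p ⊔ q) := Submodule.finiteDimensional_of_le (sup_le h1 h2)
  rw [h.dimL l hl]
  by_contra hlt
  have h3 : Module.finrank K p ≤ Module.finrank K ↥(p ⊔ q) :=
    Submodule.finrank_mono le_sup_left
  have h4 := h.dimP p hp
  have h5 := h.dimP q hq
  have e1 : p = p ⊔ q := Submodule.eq_of_le_of_finrank_le le_sup_left (by omega)
  have e2 : q = p ⊔ q := Submodule.eq_of_le_of_finrank_le le_sup_right (by omega)
  exact hpq (e1.trans e2.symm)

theorem ne_of_sup {p q : Submodule K V} (hp : p ∈ P) (hl : p ⊔ q ∈ L) : p ≠ q := by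
  rintro rfl
  rw [sup_idem] at hl
  have := h.dimP p hp
  have := h.dimL p hl
  omega

/-- Two lines of a plane share a point. -/
theorem exists_common {l m e : Submodule K V} (hl : l ∈ L) (hm : m ∈ L) (he : e ∈ E)
    (hle : l ≤ e) (hme : m ≤ e) : ∃ p ∈ P, p ≤ l ∧ p ≤ m := by
  have h1 := h.dimL l hl
  have h2 := h.dimL m hm
  have h3 := h.dimE e he
  have : Module.Finite K e := Module.finite_of_finrank_pos (by omega)
  have := h.finite_of_mem hl
  have := h.finite_of_mem hm
  have h4 := Submodule.finrank_sup_add_finrank_inf_eq l m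
  have h5 : Module.finrank K ↥(l ⊔ m) ≤ Module.finrank K e :=
    Submodule.finrank_mono (sup_le hle hme)
  have : l ⊓ m ≠ ⊥ := by
    intro hb
    rw [hb, finrank_bot] at h4
    omega
  obtain ⟨x, hx, hx0⟩ := (l ⊓ m).exists_mem_ne_zero_of_ne_bot this
  exact ⟨K ∙ x, h.point_mem l hl x hx.1 hx0, by simpa using hx.1, by simpa using hx.2⟩

/-- Connectedness follows if any two points are at distance at most two. -/
theorem connected (hc : ∀ p ∈ P, ∀ q ∈ P, ∃ s ∈ P, (p = s ∨ p ⊔ s ∈ L) ∧ (s = q ∨ s ⊔ q ∈ L)) :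
    (subspacePregeometry P L E R).Connected := by
  have adj : ∀ p q (hp : p ∈ P) (hq : q ∈ P), (p = q ∨ p ⊔ q ∈ L) →
      Relation.ReflTransGen (subspacePregeometry P L E R).inc (pt hp) (pt hq) := by
    rintro p q hp hq (rfl | hl)
    · exact .refl
    · exact .head ((inc_pt_ln hp hl).2 le_sup_left)
        (.single (inc_comm'.1 ((inc_pt_ln hq hl).2 le_sup_right)))
  have hpp : ∀ p q (hp : p ∈ P) (hq : q ∈ P),
      Relation.ReflTransGen (subspacePregeometry P L E R).inc (pt hp) (pt hq) := by
    intro p q hp hq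
    obtain ⟨s, hs, h1, h2⟩ := hc p hp q hq
    exact (adj _ _ hp hs h1).trans (adj _ _ hs hq h2)
  have hx : ∀ x : (subspacePregeometry P L E R).X, ∃ p, ∃ hp : p ∈ P,
      (subspacePregeometry P L E R).inc (pt hp) x := by
    intro x
    rcases elt_cases x with ⟨q, hq, rfl⟩ | ⟨q, hq, rfl⟩ | ⟨q, hq, rfl⟩
    · exact ⟨q, hq, Or.inl rfl⟩
    · obtain ⟨p, hp, hpq⟩ := h.exists_point hq
      exact ⟨p, hp, (inc_pt_ln hp hq).2 hpq⟩
    · obtain ⟨l, hl, hlq⟩ := h.exists_line_le q hq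
      obtain ⟨p, hp, hpl⟩ := h.exists_point hl
      exact ⟨p, hp, (inc_pt_pl hp hq).2 ((h.rel_iff p hp q hq).2 ⟨l, hl, hpl, hlq⟩)⟩
  obtain ⟨p0, hp0⟩ := h.nonempty
  refine ⟨⟨pt hp0⟩, fun x y => ?_⟩
  obtain ⟨p, hp, h1⟩ := hx x
  obtain ⟨q, hq, h2⟩ := hx y
  exact .head (inc_comm'.1 h1) ((hpp p q hp hq).tail h2)

open Classical in
/-- Simple connectivity reduces to edge cocycles on the collinearity graph of the points. -/
theorem simplyConnected
    (hc : ∀ p ∈ P, ∀ q ∈ P, ∃ s ∈ P, (p = s ∨ p ⊔ s ∈ L) ∧ (s = q ∨ s ⊔ q ∈ L))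
    (hpot : ∀ (G : Type u) [Group G] (Ψ : Submodule K V → Submodule K V → G),
      IsEdgeCocycle P L E Ψ → ∃ g : Submodule K V → G, ∀ p ∈ P, ∀ q ∈ P, p ⊔ q ∈ L →
        Ψ p q = (g p)⁻¹ * g q) :
    (subspacePregeometry P L E R).SimplyConnected := by
  refine Pregeometry.simplyConnected_of_cocycle (h.connected hc) fun G _ φ hφ => ?_
  let Ψ : Submodule K V → Submodule K V → G := fun p q =>
    if H : p ∈ P ∧ q ∈ P ∧ p ⊔ q ∈ L then
      φ (pt H.1) (ln H.2.2) * φ (ln H.2.2) (pt H.2.1) else 1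
  have hΨ : ∀ {p q l} (hp : p ∈ P) (hq : q ∈ P) (hl : l ∈ L), p ⊔ q = l →
      Ψ p q = φ (pt hp) (ln hl) * φ (ln hl) (pt hq) := by
    rintro p q l hp hq hl rfl
    exact dif_pos ⟨hp, hq, hl⟩
  have hpl : ∀ {p l} (hp : p ∈ P) (hl : l ∈ L), p ≤ l →
      (subspacePregeometry P L E R).inc (pt hp) (ln hl) := fun hp hl => (inc_pt_ln hp hl).2
  have hle : ∀ {l e} (hl : l ∈ L) (he : e ∈ E), l ≤ e →
      (subspacePregeometry P L E R).inc (ln hl) (pl he) := fun hl he => (inc_ln_pl hl he).2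
  have hpe : ∀ {p l e} (hp : p ∈ P) (_ : l ∈ L) (he : e ∈ E), p ≤ l → l ≤ e →
      (subspacePregeometry P L E R).inc (pt hp) (pl he) := fun hp hl he h1 h2 =>
    (inc_pt_pl hp he).2 ((h.rel_iff _ hp _ he).2 ⟨_, hl, h1, h2⟩)
  -- The value on two collinear points may also be computed through a plane that contains them.
  have hplane : ∀ {p q e} (hp : p ∈ P) (hq : q ∈ P) (_ : p ⊔ q ∈ L) (he : e ∈ E), p ≤ e → q ≤ e →
      Ψ p q = φ (pt hp) (pl he) * φ (pl he) (pt hq) := by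
    intro p q e hp hq hl he h1 h2
    rw [hΨ hp hq hl rfl, ← hφ.mul_eq (hpl hp hl le_sup_left) (hle hl he (sup_le h1 h2))
      (hpe hp hl he le_sup_left (sup_le h1 h2)), mul_assoc,
      hφ.mul_eq (hle hl he (sup_le h1 h2))
      (inc_comm'.1 (hpe hq hl he le_sup_right (sup_le h1 h2)))
      (inc_comm'.1 (hpl hq hl le_sup_right))]
  have hcancel : ∀ {x y : (subspacePregeometry P L E R).X} (m : G),
      (subspacePregeometry P L E R).inc x y → φ x y * (φ y x * m) = m := by
    intro x y m hxy
    rw [← mul_assoc, hφ.symm x y hxy, one_mul]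
  have hcoc : IsEdgeCocycle P L E Ψ := by
    refine ⟨fun p => ?_, fun p q => ?_, ?_⟩
    · refine dif_neg fun H => ?_
      exact h.ne_of_sup H.1 H.2.2 rfl
    · by_cases H : p ∈ P ∧ q ∈ P ∧ p ⊔ q ∈ L
      · rw [hΨ H.1 H.2.1 H.2.2 rfl, hΨ H.2.1 H.1 H.2.2 (sup_comm _ _), mul_assoc,
          hcancel _ (inc_comm'.1 (hpl _ _ le_sup_right)), hφ.symm _ _ (hpl _ _ le_sup_left)]
      · have H' : ¬ (q ∈ P ∧ p ∈ P ∧ q ⊔ p ∈ L) := fun H' =>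
          H ⟨H'.2.1, H'.1, by rw [sup_comm]; exact H'.2.2⟩
        simp only [Ψ]
        rw [dif_neg H, dif_neg H', one_mul]
    · rintro p hp q hq r hr hpq hqr hpr ⟨U, hU | hU, h1, h2, h3⟩
      · rw [hΨ hp hq hU (h.sup_eq hp hq hU (h.ne_of_sup hp hpq) h1 h2),
          hΨ hq hr hU (h.sup_eq hq hr hU (h.ne_of_sup hq hqr) h2 h3),
          hΨ hp hr hU (h.sup_eq hp hr hU (h.ne_of_sup hp hpr) h1 h3), mul_assoc,
          hcancel _ (inc_comm'.1 (hpl hq hU h2))]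
      · rw [hplane hp hq hpq hU h1 h2, hplane hq hr hqr hU h2 h3, hplane hp hr hpr hU h1 h3,
          mul_assoc, hcancel _ (inc_comm'.1 (hpe hq hqr hU le_sup_left (sup_le h2 h3)))]
  obtain ⟨g, hg⟩ := hpot G Ψ hcoc
  have indL : ∀ {p q l} (hp : p ∈ P) (hq : q ∈ P) (hl : l ∈ L), p ≤ l → q ≤ l →
      g p * φ (pt hp) (ln hl) = g q * φ (pt hq) (ln hl) := by
    intro p q l hp hq hl h1 h2
    by_cases hpq : p = q
    · subst hpq; rfl
    · have e := h.sup_eq hp hq hl hpq h1 h2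
      have h3 := hg p hp q hq (by rwa [e])
      rw [hΨ hp hq hl e] at h3
      have h4 := hφ.symm _ _ (hpl hq hl h2)
      have h5 : φ (ln hl) (pt hq) = (φ (pt hq) (ln hl))⁻¹ := eq_inv_of_mul_eq_one_right h4
      rw [h5] at h3
      rw [mul_inv_eq_iff_eq_mul] at h3
      rw [h3]; group
  -- Points of a plane lie on lines of the plane, and these have a point in common.
  have indE : ∀ {p q e} (hp : p ∈ P) (hq : q ∈ P) (he : e ∈ E), R p e → R q e →
      g p * φ (pt hp) (pl he) = g q * φ (pt hq) (pl he) := by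
    intro p q e hp hq he h1 h2
    obtain ⟨l, hl, hpl', hle'⟩ := (h.rel_iff _ hp _ he).1 h1
    obtain ⟨m, hm, hqm, hme⟩ := (h.rel_iff _ hq _ he).1 h2
    obtain ⟨s, hs, hsl, hsm⟩ := h.exists_common hl hm he hle' hme
    have step : ∀ {p q l} (hp : p ∈ P) (hq : q ∈ P) (hl : l ∈ L), p ≤ l → q ≤ l → l ≤ e →
        g p * φ (pt hp) (pl he) = g q * φ (pt hq) (pl he) := by
      intro p q l hp hq hl h1 h2 h3
      rw [← hφ.mul_eq (hpl hp hl h1) (hle hl he h3) (hpe hp hl he h1 h3),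
        ← hφ.mul_eq (hpl hq hl h2) (hle hl he h3) (hpe hq hl he h2 h3), ← mul_assoc, ← mul_assoc,
        indL hp hq hl h1 h2]
    exact (step hp hs hl hpl' hsl hle').trans (step hs hq hm hsm hqm hme)
  have ind : ∀ {p q} (hp : p ∈ P) (hq : q ∈ P) (x : (subspacePregeometry P L E R).X),
      (subspacePregeometry P L E R).inc (pt hp) x → (subspacePregeometry P L E R).inc (pt hq) x →
      g p * φ (pt hp) x = g q * φ (pt hq) x := by
    intro p q hp hq x h1 h2
    rcases elt_cases x with ⟨r, hr, rfl⟩ | ⟨r, hr, rfl⟩ | ⟨r, hr, rfl⟩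
    · rw [inc_pt_pt] at h1 h2
      subst h1; subst h2; rfl
    · exact indL hp hq hr ((inc_pt_ln _ _).1 h1) ((inc_pt_ln _ _).1 h2)
    · exact indE hp hq hr ((inc_pt_pl _ _).1 h1) ((inc_pt_pl _ _).1 h2)
  have hflag : ∀ x y : (subspacePregeometry P L E R).X, (subspacePregeometry P L E R).inc x y →
      ∃ p, ∃ hp : p ∈ P, (subspacePregeometry P L E R).inc (pt hp) x ∧
        (subspacePregeometry P L E R).inc (pt hp) y := by
    intro x y hxy
    obtain ⟨p, l, e, hp, hl, he, h1, h2, h3⟩ := h.exists_chamber {x, y} (by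
      rintro a (rfl | rfl) b (rfl | rfl)
      exacts [Or.inl rfl, hxy, inc_comm'.1 hxy, Or.inl rfl])
    have hfl := h.isFlag_chamber hp hl he h1 h2
    exact ⟨p, hp, hfl _ (by simp) _ (h3 (by simp)), hfl _ (by simp) _ (h3 (by simp))⟩
  -- The potential at an element is transported from any point incident with it.
  choose c hc1 hc2 using fun x => hflag x x (Or.inl rfl)
  refine ⟨fun x => g (c x) * φ (pt (hc1 x)) x, fun x y hxy => ?_⟩
  obtain ⟨p, hp, h1, h2⟩ := hflag x y hxy
  dsimp only
  rw [ind (hc1 x) hp x (hc2 x).1 h1, ind (hc1 y) hp y (hc2 y).1 h2,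
    ← hφ.mul_eq h1 hxy h2]
  group

end IsRankThree

end RankThree

/-! ### Groups acting on geometries of subspaces -/

section Action
variable {K V : Type u} [Field K] [AddCommGroup V] [Module K V]
  {P L E : Set (Submodule K V)} {R : Submodule K V → Submodule K V → Prop}

/-- An action of a group on subspaces that preserves the points, the lines, the planes and incidence
induces automorphisms of the geometry. -/
theorem exists_aut_hom {G : Type*} [Group G] (f : G → Submodule K V → Submodule K V)
    (hmem : ∀ g i U, U ∈ (![P, L, E] i : Set (Submodule K V)) →
      f g U ∈ (![P, L, E] i : Set (Submodule K V)))
    (hone : ∀ i, ∀ U ∈ (![P, L, E] i : Set (Submodule K V)), f 1 U = U)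
    (hmul : ∀ g h i, ∀ U ∈ (![P, L, E] i : Set (Submodule K V)), f (g * h) U = f g (f h U))
    (hmono : ∀ g U W, U ≤ W → f g U ≤ f g W)
    (hR : ∀ g, ∀ p ∈ P, ∀ e ∈ E, R p e → R (f g p) (f g e)) :
    ∃ ρ : G →* (subspacePregeometry P L E R).Aut, ∀ g (x : (subspacePregeometry P L E R).X),
      sub ((ρ g : Equiv.Perm (subspacePregeometry P L E R).X) x) = f g (sub x) := by
  let X := (subspacePregeometry P L E R).X
  let F : G → X → X := fun g x => ⟨x.1, ⟨f g x.2.1, hmem g x.1 _ x.2.2⟩⟩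
  have ext : ∀ {x y : X}, x.1 = y.1 → sub x = sub y → x = y := by
    rintro ⟨i, U, hU⟩ ⟨j, W, hW⟩ (rfl : i = j) (rfl : U = W)
    rfl
  have F1 : ∀ x, F 1 x = x := fun x => ext rfl (hone x.1 _ x.2.2)
  have Fm : ∀ g h x, F (g * h) x = F g (F h x) := fun g h x => ext rfl (hmul g h x.1 _ x.2.2)
  have Finc : ∀ g x y, (subspacePregeometry P L E R).inc x y →
      (subspacePregeometry P L E R).inc (F g x) (F g y) := by
    intro g x y h
    obtain ⟨p, hp, rfl⟩ | ⟨l, hl, rfl⟩ | ⟨e, he, rfl⟩ := elt_cases x <;>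
      obtain ⟨p', hp', rfl⟩ | ⟨l', hl', rfl⟩ | ⟨e', he', rfl⟩ := elt_cases y
    · obtain rfl := (inc_pt_pt hp hp').1 h
      exact Or.inl rfl
    · exact (inc_pt_ln (hmem g 0 _ hp) (hmem g 1 _ hl')).2 (hmono g _ _ ((inc_pt_ln hp hl').1 h))
    · exact (inc_pt_pl (hmem g 0 _ hp) (hmem g 2 _ he')).2
        (hR g _ hp _ he' ((inc_pt_pl hp he').1 h))
    · exact inc_comm'.1 ((inc_pt_ln (hmem g 0 _ hp') (hmem g 1 _ hl)).2
        (hmono g _ _ ((inc_pt_ln hp' hl).1 (inc_comm'.1 h))))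
    · obtain rfl := (inc_ln_ln hl hl').1 h
      exact Or.inl rfl
    · exact (inc_ln_pl (hmem g 1 _ hl) (hmem g 2 _ he')).2 (hmono g _ _ ((inc_ln_pl hl he').1 h))
    · exact inc_comm'.1 ((inc_pt_pl (hmem g 0 _ hp') (hmem g 2 _ he)).2
        (hR g _ hp' _ he ((inc_pt_pl hp' he).1 (inc_comm'.1 h))))
    · exact inc_comm'.1 ((inc_ln_pl (hmem g 1 _ hl') (hmem g 2 _ he)).2
        (hmono g _ _ ((inc_ln_pl hl' he).1 (inc_comm'.1 h))))
    · obtain rfl := (inc_pl_pl he he').1 h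
      exact Or.inl rfl
  have Fl : ∀ g x, F g⁻¹ (F g x) = x := fun g x => by rw [← Fm, inv_mul_cancel, F1]
  have Fr : ∀ g x, F g (F g⁻¹ x) = x := fun g x => by rw [← Fm, mul_inv_cancel, F1]
  let σ : G → (subspacePregeometry P L E R).Aut := fun g =>
    ⟨⟨F g, F g⁻¹, Fl g, Fr g⟩, fun x => rfl, fun x y => ⟨fun h => by
      have := Finc g⁻¹ _ _ h
      change (subspacePregeometry P L E R).inc (F g⁻¹ (F g x)) (F g⁻¹ (F g y)) at this
      rwa [Fl, Fl] at this, Finc g x y⟩⟩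
  refine ⟨⟨⟨σ, ?_⟩, ?_⟩, fun g x => rfl⟩
  · exact Subtype.ext (Equiv.ext F1)
  · exact fun g h => Subtype.ext (Equiv.ext (Fm g h))

/-- A group that is transitive on the incident triples of a point, a line and a plane is
flag-transitive. -/
theorem IsRankThree.flagTransitive (h : IsRankThree P L E R) {G : Type*} [Group G]
    (ρ : G →* (subspacePregeometry P L E R).Aut)
    (hρ : ∀ p ∈ P, ∀ l ∈ L, ∀ e ∈ E, ∀ p' ∈ P, ∀ l' ∈ L, ∀ e' ∈ E, p ≤ l → l ≤ e → p' ≤ l' →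
      l' ≤ e' → ∃ g, ∀ x : (subspacePregeometry P L E R).X,
        (sub x = p → sub ((ρ g : Equiv.Perm _) x) = p') ∧
        (sub x = l → sub ((ρ g : Equiv.Perm _) x) = l') ∧
        (sub x = e → sub ((ρ g : Equiv.Perm _) x) = e')) :
    (subspacePregeometry P L E R).FlagTransitive ρ := by
  intro F F' hF hF' ht
  obtain ⟨p, l, e, hp, hl, he, hpl, hle, hsub⟩ := h.exists_chamber F hF
  obtain ⟨p', l', e', hp', hl', he', hpl', hle', hsub'⟩ := h.exists_chamber F' hF'
  obtain ⟨g, hg⟩ := hρ p hp l hl e he p' hp' l' hl' e' he' hpl hle hpl' hle'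
  have ext : ∀ {x y : (subspacePregeometry P L E R).X}, x.1 = y.1 → sub x = sub y → x = y := by
    rintro ⟨i, U, hU⟩ ⟨j, W, hW⟩ (rfl : i = j) (rfl : U = W)
    rfl
  have gp : (ρ g : Equiv.Perm _) (pt hp) = pt hp' := ext ((ρ g).2.1 _) ((hg _).1 rfl)
  have gl : (ρ g : Equiv.Perm _) (ln hl) = ln hl' := ext ((ρ g).2.1 _) ((hg _).2.1 rfl)
  have ge : (ρ g : Equiv.Perm _) (pl he) = pl he' := ext ((ρ g).2.1 _) ((hg _).2.2 rfl)
  -- Corresponding elements of the two chambers have the same type.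
  have key : ∀ x ∈ ({pt hp, ln hl, pl he} : Set (subspacePregeometry P L E R).X),
      ∀ y ∈ ({pt hp', ln hl', pl he'} : Set (subspacePregeometry P L E R).X),
      (subspacePregeometry P L E R).typ x = (subspacePregeometry P L E R).typ y →
      (ρ g : Equiv.Perm _) x = y := by
    have h01 : (0 : Fin 3) ≠ 1 := by decide
    have h02 : (0 : Fin 3) ≠ 2 := by decide
    have h12 : (1 : Fin 3) ≠ 2 := by decide
    rintro x (rfl | rfl | rfl) y (rfl | rfl | rfl) hxy
    exacts [gp, absurd hxy h01, absurd hxy h02, absurd hxy h01.symm, gl, absurd hxy h12,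
      absurd hxy h02.symm, absurd hxy h12.symm, ge]
  refine ⟨g, Set.Subset.antisymm ?_ ?_⟩
  · rintro _ ⟨x, hx, rfl⟩
    obtain ⟨y, hy, hyx⟩ : (subspacePregeometry P L E R).typ x ∈
        (subspacePregeometry P L E R).typ '' F' := ht ▸ ⟨x, hx, rfl⟩
    rwa [key x (hsub hx) y (hsub' hy) hyx.symm]
  · intro y hy
    obtain ⟨x, hx, hxy⟩ : (subspacePregeometry P L E R).typ y ∈
        (subspacePregeometry P L E R).typ '' F := ht ▸ ⟨y, hy, rfl⟩
    exact ⟨x, hx, key x (hsub hx) y (hsub' hy) hxy⟩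

end Action

variable {K : Type u} [Field K]

/-! ### Subspaces of dimension at most three -/

section Subspaces
variable {W : Type*} [AddCommGroup W] [Module K W]

theorem span_range_pair (x y : W) : Submodule.span K (Set.range ![x, y]) = K ∙ x ⊔ K ∙ y := by
  rw [← Submodule.span_insert]
  congr 1
  ext z
  simp [eq_comm, or_comm]

theorem span_range_triple (x y z : W) :
    Submodule.span K (Set.range ![x, y, z]) = K ∙ x ⊔ K ∙ y ⊔ K ∙ z := by
  rw [sup_assoc, ← Submodule.span_insert, ← Submodule.span_insert]
  congr 1
  ext z
  simp [eq_comm]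
  tauto

theorem finrank_pair {x y : W} (h : LinearIndependent K ![x, y]) :
    Module.finrank K ↥(K ∙ x ⊔ K ∙ y) = 2 := by
  have := finrank_span_eq_card h
  rwa [span_range_pair] at this

theorem finrank_triple {x y z : W} (h : LinearIndependent K ![x, y, z]) :
    Module.finrank K ↥(K ∙ x ⊔ K ∙ y ⊔ K ∙ z) = 3 := by
  have := finrank_span_eq_card h
  rwa [span_range_triple] at this

theorem mem_pair {x y z : W} : z ∈ K ∙ x ⊔ K ∙ y ↔ ∃ a b : K, z = a • x + b • y := by
  rw [← Submodule.span_insert, Submodule.mem_span_pair]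
  simp only [eq_comm]

theorem mem_triple {x y z w : W} :
    w ∈ K ∙ x ⊔ K ∙ y ⊔ K ∙ z ↔ ∃ a b c : K, w = a • x + b • y + c • z := by
  rw [Submodule.mem_sup]
  constructor
  · rintro ⟨u, hu, v, hv, rfl⟩
    obtain ⟨a, b, rfl⟩ := mem_pair.1 hu
    obtain ⟨c, rfl⟩ := Submodule.mem_span_singleton.1 hv
    exact ⟨a, b, c, rfl⟩
  · rintro ⟨a, b, c, rfl⟩
    exact ⟨_, mem_pair.2 ⟨a, b, rfl⟩, _, Submodule.mem_span_singleton.2 ⟨c, rfl⟩, rfl⟩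

theorem left_mem_pair (x y : W) : x ∈ K ∙ x ⊔ K ∙ y := mem_pair.2 ⟨1, 0, by simp⟩
theorem right_mem_pair (x y : W) : y ∈ K ∙ x ⊔ K ∙ y := mem_pair.2 ⟨0, 1, by simp⟩

theorem exists_eq_span_singleton {p : Submodule K W} (h : Module.finrank K p = 1) :
    ∃ x, x ≠ 0 ∧ p = K ∙ x := by
  obtain ⟨⟨x, hx⟩, h0, h1⟩ := finrank_eq_one_iff'.1 h
  refine ⟨x, fun h => h0 (Subtype.ext h), le_antisymm (fun y hy => ?_) (by simpa)⟩
  obtain ⟨c, hc⟩ := h1 ⟨y, hy⟩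
  exact Submodule.mem_span_singleton.2 ⟨c, congrArg Subtype.val hc⟩

theorem exists_indep_mem {e : Submodule K W} (h : 1 < Module.finrank K e) {x : W} (hx : x ∈ e)
    (hx0 : x ≠ 0) : ∃ y ∈ e, LinearIndependent K ![x, y] := by
  have : Nontrivial e := Module.nontrivial_of_finrank_pos (R := K) (by omega)
  obtain ⟨y, hy⟩ := exists_linearIndependent_pair_of_one_lt_finrank h
    (x := (⟨x, hx⟩ : e)) (fun h => hx0 (congrArg Subtype.val h))
  refine ⟨y, y.2, ?_⟩
  rw [LinearIndependent.pair_iff] at hy ⊢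
  intro a b hab
  exact hy a b (Subtype.ext (by simpa using hab))

theorem eq_pair {l : Submodule K W} (h : Module.finrank K l = 2) {x y : W} (hx : x ∈ l)
    (hy : y ∈ l) (hxy : LinearIndependent K ![x, y]) : l = K ∙ x ⊔ K ∙ y := by
  have : Module.Finite K l := Module.finite_of_finrank_pos (by omega)
  exact (Submodule.eq_of_le_of_finrank_le (sup_le (by simpa) (by simpa))
    (by rw [h, finrank_pair hxy])).symm

theorem eq_triple {l : Submodule K W} (h : Module.finrank K l = 3) {x y z : W} (hx : x ∈ l)
    (hy : y ∈ l) (hz : z ∈ l) (hxy : LinearIndependent K ![x, y, z]) :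
    l = K ∙ x ⊔ K ∙ y ⊔ K ∙ z := by
  have : Module.Finite K l := Module.finite_of_finrank_pos (by omega)
  exact (Submodule.eq_of_le_of_finrank_le (sup_le (sup_le (by simpa) (by simpa)) (by simpa))
    (by rw [h, finrank_triple hxy])).symm

theorem exists_eq_pair {l : Submodule K W} (h : Module.finrank K l = 2) :
    ∃ x y, LinearIndependent K ![x, y] ∧ l = K ∙ x ⊔ K ∙ y := by
  have h0 : l ≠ ⊥ := by rintro rfl; simp at h
  obtain ⟨x, hx, hx0⟩ := l.exists_mem_ne_zero_of_ne_bot h0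
  obtain ⟨y, hy, hxy⟩ := exists_indep_mem (by omega) hx hx0
  exact ⟨x, y, hxy, eq_pair h hx hy hxy⟩

theorem exists_indep_pair {e : Submodule K W} (h : 1 < Module.finrank K e) :
    ∃ x ∈ e, ∃ y ∈ e, LinearIndependent K ![x, y] := by
  have h0 : e ≠ ⊥ := by rintro rfl; simp at h
  obtain ⟨x, hx, hx0⟩ := e.exists_mem_ne_zero_of_ne_bot h0
  obtain ⟨y, hy, hxy⟩ := exists_indep_mem h hx hx0
  exact ⟨x, hx, y, hy, hxy⟩

theorem indep_of_finrank_pair {x y : W} (h : Module.finrank K ↥(K ∙ x ⊔ K ∙ y) = 2) :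
    LinearIndependent K ![x, y] := by
  rw [linearIndependent_iff_card_eq_finrank_span, Set.finrank, span_range_pair, h]
  simp

theorem linearIndependent_triple {x y z : W}
    (h : ∀ a b c : K, a • x + b • y + c • z = 0 → a = 0 ∧ b = 0 ∧ c = 0) :
    LinearIndependent K ![x, y, z] := by
  rw [Fintype.linearIndependent_iff]
  intro g hg
  obtain ⟨h0, h1, h2⟩ := h (g 0) (g 1) (g 2) (by simpa [Fin.sum_univ_three] using hg)
  intro i; fin_cases i <;> assumption

variable (W) in
/-- A choice of representing vectors for the points of a projective space. -/
theorem exists_repr : ∃ r : Submodule K W → W,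
    ∀ p : Submodule K W, Module.finrank K p = 1 → p = K ∙ r p := by
  refine ⟨fun p => Classical.epsilon fun x => p = K ∙ x, fun p hp => ?_⟩
  obtain ⟨x, -, hx⟩ := exists_eq_span_singleton hp
  exact Classical.epsilon_spec (p := fun x => p = K ∙ x) ⟨x, hx⟩

end Subspaces

/-! ### The split octonion algebra -/

local infixl:70 " ⋆ " => zornMul

omit [Field K] in
theorem zorn_ext {x y : Zorn K} (h1 : x.1 = y.1) (h2 : x.2.1 0 = y.2.1 0)
    (h3 : x.2.1 1 = y.2.1 1) (h4 : x.2.1 2 = y.2.1 2) (h5 : x.2.2.1 0 = y.2.2.1 0)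
    (h6 : x.2.2.1 1 = y.2.2.1 1) (h7 : x.2.2.1 2 = y.2.2.1 2) (h8 : x.2.2.2 = y.2.2.2) :
    x = y := by
  refine Prod.ext h1 (Prod.ext ?_ (Prod.ext ?_ h8))
  · ext i; fin_cases i <;> assumption
  · ext i; fin_cases i <;> assumption

theorem zornMul_def (x y : Zorn K) : x ⋆ y =
    (x.1 * y.1 + (x.2.1 0 * y.2.2.1 0 + x.2.1 1 * y.2.2.1 1 + x.2.1 2 * y.2.2.1 2),
     ![x.1 * y.2.1 0 + y.2.2.2 * x.2.1 0 - (x.2.2.1 1 * y.2.2.1 2 - x.2.2.1 2 * y.2.2.1 1),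
       x.1 * y.2.1 1 + y.2.2.2 * x.2.1 1 - (x.2.2.1 2 * y.2.2.1 0 - x.2.2.1 0 * y.2.2.1 2),
       x.1 * y.2.1 2 + y.2.2.2 * x.2.1 2 - (x.2.2.1 0 * y.2.2.1 1 - x.2.2.1 1 * y.2.2.1 0)],
     ![y.1 * x.2.2.1 0 + x.2.2.2 * y.2.2.1 0 + (x.2.1 1 * y.2.1 2 - x.2.1 2 * y.2.1 1),
       y.1 * x.2.2.1 1 + x.2.2.2 * y.2.2.1 1 + (x.2.1 2 * y.2.1 0 - x.2.1 0 * y.2.1 2),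
       y.1 * x.2.2.1 2 + x.2.2.2 * y.2.2.1 2 + (x.2.1 0 * y.2.1 1 - x.2.1 1 * y.2.1 0)],
     x.2.2.2 * y.2.2.2 + (x.2.2.1 0 * y.2.1 0 + x.2.2.1 1 * y.2.1 1 + x.2.2.1 2 * y.2.1 2)) := by
  obtain ⟨a, v, w, b⟩ := x
  obtain ⟨a', v', w', b'⟩ := y
  apply zorn_ext <;>
    simp [zornMul, cross_apply, dotProduct, Fin.sum_univ_three, Matrix.vecHead, Matrix.vecTail]

/-- The trace of an octonion. -/
def tr (x : Zorn K) : K := x.1 + x.2.2.2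

/-- The norm of an octonion. -/
def nm (x : Zorn K) : K :=
  x.1 * x.2.2.2 - (x.2.1 0 * x.2.2.1 0 + x.2.1 1 * x.2.2.1 1 + x.2.1 2 * x.2.2.1 2)

/-- The polar form of the norm. -/
def pol (x y : Zorn K) : K :=
  x.1 * y.2.2.2 + x.2.2.2 * y.1
    - (x.2.1 0 * y.2.2.1 0 + x.2.1 1 * y.2.2.1 1 + x.2.1 2 * y.2.2.1 2)
    - (x.2.2.1 0 * y.2.1 0 + x.2.2.1 1 * y.2.1 1 + x.2.2.1 2 * y.2.1 2)

variable (K) in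
/-- The unit octonion. -/
def oct1 : Zorn K := (1, 0, 0, 1)

/-- Conjugation of octonions. -/
def cj (x : Zorn K) : Zorn K := (x.2.2.2, -x.2.1, -x.2.2.1, x.1)

theorem add_mul' (x y z : Zorn K) : (x + y) ⋆ z = x ⋆ z + y ⋆ z := by
  apply zorn_ext <;> simp [zornMul_def] <;> ring
theorem mul_add' (x y z : Zorn K) : x ⋆ (y + z) = x ⋆ y + x ⋆ z := by
  apply zorn_ext <;> simp [zornMul_def] <;> ring
theorem smul_mul' (c : K) (x y : Zorn K) : (c • x) ⋆ y = c • (x ⋆ y) := by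
  apply zorn_ext <;> simp [zornMul_def] <;> ring
theorem mul_smul' (c : K) (x y : Zorn K) : x ⋆ (c • y) = c • (x ⋆ y) := by
  apply zorn_ext <;> simp [zornMul_def] <;> ring
theorem neg_mul' (x y : Zorn K) : (-x) ⋆ y = -(x ⋆ y) := by
  apply zorn_ext <;> simp [zornMul_def] <;> ring
theorem mul_neg' (x y : Zorn K) : x ⋆ (-y) = -(x ⋆ y) := by
  apply zorn_ext <;> simp [zornMul_def] <;> ring
theorem sub_mul' (x y z : Zorn K) : (x - y) ⋆ z = x ⋆ z - y ⋆ z := by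
  rw [sub_eq_add_neg, add_mul', neg_mul', ← sub_eq_add_neg]
theorem mul_sub' (x y z : Zorn K) : x ⋆ (y - z) = x ⋆ y - x ⋆ z := by
  rw [sub_eq_add_neg, mul_add', mul_neg', ← sub_eq_add_neg]
theorem zero_mul' (x : Zorn K) : (0 : Zorn K) ⋆ x = 0 := by
  simpa using smul_mul' (0 : K) 0 x
theorem mul_zero' (x : Zorn K) : x ⋆ (0 : Zorn K) = 0 := by
  simpa using mul_smul' (0 : K) x 0
theorem one_mul' (x : Zorn K) : oct1 K ⋆ x = x := by
  apply zorn_ext <;> simp [zornMul_def, oct1]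
theorem mul_one' (x : Zorn K) : x ⋆ oct1 K = x := by
  apply zorn_ext <;> simp [zornMul_def, oct1]

theorem cj_cj (x : Zorn K) : cj (cj x) = x := by simp [cj]
theorem cj_add (x y : Zorn K) : cj (x + y) = cj x + cj y := by
  apply zorn_ext <;> simp [cj] <;> ring
theorem cj_smul (c : K) (x : Zorn K) : cj (c • x) = c • cj x := by
  apply zorn_ext <;> simp [cj]
theorem cj_mul (x y : Zorn K) : cj (x ⋆ y) = cj y ⋆ cj x := by
  apply zorn_ext <;> simp [cj, zornMul_def] <;> ring
theorem cj_eq (x : Zorn K) : cj x = tr x • oct1 K - x := by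
  apply zorn_ext <;> simp [cj, tr, oct1]
theorem cj_of_tr {x : Zorn K} (h : tr x = 0) : cj x = -x := by
  rw [cj_eq, h]; simp
theorem mul_cj (x : Zorn K) : x ⋆ cj x = nm x • oct1 K := by
  apply zorn_ext <;> simp [cj, zornMul_def, nm, oct1] <;> ring
theorem sq_eq (x : Zorn K) : x ⋆ x = tr x • x - nm x • oct1 K := by
  apply zorn_ext <;> simp [tr, zornMul_def, nm, oct1] <;> ring
theorem mul_cj_add (x y : Zorn K) : x ⋆ cj y + y ⋆ cj x = pol x y • oct1 K := by
  apply zorn_ext <;> simp [cj, zornMul_def, pol, oct1] <;> ring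
theorem mul_mul_cj_add (x y z : Zorn K) :
    x ⋆ (cj y ⋆ z) + y ⋆ (cj x ⋆ z) = pol x y • z := by
  apply zorn_ext <;> simp [cj, zornMul_def, pol] <;> ring
theorem left_alt (x y : Zorn K) : x ⋆ (x ⋆ y) = (x ⋆ x) ⋆ y := by
  apply zorn_ext <;> simp [zornMul_def] <;> ring
theorem right_alt (x y : Zorn K) : (y ⋆ x) ⋆ x = y ⋆ (x ⋆ x) := by
  apply zorn_ext <;> simp [zornMul_def] <;> ring
theorem moufang (x y z : Zorn K) : (z ⋆ x) ⋆ (y ⋆ z) = (z ⋆ (x ⋆ y)) ⋆ z := by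
  apply zorn_ext <;> simp [zornMul_def] <;> ring
theorem nm_mul (x y : Zorn K) : nm (x ⋆ y) = nm x * nm y := by
  simp [zornMul_def, nm]; ring
theorem tr_mul_cj (x y : Zorn K) : tr (x ⋆ cj y) = pol x y := by
  simp [zornMul_def, tr, cj, pol]; ring
theorem nm_add (x y : Zorn K) : nm (x + y) = nm x + nm y + pol x y := by
  simp [nm, pol]; ring
theorem nm_smul (c : K) (x : Zorn K) : nm (c • x) = c ^ 2 * nm x := by
  simp [nm]; ring
theorem tr_add (x y : Zorn K) : tr (x + y) = tr x + tr y := by simp [tr]; ring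
theorem tr_smul (c : K) (x : Zorn K) : tr (c • x) = c * tr x := by simp [tr]; ring
theorem tr_neg (x : Zorn K) : tr (-x) = -tr x := by simp [tr]; ring
theorem pol_comm (x y : Zorn K) : pol x y = pol y x := by simp [pol]; ring
theorem pol_add_left (x y z : Zorn K) : pol (x + y) z = pol x z + pol y z := by
  simp [pol]; ring
theorem pol_smul_left (c : K) (x z : Zorn K) : pol (c • x) z = c * pol x z := by
  simp [pol]; ring
theorem pol_neg_left (x z : Zorn K) : pol (-x) z = -pol x z := by
  simp [pol]; ring
theorem pol_neg_right (x z : Zorn K) : pol x (-z) = -pol x z := by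
  simp [pol]; ring
theorem pol_one (x : Zorn K) : pol (oct1 K) x = tr x := by
  simp [pol, oct1, tr]; ring

theorem eq_zero_of_pol {x : Zorn K} (h : ∀ y, pol x y = 0) : x = 0 := by
  apply zorn_ext
  · simpa [pol] using h (0, 0, 0, 1)
  · simpa [pol] using h (0, 0, ![1, 0, 0], 0)
  · simpa [pol] using h (0, 0, ![0, 1, 0], 0)
  · simpa [pol] using h (0, 0, ![0, 0, 1], 0)
  · simpa [pol] using h (0, ![1, 0, 0], 0, 0)
  · simpa [pol] using h (0, ![0, 1, 0], 0, 0)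
  · simpa [pol] using h (0, ![0, 0, 1], 0, 0)
  · simpa [pol] using h (1, 0, 0, 0)

/-! ### Elements of `G₂(K)` by the Cayley–Dickson process -/

section CayleyDickson

/-- The span of `X ⋆ W`, `X`, `W`, `W ⋆ X`: the image of the matrix with rows `(a, b)`, `(c, d)`
under the algebra embedding `E₁₂ ↦ X`, `E₂₁ ↦ W` of the two-by-two matrices, for isotropic `X`
and `W` of trace `0` with `X ⋆ W + W ⋆ X = 1`. -/
def quat (X W : Zorn K) (a b c d : K) : Zorn K :=
  a • (X ⋆ W) + b • X + c • W + d • (W ⋆ X)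

variable {X W k : Zorn K}

theorem quat_mul (hX : X ⋆ X = 0) (hW : W ⋆ W = 0) (hXW : X ⋆ W + W ⋆ X = oct1 K)
    (a b c d a' b' c' d' : K) :
    quat X W a b c d ⋆ quat X W a' b' c' d' =
      quat X W (a * a' + b * c') (a * b' + b * d') (c * a' + d * c') (c * b' + d * d') := by
  have e1 : X ⋆ (X ⋆ W) = 0 := by rw [left_alt, hX, zero_mul']
  have e2 : W ⋆ (W ⋆ X) = 0 := by rw [left_alt, hW, zero_mul']
  have e3 : (X ⋆ W) ⋆ W = 0 := by rw [right_alt, hW, mul_zero']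
  have e4 : (W ⋆ X) ⋆ X = 0 := by rw [right_alt, hX, mul_zero']
  have f1 : W ⋆ X = oct1 K - X ⋆ W := eq_sub_of_add_eq' hXW
  have f2 : X ⋆ W = oct1 K - W ⋆ X := eq_sub_of_add_eq hXW
  have e5 : X ⋆ (W ⋆ X) = X := by rw [f1, mul_sub', mul_one', e1, sub_zero]
  have e6 : W ⋆ (X ⋆ W) = W := by rw [f2, mul_sub', mul_one', e2, sub_zero]
  have e7 : (X ⋆ W) ⋆ X = X := by rw [f2, sub_mul', one_mul', e4, sub_zero]
  have e8 : (W ⋆ X) ⋆ W = W := by rw [f1, sub_mul', one_mul', e3, sub_zero]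
  have e9 : (X ⋆ W) ⋆ (W ⋆ X) = 0 := by rw [moufang, hW, mul_zero', zero_mul']
  have e10 : (W ⋆ X) ⋆ (X ⋆ W) = 0 := by rw [moufang, hX, mul_zero', zero_mul']
  have e11 : (X ⋆ W) ⋆ (X ⋆ W) = X ⋆ W := by
    have := congrArg (· ⋆ (X ⋆ W)) hXW
    simpa only [add_mul', e10, add_zero, one_mul'] using this
  have e12 : (W ⋆ X) ⋆ (W ⋆ X) = W ⋆ X := by
    have := congrArg (· ⋆ (W ⋆ X)) hXW
    simpa only [add_mul', e9, zero_add, one_mul'] using this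
  simp only [quat, add_mul', mul_add', smul_mul', mul_smul', hX, hW, e1, e2, e3, e4, e5, e6, e7,
    e8, e9, e10, e11, e12]
  module

theorem quat_add (a b c d a' b' c' d' : K) : quat X W a b c d + quat X W a' b' c' d' =
    quat X W (a + a') (b + b') (c + c') (d + d') := by
  simp only [quat]; module

theorem quat_smul (r a b c d : K) : r • quat X W a b c d =
    quat X W (r * a) (r * b) (r * c) (r * d) := by
  simp only [quat]; module

theorem cj_quat (hX : tr X = 0) (hW : tr W = 0) (a b c d : K) :
    cj (quat X W a b c d) = quat X W d (-b) (-c) a := by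
  simp only [quat, cj_add, cj_smul, cj_mul, cj_of_tr hX, cj_of_tr hW, neg_mul', mul_neg']
  module

theorem pol_quat (hXW : X ⋆ W + W ⋆ X = oct1 K) (hk : tr k = 0) (h1 : pol X k = 0)
    (h2 : pol W k = 0) (h3 : pol (X ⋆ W) k = 0) (a b c d : K) :
    pol (quat X W a b c d) k = 0 := by
  have h4 : pol (W ⋆ X) k = 0 := by
    have := pol_add_left (X ⋆ W) (W ⋆ X) k
    rw [hXW, pol_one, hk, h3, zero_add] at this
    exact this.symm
  simp only [quat, pol_add_left, pol_smul_left, h1, h2, h3, h4]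
  ring

/-! The multiplication rules of the Cayley–Dickson double: `a` and `b` range over a quaternion
algebra orthogonal to the element `k` of trace zero. -/

theorem mul_comm_cj (hk : tr k = 0) {b : Zorn K} (hb : pol b k = 0) : b ⋆ k = k ⋆ cj b := by
  have := mul_cj_add b (cj k)
  rw [cj_cj, cj_of_tr hk, pol_neg_right, hb, neg_mul'] at this
  simpa [add_neg_eq_zero] using this

theorem mul_mul_perp (hk : tr k = 0) {a b : Zorn K} (ha : pol a k = 0) (hb : pol b k = 0)
    (hab : pol (b ⋆ a) k = 0) : a ⋆ (b ⋆ k) = (b ⋆ a) ⋆ k := by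
  have := mul_mul_cj_add a (cj k) (cj b)
  rw [cj_cj, cj_of_tr hk, pol_neg_right, ha, neg_mul', ← cj_mul, ← mul_comm_cj hk hab,
    ← mul_comm_cj hk hb] at this
  simpa [add_neg_eq_zero] using this

theorem perp_mul_mul (hk : tr k = 0) {a b : Zorn K} (ha : pol (cj a) k = 0) (hb : pol b k = 0)
    (hab : pol (b ⋆ cj a) k = 0) : (b ⋆ k) ⋆ a = (b ⋆ cj a) ⋆ k := by
  have h1 : ∀ {c : Zorn K}, pol c k = 0 → cj (c ⋆ k) = -(c ⋆ k) := fun {c} hc => by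
    apply cj_of_tr
    have := tr_mul_cj c (cj k)
    rw [cj_cj, cj_of_tr hk, pol_neg_right, hc] at this
    simpa using this
  have h2 := mul_mul_perp hk ha hb hab
  rw [← cj_cj ((b ⋆ k) ⋆ a), cj_mul, h1 hb, mul_neg', h2, ← h1 hab, cj_cj]

theorem perp_mul_perp (hk : tr k = 0) (hk1 : nm k = 1) {a b : Zorn K} (ha : pol a k = 0)
    (hab : pol (cj b ⋆ a) k = 0) : (a ⋆ k) ⋆ (b ⋆ k) = -(cj b ⋆ a) := by
  have h1 := mul_comm_cj hk hab
  rw [mul_comm_cj hk ha, moufang]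
  rw [cj_mul, cj_cj] at h1
  rw [← h1, right_alt, sq_eq, hk, hk1]
  simp [mul_neg', mul_one']

/-- The linear map that sends the standard generators `v₀`, `w₀`, `v₁ - w₁` of the octonions to
`X`, `W`, `k`: the octonions are the sum of the quaternion algebra generated by `X` and `W` and its
right translate by `k`. -/
def cdMap (X W k : Zorn K) : Zorn K →ₗ[K] Zorn K where
  toFun z := quat X W z.1 (z.2.1 0) (z.2.2.1 0) z.2.2.2 +
    quat X W (z.2.1 1) (z.2.2.1 2) (z.2.1 2) (-z.2.2.1 1) ⋆ k
  map_add' x y := by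
    simp only [Prod.fst_add, Prod.snd_add, Pi.add_apply, neg_add, ← quat_add, add_mul']
    module
  map_smul' c x := by
    simp only [Prod.smul_fst, Prod.smul_snd, Pi.smul_apply, smul_eq_mul, ← mul_neg, ← quat_smul,
      smul_mul', RingHom.id_apply, smul_add]

/-- The map `cdMap X W k` is an automorphism of the octonions if `X` and `W` are isotropic and
generate a quaternion algebra and `k` is a unit vector orthogonal to it: by the multiplication rules
of the double it is multiplicative, so it preserves the norm and is injective. -/
theorem exists_mem_G2 (hX : X ⋆ X = 0) (hW : W ⋆ W = 0) (hXW : X ⋆ W + W ⋆ X = oct1 K)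
    (hX0 : tr X = 0) (hW0 : tr W = 0) (hk : tr k = 0) (h1 : pol X k = 0)
    (h2 : pol W k = 0) (h3 : pol (X ⋆ W) k = 0) (hk1 : nm k = 1) :
    ∃ g : G2 K, ∀ z, (g : Zorn K ≃ₗ[K] Zorn K) z = cdMap X W k z := by
  have hpol := pol_quat hXW hk h1 h2 h3
  have hmul : ∀ x y, cdMap X W k (x ⋆ y) = cdMap X W k x ⋆ cdMap X W k y := by
    intro x y
    have r2 := fun a b c d a' b' c' d' => mul_mul_perp hk (hpol a b c d) (hpol a' b' c' d')
      (by rw [quat_mul hX hW hXW]; exact hpol _ _ _ _)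
    have r3 := fun a b c d a' b' c' d' => perp_mul_mul hk (a := quat X W a b c d)
      (by rw [cj_quat hX0 hW0]; exact hpol _ _ _ _) (hpol a' b' c' d')
      (by rw [cj_quat hX0 hW0, quat_mul hX hW hXW]; exact hpol _ _ _ _)
    have r4 := fun a b c d a' b' c' d' => perp_mul_perp hk hk1 (b := quat X W a b c d)
      (hpol a' b' c' d')
      (by rw [cj_quat hX0 hW0, quat_mul hX hW hXW]; exact hpol _ _ _ _)
    simp only [cdMap, LinearMap.coe_mk, AddHom.coe_mk, add_mul', mul_add', r2, r3, r4,
      quat_mul hX hW hXW, cj_quat hX0 hW0]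
    have regroup : ∀ a b c d : Zorn K, a + b + (c + d) = (a + d) + (b + c) := fun _ _ _ _ => by
      abel
    -- Both sides are now a quaternion plus a quaternion times `k`.
    rw [regroup, ← add_mul', ← neg_one_smul K (quat X W _ _ _ _), quat_smul, quat_add, quat_add,
      zornMul_def]
    congr 1
    · congr 1 <;> simp <;> ring
    · congr 2 <;> simp <;> ring
  have hone : cdMap X W k (oct1 K) = oct1 K := by
    have : quat X W 0 0 0 0 = 0 := by simp [quat]
    simp [cdMap, oct1, this, zero_mul']
    simpa [quat, oct1] using hXW
  have hcj : ∀ x, cj (cdMap X W k x) = cdMap X W k (cj x) := by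
    intro x
    have e : ∀ a b c d, cj (quat X W a b c d ⋆ k) = -(quat X W a b c d ⋆ k) := by
      intro a b c d
      apply cj_of_tr
      have := tr_mul_cj (quat X W a b c d) (cj k)
      rw [cj_cj, cj_of_tr hk, pol_neg_right, hpol] at this
      simpa using this
    simp only [cdMap, LinearMap.coe_mk, AddHom.coe_mk, cj_add, e, cj_quat hX0 hW0]
    rw [← neg_mul', ← neg_one_smul K (quat X W (x.2.1 1) _ _ _), quat_smul]
    simp [cj]
  have hnm : ∀ x, nm (cdMap X W k x) = nm x := by
    intro x
    have := mul_cj (cdMap X W k x)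
    rw [hcj, ← hmul, mul_cj, map_smul, hone] at this
    simpa [oct1] using (congrArg (fun z : Zorn K => z.1) this).symm
  have hinj : Function.Injective (cdMap X W k) := by
    rw [← LinearMap.ker_eq_bot, LinearMap.ker_eq_bot']
    intro x hx
    apply eq_zero_of_pol
    intro y
    have e1 := nm_add x y
    rw [← hnm (x + y), map_add, ← hnm x, hx, zero_add, hnm] at e1
    have e2 : nm (0 : Zorn K) = 0 := by simp [nm]
    rw [e2, zero_add] at e1
    simpa using e1
  exact ⟨⟨LinearEquiv.ofInjectiveEndo _ hinj, fun x y => by simpa using hmul x y⟩,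
    fun z => by simp⟩

end CayleyDickson

/-! ### The action of `G₂(K)` on the octonions of trace zero -/

theorem pol_mul_left (x y z : Zorn K) : pol (x ⋆ y) z = pol y (cj x ⋆ z) := by
  simp [pol, zornMul_def, cj]; ring

theorem pol_mul_right_right (x y z : Zorn K) : pol (x ⋆ z) (y ⋆ z) = pol x y * nm z := by
  simp [pol, zornMul_def, nm]; ring

theorem pol_self (x : Zorn K) : pol x x = 2 * nm x := by
  simp [pol, nm]; ring

theorem G2.mul (g : G2 K) (x y : Zorn K) :
    (g : Zorn K ≃ₗ[K] Zorn K) (x ⋆ y) = (g : Zorn K ≃ₗ[K] Zorn K) x ⋆ (g : Zorn K ≃ₗ[K] Zorn K) y :=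
  g.2 x y

theorem G2.one (g : G2 K) : (g : Zorn K ≃ₗ[K] Zorn K) (oct1 K) = oct1 K := by
  obtain ⟨z, hz⟩ := (g : Zorn K ≃ₗ[K] Zorn K).surjective (oct1 K)
  have := G2.mul g (oct1 K) z
  rwa [one_mul', hz, mul_one', eq_comm] at this

/-- An automorphism respects the quadratic equation of an element, hence trace and norm. -/
theorem G2.tr_nm (g : G2 K) (x : Zorn K) :
    tr ((g : Zorn K ≃ₗ[K] Zorn K) x) = tr x ∧ nm ((g : Zorn K ≃ₗ[K] Zorn K) x) = nm x := by
  set y := (g : Zorn K ≃ₗ[K] Zorn K) x with hy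
  have h1 : y ⋆ y = tr x • y - nm x • oct1 K := by
    rw [hy, ← G2.mul, sq_eq, map_sub, map_smul, map_smul, G2.one]
  rw [sq_eq] at h1
  have h2 : (tr y - tr x) • y = (nm y - nm x) • oct1 K := by
    rw [sub_smul, sub_smul]
    linear_combination (exp := 1) h1
  -- If the traces differ then `y`, and with it `x`, is a scalar, which is fixed by `g`.
  have h3 : tr y = tr x := by
    by_contra hne
    have hne' : tr y - tr x ≠ 0 := sub_ne_zero.2 hne
    have h4 : y = ((tr y - tr x)⁻¹ * (nm y - nm x)) • oct1 K := by
      rw [mul_smul, ← h2, smul_smul, inv_mul_cancel₀ hne', one_smul]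
    generalize (tr y - tr x)⁻¹ * (nm y - nm x) = c at h4
    have h5 : x = c • oct1 K := by
      apply (g : Zorn K ≃ₗ[K] Zorn K).injective
      rw [map_smul, G2.one, ← h4]
    exact hne (by rw [h4, h5])
  refine ⟨h3, ?_⟩
  rw [h3, sub_self, zero_smul] at h2
  have := congrArg (fun z : Zorn K => z.1) h2
  simp only [Prod.smul_fst, oct1, smul_eq_mul, mul_one, Prod.fst_zero] at this
  exact (sub_eq_zero.1 this.symm)

theorem toZorn_def (x : V K) :
    toZorn K x = (-x 3, ![x 0, x 1, x 2], ![-x 4, -x 5, -x 6], x 3) := by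
  apply zorn_ext <;> simp [toZorn]

variable (K) in
/-- The left inverse of `toZorn` that reads off the coordinates. -/
def fromZorn : Zorn K →ₗ[K] V K where
  toFun z := ![z.2.1 0, z.2.1 1, z.2.1 2, z.2.2.2, -z.2.2.1 0, -z.2.2.1 1, -z.2.2.1 2]
  map_add' x y := by
    ext i; fin_cases i <;> simp <;> ring
  map_smul' c x := by
    ext i; fin_cases i <;> simp

theorem fromZorn_toZorn (x : V K) : fromZorn K (toZorn K x) = x := by
  ext i; fin_cases i <;> simp [fromZorn, toZorn_def]

theorem toZorn_fromZorn {z : Zorn K} (h : tr z = 0) : toZorn K (fromZorn K z) = z := by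
  have h' : z.1 = -z.2.2.2 := eq_neg_of_add_eq_zero_left h
  apply zorn_ext <;> simp [fromZorn, toZorn_def, h']

theorem toZorn_injective : Function.Injective (toZorn K) :=
  Function.LeftInverse.injective fromZorn_toZorn

theorem tr_toZorn (x : V K) : tr (toZorn K x) = 0 := by simp [tr, toZorn_def]

theorem nm_toZorn (x : V K) : nm (toZorn K x) = quad x := by
  simp [nm, toZorn_def, quad]; ring

theorem form_def (x y : V K) : form x y =
    x 0 * y 4 + x 4 * y 0 + x 1 * y 5 + x 5 * y 1 + x 2 * y 6 + x 6 * y 2 - 2 * x 3 * y 3 := by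
  simp [form, quad]; ring

theorem pol_toZorn (x y : V K) : pol (toZorn K x) (toZorn K y) = form x y := by
  simp [pol, toZorn_def, form_def]; ring

/-- The invariant alternating trilinear form on the octonions of trace zero. -/
def tri (x y z : V K) : K := tr (toZorn K x ⋆ (toZorn K y ⋆ toZorn K z))

/-- The relation `x y = 0` between octonions of trace zero; for distinct points of the quadric it
means that they lie on a common hexagon line. -/
def Hex (x y : V K) : Prop := toZorn K x ⋆ toZorn K y = 0

theorem tri_def (x y z : V K) : tri x y z =
    (x 0 * (y 1 * z 2 - y 2 * z 1) - x 1 * (y 0 * z 2 - y 2 * z 0) +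
      x 2 * (y 0 * z 1 - y 1 * z 0)) +
    (x 4 * (y 5 * z 6 - y 6 * z 5) - x 5 * (y 4 * z 6 - y 6 * z 4) +
      x 6 * (y 4 * z 5 - y 5 * z 4)) +
    (x 3 * (y 0 * z 4 - y 4 * z 0 + y 1 * z 5 - y 5 * z 1 + y 2 * z 6 - y 6 * z 2) -
     y 3 * (x 0 * z 4 - x 4 * z 0 + x 1 * z 5 - x 5 * z 1 + x 2 * z 6 - x 6 * z 2) +
     z 3 * (x 0 * y 4 - x 4 * y 0 + x 1 * y 5 - x 5 * y 1 + x 2 * y 6 - x 6 * y 2)) := by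
  simp [tri, tr, toZorn_def, zornMul_def]; ring

theorem tri_eq_pol (x y z : V K) : tri x y z = -pol (toZorn K x ⋆ toZorn K y) (toZorn K z) := by
  simp [tri, tr, pol, toZorn_def, zornMul_def]; ring

theorem hex_iff (x y : V K) : Hex x y ↔
    (x 3 * y 3 = x 0 * y 4 + x 1 * y 5 + x 2 * y 6 ∧
     x 3 * y 3 = x 4 * y 0 + x 5 * y 1 + x 6 * y 2) ∧
    grass x y 1 2 = grass x y 3 4 ∧ grass x y 5 6 = grass x y 0 3 ∧
    grass x y 4 5 = grass x y 2 3 ∧ grass x y 0 1 = grass x y 3 6 ∧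
    grass x y 0 2 = -grass x y 3 5 ∧ grass x y 4 6 = -grass x y 1 3 := by
  unfold Hex grass
  constructor
  · intro h
    rw [zornMul_def, toZorn_def, toZorn_def] at h
    have c1 := congrArg (fun z : Zorn K => z.1) h
    have c2 := congrArg (fun z : Zorn K => z.2.1 0) h
    have c3 := congrArg (fun z : Zorn K => z.2.1 1) h
    have c4 := congrArg (fun z : Zorn K => z.2.1 2) h
    have c5 := congrArg (fun z : Zorn K => z.2.2.1 0) h
    have c6 := congrArg (fun z : Zorn K => z.2.2.1 1) h
    have c7 := congrArg (fun z : Zorn K => z.2.2.1 2) h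
    have c8 := congrArg (fun z : Zorn K => z.2.2.2) h
    simp at c1 c2 c3 c4 c5 c6 c7 c8
    refine ⟨⟨?_, ?_⟩, ?_, ?_, ?_, ?_, ?_, ?_⟩
    · linear_combination c1
    · linear_combination c8
    · linear_combination c5
    · linear_combination -c2
    · linear_combination -c4
    · linear_combination c7
    · linear_combination -c6
    · linear_combination c3
  · rintro ⟨⟨c1, c8⟩, c5, c2, c4, c7, c6, c3⟩
    rw [zornMul_def, toZorn_def, toZorn_def]
    apply zorn_ext <;> simp
    · linear_combination c1
    · linear_combination -c2
    · linear_combination c3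
    · linear_combination -c4
    · linear_combination c5
    · linear_combination -c6
    · linear_combination c7
    · linear_combination c8

/-- For points of a line of the quadric the equations in Grassmannian coordinates imply that the
product vanishes. -/
theorem hex_of_grass {x y : V K} (hx : quad x = 0) (hxy : form x y = 0)
    (h : grass x y 1 2 = grass x y 3 4 ∧ grass x y 5 6 = grass x y 0 3 ∧
    grass x y 4 5 = grass x y 2 3 ∧ grass x y 0 1 = grass x y 3 6 ∧
    grass x y 0 2 = -grass x y 3 5 ∧ grass x y 4 6 = -grass x y 1 3) : Hex x y := by
  rw [hex_iff]
  refine ⟨?_, h⟩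
  -- The norm of the product is zero, and only its diagonal entries, opposite to each other, are
  -- still in question.
  have h0 := nm_mul (toZorn K x) (toZorn K y)
  rw [nm_toZorn, hx, zero_mul] at h0
  unfold grass at h
  obtain ⟨c5, c2, c4, c7, c6, c3⟩ := h
  rw [form_def] at hxy
  rw [zornMul_def, toZorn_def, toZorn_def, nm] at h0
  simp at h0
  have d : (x 3 * y 3 - (x 0 * y 4 + x 1 * y 5 + x 2 * y 6)) *
      (x 3 * y 3 - (x 0 * y 4 + x 1 * y 5 + x 2 * y 6)) = 0 := by
    have e2 : -(x 3 * y 0) + y 3 * x 0 - (x 5 * y 6 - x 6 * y 5) = 0 := by linear_combination -c2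
    have e3 : -(x 3 * y 1) + y 3 * x 1 - (x 6 * y 4 - x 4 * y 6) = 0 := by linear_combination c3
    have e4 : -(x 3 * y 2) + y 3 * x 2 - (x 4 * y 5 - x 5 * y 4) = 0 := by linear_combination -c4
    rw [e2, e3, e4] at h0
    linear_combination -h0 -
      (x 3 * y 3 - (x 0 * y 4 + x 1 * y 5 + x 2 * y 6)) * hxy
  have d2 := mul_self_eq_zero.1 d
  exact ⟨by linear_combination d2, by linear_combination -d2 - hxy⟩

/-- The hexagon lines are the two-dimensional spaces of octonions of trace zero with zero
multiplication. -/
theorem isHexagonLine_iff (U : Submodule K (V K)) :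
    IsHexagonLine U ↔ Module.finrank K U = 2 ∧ ∀ x ∈ U, ∀ y ∈ U, Hex x y := by
  constructor
  · rintro ⟨h1, h2, h3⟩
    refine ⟨h1, fun x hx y hy => hex_of_grass (h2 x hx) ?_ (h3 x hx y hy)⟩
    rw [form, h2 _ (U.add_mem hx hy), h2 x hx, h2 y hy]; ring
  · rintro ⟨h1, h2⟩
    refine ⟨h1, fun x hx => ?_, fun x hx y hy => ((hex_iff x y).1 (h2 x hx y hy)).2⟩
    have := h2 x hx x hx
    rw [Hex, sq_eq, tr_toZorn, nm_toZorn] at this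
    have := congrArg (fun z : Zorn K => z.1) this
    simpa [oct1] using this

theorem form_self (x : V K) : form x x = 2 * quad x := by
  simp [form_def, quad]; ring
theorem form_comm (x y : V K) : form x y = form y x := by simp [form_def]; ring
theorem form_add_left (x y z : V K) : form (x + y) z = form x z + form y z := by
  simp [form_def]; ring
theorem form_add_right (x y z : V K) : form x (y + z) = form x y + form x z := by
  simp [form_def]; ring
theorem form_smul_left (c : K) (x z : V K) : form (c • x) z = c * form x z := by
  simp [form_def]; ring
theorem form_smul_right (c : K) (x z : V K) : form x (c • z) = c * form x z := by
  simp [form_def]; ring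
theorem form_sub_left (x y z : V K) : form (x - y) z = form x z - form y z := by
  simp [form_def]; ring
theorem form_sub_right (x y z : V K) : form x (y - z) = form x y - form x z := by
  simp [form_def]; ring
theorem quad_add (x y : V K) : quad (x + y) = quad x + quad y + form x y := by
  simp [form]
theorem quad_smul (c : K) (x : V K) : quad (c • x) = c ^ 2 * quad x := by
  simp [quad]; ring
theorem tri_smul_left (c : K) (x y z : V K) : tri (c • x) y z = c * tri x y z := by
  simp [tri_def]; ring
theorem tri_smul_mid (c : K) (x y z : V K) : tri x (c • y) z = c * tri x y z := by
  simp [tri_def]; ring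
theorem tri_smul_right (c : K) (x y z : V K) : tri x y (c • z) = c * tri x y z := by
  simp [tri_def]; ring
theorem tri_add_right (x y z w : V K) : tri x y (z + w) = tri x y z + tri x y w := by
  simp [tri_def]; ring
theorem tri_rotate (x y z : V K) : tri x y z = tri y z x := by
  simp only [tri_def]; ring
theorem tri_swap (x y z : V K) : tri x y z = -tri y x z := by
  simp only [tri_def]; ring

theorem hex_self {x : V K} (hx : quad x = 0) : Hex x x := by
  rw [Hex, sq_eq, tr_toZorn, nm_toZorn, hx]; simp

theorem Hex.symm {x y : V K} (h : Hex x y) : Hex y x := by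
  have := cj_mul (toZorn K x) (toZorn K y)
  rw [h, cj_of_tr (tr_toZorn x), cj_of_tr (tr_toZorn y), neg_mul', mul_neg', neg_neg] at this
  rw [Hex, ← this]; simp [cj]

theorem hex_comm {x y : V K} : Hex x y ↔ Hex y x := ⟨Hex.symm, Hex.symm⟩

theorem Hex.add_right {x y z : V K} (h : Hex x y) (h2 : Hex x z) : Hex x (y + z) := by
  rw [Hex, map_add, mul_add', h, h2, add_zero]

theorem Hex.smul_right {x y : V K} (c : K) (h : Hex x y) : Hex x (c • y) := by
  rw [Hex, map_smul, mul_smul', h, smul_zero]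

theorem hex_smul_right {x y : V K} {c : K} (hc : c ≠ 0) : Hex x (c • y) ↔ Hex x y :=
  ⟨fun h => by simpa [hc] using h.smul_right c⁻¹, Hex.smul_right c⟩

theorem hex_add_right {x y z : V K} (h : Hex x y) : Hex x (y + z) ↔ Hex x z := by
  rw [Hex, map_add, mul_add', h, zero_add, Hex]

theorem Hex.form {x y : V K} (h : Hex x y) : form x y = 0 := by
  obtain ⟨⟨h1, h2⟩, -⟩ := (hex_iff x y).1 h
  rw [form_def]; linear_combination -h1 - h2

/-! ### Transitivity -/

theorem toZorn_fromZorn_apply (g : G2 K) (x : V K) :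
    toZorn K (fromZorn K ((g : Zorn K ≃ₗ[K] Zorn K) (toZorn K x))) =
      (g : Zorn K ≃ₗ[K] Zorn K) (toZorn K x) :=
  toZorn_fromZorn (by rw [(G2.tr_nm _ _).1, tr_toZorn])

/-- The linear action on the octonions of trace zero. -/
def act (g : G2 K) : V K ≃ₗ[K] V K where
  toFun x := fromZorn K ((g : Zorn K ≃ₗ[K] Zorn K) (toZorn K x))
  map_add' x y := by simp
  map_smul' c x := by simp
  invFun x := fromZorn K (((g⁻¹ : G2 K) : Zorn K ≃ₗ[K] Zorn K) (toZorn K x))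
  left_inv x := by
    beta_reduce
    rw [toZorn_fromZorn_apply]
    exact (congrArg _ ((g : Zorn K ≃ₗ[K] Zorn K).symm_apply_apply _)).trans (fromZorn_toZorn x)
  right_inv x := by
    beta_reduce
    rw [toZorn_fromZorn_apply]
    exact (congrArg _ ((g : Zorn K ≃ₗ[K] Zorn K).apply_symm_apply _)).trans (fromZorn_toZorn x)

theorem toZorn_act (g : G2 K) (x : V K) :
    toZorn K (act g x) = (g : Zorn K ≃ₗ[K] Zorn K) (toZorn K x) :=
  toZorn_fromZorn_apply g x

theorem quad_act (g : G2 K) (x : V K) : quad (act g x) = quad x := by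
  rw [← nm_toZorn, toZorn_act, (G2.tr_nm _ _).2, nm_toZorn]

theorem form_act (g : G2 K) (x y : V K) : form (act g x) (act g y) = form x y := by
  simp only [form, ← map_add, quad_act]

theorem tri_act (g : G2 K) (x y z : V K) : tri (act g x) (act g y) (act g z) = tri x y z := by
  simp only [tri, toZorn_act, ← G2.mul, (G2.tr_nm _ _).1]

theorem hex_act (g : G2 K) {x y : V K} : Hex (act g x) (act g y) ↔ Hex x y := by
  simp only [Hex, toZorn_act, ← G2.mul]
  exact map_eq_zero_iff _ (g : Zorn K ≃ₗ[K] Zorn K).injective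

variable (K) in
/-- The standard basis vectors. -/
abbrev bv (i : Fin 7) : V K := Pi.single i 1

/-- Two isotropic vectors of inner product one and a unit vector orthogonal to the quaternion
algebra they generate can be moved to standard position. -/
theorem exists_act_eq {x y k : V K} (hx : quad x = 0) (hy : quad y = 0) (hxy : form x y = 1)
    (hxk : form x k = 0) (hyk : form y k = 0) (ht : tri x y k = 0) (hk : quad k = 1) :
    ∃ g : G2 K, act g (bv K 0) = x ∧ act g (bv K 4) = y ∧ act g (bv K 1 + bv K 5) = k ∧
      toZorn K (act g (bv K 5)) = -((toZorn K y ⋆ toZorn K x) ⋆ toZorn K k) ∧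
      toZorn K (act g (bv K 6)) = -(toZorn K x ⋆ toZorn K k) := by
  have hX : toZorn K x ⋆ toZorn K x = 0 := hex_self hx
  have hW : (-toZorn K y) ⋆ (-toZorn K y) = 0 := by
    rw [neg_mul', mul_neg', neg_neg]; exact hex_self hy
  have hXW : toZorn K x ⋆ (-toZorn K y) + (-toZorn K y) ⋆ toZorn K x = oct1 K := by
    have := mul_cj_add (toZorn K x) (toZorn K y)
    rwa [cj_of_tr (tr_toZorn x), cj_of_tr (tr_toZorn y), pol_toZorn, hxy, one_smul,
      mul_neg' (toZorn K y), ← neg_mul'] at this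
  obtain ⟨g, hg⟩ := exists_mem_G2 (k := toZorn K k) hX hW hXW (tr_toZorn x)
    (by rw [tr_neg, tr_toZorn, neg_zero]) (tr_toZorn k) (by rw [pol_toZorn, hxk])
    (by rw [pol_neg_left, pol_toZorn, hyk, neg_zero])
    (by rw [mul_neg', pol_neg_left, ← tri_eq_pol, ht]) (by rw [nm_toZorn, hk])
  have hq : quat (toZorn K x) (-toZorn K y) 0 0 0 0 = 0 := by simp [quat]
  refine ⟨g, toZorn_injective ?_, toZorn_injective ?_, toZorn_injective ?_, ?_, ?_⟩
  · rw [toZorn_act, hg, toZorn_def (bv K 0)]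
    simp [cdMap, hq, zero_mul']; simp [quat]
  · rw [toZorn_act, hg, toZorn_def (bv K 4)]
    simp [cdMap, hq, zero_mul']; simp [quat]
  · rw [toZorn_act, hg, toZorn_def (bv K 1 + bv K 5)]
    have : quat (toZorn K x) (-toZorn K y) 1 0 0 1 = oct1 K := by simpa [quat] using hXW
    simp [cdMap, hq, this, one_mul']
  · rw [toZorn_act, hg, toZorn_def (bv K 5)]
    simp [cdMap, hq]; simp [quat, neg_mul']
  · rw [toZorn_act, hg, toZorn_def (bv K 6)]
    simp [cdMap, hq]; simp [quat, neg_mul']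

/-- Two singular vectors of inner product one generate a quaternion algebra whose orthogonal
complement contains a nonsingular vector. -/
theorem exists_perp_quaternion {x y : V K} (hx : quad x = 0) (hy : quad y = 0)
    (hxy : form x y = 1) : ∃ k, form x k = 0 ∧ form y k = 0 ∧ tri x y k = 0 ∧ quad k ≠ 0 := by
  by_contra hcon
  push Not at hcon
  -- Otherwise the orthogonal complement of the quaternion algebra is totally singular. As the polar
  -- form of the norm is nondegenerate, the complement is zero, and the octonions have dimension
  -- four.
  set X := toZorn K x with hXdef
  set Y := toZorn K y with hYdef
  have hX : X ⋆ X = 0 := hex_self hx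
  have hY : Y ⋆ Y = 0 := hex_self hy
  have hXY : X ⋆ Y + Y ⋆ X = -oct1 K := by
    have := mul_cj_add X Y
    rw [cj_of_tr (tr_toZorn x), cj_of_tr (tr_toZorn y), pol_toZorn, hxy, one_smul, mul_neg',
      mul_neg', ← neg_add] at this
    rw [← this, neg_neg]
  have nX : nm X = 0 := by rw [nm_toZorn, hx]
  have nY : nm Y = 0 := by rw [nm_toZorn, hy]
  have pXY : pol X Y = 1 := by rw [pol_toZorn, hxy]
  have pYX : pol Y X = 1 := by rw [pol_comm, pXY]
  have tX : tr X = 0 := tr_toZorn x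
  have tY : tr Y = 0 := tr_toZorn y
  have cX : cj X = -X := cj_of_tr tX
  have cY : cj Y = -Y := cj_of_tr tY
  have mn : ∀ a b c : Zorn K, pol (a ⋆ b) c = pol b (cj a ⋆ c) := pol_mul_left
  have ps : ∀ a b c : Zorn K, pol a (b - c) = pol a b - pol a c := fun a b c => by
    rw [pol_comm, sub_eq_add_neg, pol_add_left, pol_neg_left, pol_comm, pol_comm c]; ring
  have pa : ∀ a b c : Zorn K, pol a (b + c) = pol a b + pol a c := fun a b c => by
    rw [pol_comm, pol_add_left, pol_comm, pol_comm c]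
  have pm : ∀ (r : K) (a b : Zorn K), pol a (r • b) = r * pol a b := fun r a b => by
    rw [pol_comm, pol_smul_left, pol_comm]
  have pz : ∀ a : Zorn K, pol a 0 = 0 := fun a => by simp [pol]
  let E := X ⋆ Y
  let F := Y ⋆ X
  have hE : F = -oct1 K - E := eq_sub_of_add_eq' hXY
  have e1 : X ⋆ E = 0 := by simp only [E]; rw [left_alt, hX, zero_mul']
  have e2 : Y ⋆ F = 0 := by simp only [F]; rw [left_alt, hY, zero_mul']
  have e3 : X ⋆ F = -X := by rw [hE, mul_sub', mul_neg', mul_one', e1, sub_zero]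
  have pXE : pol X E = 0 := by rw [pol_comm]; simp only [E]; rw [mn, cX, neg_mul', hX]; simp [pz]
  have pXF : pol X F = 0 := by
    rw [hE, ps, pXE, pol_neg_right, pol_comm, pol_one, tX]; simp
  have pYF : pol Y F = 0 := by rw [pol_comm]; simp only [F]; rw [mn, cY, neg_mul', hY]; simp [pz]
  have pYE : pol Y E = 0 := by
    have : E = -oct1 K - F := eq_sub_of_add_eq hXY
    rw [this, ps, pYF, pol_neg_right, pol_comm, pol_one, tY]; simp
  have pEE : pol E E = 0 := by
    conv_lhs => enter [1]; simp only [E]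
    rw [mn, cX, neg_mul', e1]; simp [pz]
  have pFF : pol F F = 0 := by
    conv_lhs => enter [1]; simp only [F]
    rw [mn, cY, neg_mul', e2]; simp [pz]
  have pEF : pol E F = 1 := by
    conv_lhs => enter [1]; simp only [E]
    rw [mn, cX, neg_mul', e3, neg_neg, pYX]
  have pXX : pol X X = 0 := by rw [pol_self, nX, mul_zero]
  have pYY : pol Y Y = 0 := by rw [pol_self, nY, mul_zero]
  -- The projection onto the orthogonal complement of the quaternion algebra.
  let pr : Zorn K → Zorn K := fun u =>
    u - (pol F u • E + pol E u • F + pol Y u • X + pol X u • Y)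
  have prX : ∀ u, pol X (pr u) = 0 := fun u => by
    simp only [pr, ps, pa, pm, pXE, pXF, pXX, pXY]; ring
  have prY : ∀ u, pol Y (pr u) = 0 := fun u => by
    simp only [pr, ps, pa, pm, pYE, pYF, pYY, pYX]; ring
  have prE : ∀ u, pol E (pr u) = 0 := fun u => by
    simp only [pr, ps, pa, pm, pEE, pEF, pol_comm E X, pol_comm E Y, pXE, pYE]; ring
  have prF : ∀ u, pol F (pr u) = 0 := fun u => by
    simp only [pr, ps, pa, pm, pFF, pol_comm F E, pEF, pol_comm F X, pol_comm F Y, pXF, pYF]; ring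
  have prt : ∀ u, tr (pr u) = 0 := fun u => by
    rw [← pol_one, ← neg_neg (oct1 K), ← hXY, pol_neg_left, pol_add_left]
    rw [show pol (X ⋆ Y) (pr u) = 0 from prE u, show pol (Y ⋆ X) (pr u) = 0 from prF u]; simp
  have prn : ∀ u, nm (pr u) = 0 := fun u => by
    have h := toZorn_fromZorn (prt u)
    rw [← h, nm_toZorn]
    apply hcon
    · rw [← pol_toZorn, h]; exact prX u
    · rw [← pol_toZorn, h]; exact prY u
    · rw [tri_eq_pol, h, show pol (X ⋆ Y) (pr u) = 0 from prE u, neg_zero]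
  have pradd : ∀ u v, pr (u + v) = pr u + pr v := fun u v => by
    simp only [pr, pa]; module
  have prp : ∀ u v, pol (pr u) v = 0 := fun u v => by
    have h1 := nm_add (pr u) (pr v)
    rw [← pradd, prn, prn, prn] at h1
    have h2 : v = pr v + (pol F v • E + pol E v • F + pol Y v • X + pol X v • Y) := by
      simp only [pr]; abel
    rw [h2]
    simp only [pa, pm, pol_comm (pr u) E, pol_comm (pr u) F, pol_comm (pr u) X,
      pol_comm (pr u) Y, prX, prY, prE, prF]
    linear_combination -h1
  have hall : ∀ u, u ∈ Submodule.span K (Set.range ![E, F, X, Y]) := fun u => by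
    have h1 := eq_zero_of_pol (prp u)
    have h2 : u = pol F u • E + pol E u • F + pol Y u • X + pol X u • Y := sub_eq_zero.1 h1
    rw [h2]
    have hm : ∀ i, ![E, F, X, Y] i ∈ Submodule.span K (Set.range ![E, F, X, Y]) := fun i =>
      Submodule.subset_span ⟨i, rfl⟩
    exact add_mem (add_mem (add_mem (Submodule.smul_mem _ _ (hm 0)) (Submodule.smul_mem _ _ (hm 1)))
      (Submodule.smul_mem _ _ (hm 2))) (Submodule.smul_mem _ _ (hm 3))
  have h1 := finrank_range_le_card (R := K) ![E, F, X, Y]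
  rw [Set.finrank, (Submodule.eq_top_iff'.2 hall : _ = ⊤), finrank_top] at h1
  simp at h1

/-- `G₂(K)` is transitive on hyperbolic pairs. -/
theorem exists_act_pair {x y : V K} (hx : quad x = 0) (hy : quad y = 0) (hxy : form x y = 1) :
    ∃ g : G2 K, act g (bv K 0) = x ∧ act g (bv K 4) = y := by
  obtain ⟨k, h1, h2, h3, h4⟩ := exists_perp_quaternion hx hy hxy
  -- Left multiplication by the quaternion `1 + c y x`, whose norm is `1 - c`, makes `k` a unit
  -- vector for `c = 1 - (quad k)⁻¹`.
  have e1 : ∀ c : K, ∃ k', toZorn K k' = toZorn K k + c • (toZorn K x ⋆ (toZorn K y ⋆ toZorn K k))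
      := fun c => by
    refine ⟨_, toZorn_fromZorn ?_⟩
    rw [tr_add, tr_smul, tr_toZorn]
    change 0 + c * tri x y k = 0
    rw [h3]; ring
  obtain ⟨k', hk'⟩ := e1 (1 - (quad k)⁻¹)
  have hX : toZorn K x ⋆ toZorn K x = 0 := hex_self hx
  have hY : toZorn K y ⋆ toZorn K y = 0 := hex_self hy
  have z0 : ∀ a : Zorn K, pol a 0 = 0 := fun a => by simp [pol]
  have cX := cj_of_tr (tr_toZorn x)
  have cY := cj_of_tr (tr_toZorn y)
  have f1 : form k x = 0 := by rw [form_comm, h1]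
  have f2 : form k y = 0 := by rw [form_comm, h2]
  have key : pol (toZorn K x ⋆ (toZorn K y ⋆ toZorn K k)) (toZorn K k) = -quad k := by
    rw [pol_mul_left, cX, neg_mul', pol_neg_right, pol_mul_right_right, pol_toZorn, form_comm, hxy,
      nm_toZorn, one_mul]
  have n1 : quad k' = 1 := by
    rw [← nm_toZorn, hk', nm_add, nm_smul, nm_mul, nm_toZorn, nm_toZorn, hx, zero_mul, mul_zero,
      pol_comm, pol_smul_left, key]
    field_simp
    ring
  obtain ⟨g, hg1, hg2, -⟩ := exists_act_eq (k := k') hx hy hxy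
    (by
      rw [form_comm, ← pol_toZorn, hk', pol_add_left, pol_toZorn, f1, pol_smul_left, pol_mul_left,
        cX, neg_mul', hX]
      simp [z0])
    (by
      have h5 : toZorn K y ⋆ (toZorn K x ⋆ toZorn K y) = -toZorn K y := by
        have := mul_cj_add (toZorn K x) (toZorn K y)
        rw [cX, cY, pol_toZorn, hxy, one_smul] at this
        have h6 := congrArg (fun z => toZorn K y ⋆ z) this
        simp only [mul_add', mul_neg', mul_one', left_alt, hY, zero_mul', neg_zero, add_zero] at h6
        exact neg_eq_iff_eq_neg.1 h6
      rw [form_comm, ← pol_toZorn, hk', pol_add_left, pol_toZorn, f2, pol_smul_left, pol_mul_left,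
        cX, neg_mul', pol_neg_right, pol_mul_left, cY, neg_mul', h5, neg_neg, pol_toZorn, f2]
      simp)
    (by
      rw [tri_eq_pol, pol_comm, hk', pol_add_left, pol_comm (toZorn K k), pol_smul_left,
        pol_mul_left (toZorn K x) (toZorn K y ⋆ _), cX, neg_mul', left_alt, hX, zero_mul',
        neg_zero, z0, mul_zero, add_zero, ← tri_eq_pol, h3]) n1
  exact ⟨g, hg1, hg2⟩

/-- `G₂(K)` is transitive on the points of the quadric. -/
theorem exists_act_point {x : V K} (hx : quad x = 0) (hx0 : x ≠ 0) :
    ∃ g : G2 K, act g (bv K 0) = x := by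
  -- Some standard basis vector is singular and not perpendicular to `x`.
  obtain ⟨i, j, hij, hi⟩ : ∃ i j : Fin 7, (∀ c, quad (Pi.single j c : V K) = 0) ∧ x i ≠ 0 ∧
      ∀ c, form x (Pi.single j c) = x i * c := by
    by_contra hcon
    push Not at hcon
    have h0 : x 0 = 0 := by
      by_contra h
      obtain ⟨c, hc⟩ := hcon 0 4 (by simp [quad]) h
      exact hc (by simp [form_def])
    have h1 : x 1 = 0 := by
      by_contra h
      obtain ⟨c, hc⟩ := hcon 1 5 (by simp [quad]) h
      exact hc (by simp [form_def])
    have h2 : x 2 = 0 := by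
      by_contra h
      obtain ⟨c, hc⟩ := hcon 2 6 (by simp [quad]) h
      exact hc (by simp [form_def])
    have h4 : x 4 = 0 := by
      by_contra h
      obtain ⟨c, hc⟩ := hcon 4 0 (by simp [quad]) h
      exact hc (by simp [form_def])
    have h5 : x 5 = 0 := by
      by_contra h
      obtain ⟨c, hc⟩ := hcon 5 1 (by simp [quad]) h
      exact hc (by simp [form_def])
    have h6 : x 6 = 0 := by
      by_contra h
      obtain ⟨c, hc⟩ := hcon 6 2 (by simp [quad]) h
      exact hc (by simp [form_def])
    have h3 : x 3 = 0 := by simpa [quad, h0, h1, h2, h4, h5, h6] using hx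
    exact hx0 (by ext i; fin_cases i <;> assumption)
  obtain ⟨g, hg, -⟩ := exists_act_pair hx (hij (x i)⁻¹) (by rw [hi.2, mul_inv_cancel₀ hi.1])
  exact ⟨g, hg⟩

/-! ### Ideal triangles in the split Cayley hexagon -/

theorem act_mul (g h : G2 K) (x : V K) : act (g * h) x = act g (act h x) := by
  apply toZorn_injective
  rw [toZorn_act, toZorn_act, toZorn_act]; rfl

/-- Distinct points of the quadric on a common ideal line, in terms of representing vectors. -/
structure IdealPair (x y : V K) : Prop where
  left : quad x = 0
  right : quad y = 0
  form : form x y = 0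
  not_hex : ¬ Hex x y

theorem IdealPair.symm {x y : V K} (h : IdealPair x y) : IdealPair y x :=
  ⟨h.right, h.left, by rw [form_comm, h.form], fun h' => h.not_hex h'.symm⟩

theorem idealPair_act (g : G2 K) {x y : V K} : IdealPair (act g x) (act g y) ↔ IdealPair x y :=
  ⟨fun h => ⟨by rw [← quad_act g, h.left], by rw [← quad_act g, h.right],
    by rw [← form_act g, h.form], fun h' => h.not_hex ((hex_act g).2 h')⟩,
   fun h => ⟨by rw [quad_act, h.left], by rw [quad_act, h.right],
    by rw [form_act, h.form], fun h' => h.not_hex ((hex_act g).1 h')⟩⟩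

theorem idealPair_smul_right {c : K} (hc : c ≠ 0) {x y : V K} :
    IdealPair x (c • y) ↔ IdealPair x y := by
  constructor
  · rintro ⟨h1, h2, h3, h4⟩
    rw [quad_smul] at h2
    rw [form_smul_right] at h3
    rw [hex_smul_right hc] at h4
    exact ⟨h1, by simpa [hc] using h2, by simpa [hc] using h3, h4⟩
  · rintro ⟨h1, h2, h3, h4⟩
    exact ⟨h1, by rw [quad_smul, h2, mul_zero], by rw [form_smul_right, h3, mul_zero],
      by rwa [hex_smul_right hc]⟩

theorem idealPair_smul_left {c : K} (hc : c ≠ 0) {x y : V K} :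
    IdealPair (c • x) y ↔ IdealPair x y :=
  ⟨fun h => ((idealPair_smul_right hc).1 h.symm).symm,
    fun h => ((idealPair_smul_right hc).2 h.symm).symm⟩

theorem hex_zero_right (x : V K) : Hex x 0 := by rw [Hex, map_zero, mul_zero']
theorem hex_zero_left (x : V K) : Hex 0 x := by rw [Hex, map_zero, zero_mul']

theorem IdealPair.ne_zero_left {x y : V K} (h : IdealPair x y) : x ≠ 0 := by
  rintro rfl; exact h.not_hex (hex_zero_left y)

theorem IdealPair.ne_zero_right {x y : V K} (h : IdealPair x y) : y ≠ 0 := by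
  rintro rfl; exact h.not_hex (hex_zero_right x)

theorem not_hex_of_tri {x y z : V K} (h : tri x y z ≠ 0) : ¬ Hex x y := by
  intro h'
  rw [tri_eq_pol, h'] at h
  simp [pol] at h

/-- A group-valued function on pairs of vectors that multiplies correctly along triangles of points
in ideal planes and on ideal lines. -/
structure IdealCocycle {G : Type*} [Group G] (ψ : V K → V K → G) : Prop where
  smul_left : ∀ (c : K) x y, c ≠ 0 → ψ (c • x) y = ψ x y
  smul_right : ∀ (c : K) x y, c ≠ 0 → ψ x (c • y) = ψ x y
  self : ∀ x, ψ x x = 1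
  symm : ∀ x y, ψ x y * ψ y x = 1
  plane : ∀ x y z, IdealPair x y → IdealPair y z → IdealPair x z → tri x y z ≠ 0 →
    ψ x y * ψ y z = ψ x z
  line : ∀ x y z, IdealPair x y → IdealPair y z → IdealPair x z →
    z ∈ Submodule.span K {x, y} → ψ x y * ψ y z = ψ x z

namespace IdealCocycle
variable {G : Type*} [Group G] {ψ : V K → V K → G}

theorem act (h : IdealCocycle ψ) (g : G2 K) :
    IdealCocycle fun x y => ψ (Cayley.act g x) (Cayley.act g y) where
  smul_left c x y hc := by rw [map_smul, h.smul_left c _ _ hc]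
  smul_right c x y hc := by rw [map_smul, h.smul_right c _ _ hc]
  self x := h.self _
  symm x y := h.symm _ _
  plane x y z h1 h2 h3 h4 := h.plane _ _ _ ((idealPair_act g).2 h1) ((idealPair_act g).2 h2)
    ((idealPair_act g).2 h3) (by rwa [tri_act])
  line x y z h1 h2 h3 h4 := by
    refine h.line _ _ _ ((idealPair_act g).2 h1) ((idealPair_act g).2 h2)
      ((idealPair_act g).2 h3) ?_
    obtain ⟨a, b, rfl⟩ := Submodule.mem_span_pair.1 h4
    exact Submodule.mem_span_pair.2 ⟨a, b, by simp⟩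

theorem plane' (h : IdealCocycle ψ) {x y z : V K} (hx : quad x = 0) (hy : quad y = 0)
    (hz : quad z = 0) (hxy : form x y = 0) (hyz : form y z = 0) (hxz : form x z = 0)
    (ht : tri x y z ≠ 0) : ψ x y * ψ y z = ψ x z := by
  refine h.plane x y z ⟨hx, hy, hxy, not_hex_of_tri ht⟩
    ⟨hy, hz, hyz, not_hex_of_tri (z := x) (by rwa [← tri_rotate])⟩
    ⟨hx, hz, hxz, fun h' => not_hex_of_tri (z := y) (by rwa [← tri_rotate, ← tri_rotate]) h'.symm⟩
    ht

end IdealCocycle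

/-- The triangle on `x, y, z` multiplies correctly for every cocycle. -/
def Fills (x y z : V K) : Prop :=
  ∀ (G : Type u) [Group G] (ψ : V K → V K → G), IdealCocycle ψ → ψ x y * ψ y z = ψ x z

theorem Fills.act {x y z : V K} (h : Fills x y z) (g : G2 K) :
    Fills (act g x) (act g y) (act g z) := fun G _ _ hψ => h G _ (hψ.act g)

theorem fills_smul {a b c : K} (ha : a ≠ 0) (hb : b ≠ 0) (hc : c ≠ 0) {x y z : V K} :
    Fills (a • x) (b • y) (c • z) ↔ Fills x y z := by
  unfold Fills
  constructor <;> intro h G _ ψ hψ <;> have := h G ψ hψ <;>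
    simpa only [hψ.smul_left _ _ _ ha, hψ.smul_left _ _ _ hb, hψ.smul_right _ _ _ hb,
      hψ.smul_right _ _ _ hc] using this

/-- A triangle in a special plane is filled by three further points: the six points are the
vertices of an octahedron whose other seven faces lie in ideal planes. -/
theorem fills_octahedron : Fills (![0, 0, 0, 0, 0, 1, 0] : V K) ![0, 0, 0, 0, 0, 0, 1]
    ![1, 0, 0, 0, 0, 1, 1] := by
  intro G _ ψ h
  set x : V K := ![0, 0, 0, 0, 0, 1, 0]
  set y : V K := ![0, 0, 0, 0, 0, 0, 1]
  set z : V K := ![1, 0, 0, 0, 0, 1, 1]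
  set a : V K := ![1, 0, 0, 1, 1, 0, 0]
  set b : V K := ![1, 1, 0, 0, -1, 1, 1]
  set c : V K := ![1, 0, 1, 0, -1, 1, 1]
  have e1 : ψ x a * ψ a y = ψ x y := by
    apply h.plane' <;> simp [x, y, a, quad, form_def, tri_def]
  have e2 : ψ y b * ψ b z = ψ y z := by
    apply h.plane' <;> simp [z, y, b, quad, form_def, tri_def]
  have e3 : ψ x c * ψ c z = ψ x z := by
    apply h.plane' <;> simp [z, x, c, quad, form_def, tri_def]
  have e4 : ψ a y * ψ y b = ψ a b := by
    apply h.plane' <;> simp [a, y, b, quad, form_def, tri_def]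
  have e5 : ψ a c * ψ c b = ψ a b := by
    apply h.plane' <;> simp [a, c, b, quad, form_def, tri_def]
  have e6 : ψ c b * ψ b z = ψ c z := by
    apply h.plane' <;> simp [z, c, b, quad, form_def, tri_def]
  have e7 : ψ x a * ψ a c = ψ x c := by
    apply h.plane' <;> simp [x, c, a, quad, form_def, tri_def]
  calc ψ x y * ψ y z = ψ x a * (ψ a y * ψ y b) * ψ b z := by rw [← e1, ← e2]; group
    _ = (ψ x a * ψ a c) * (ψ c b * ψ b z) := by rw [e4, ← e5]; group
    _ = ψ x z := by rw [e6, e7, e3]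

/-- Two vectors `x` and `y` that span an ideal line can be moved to `e₅` and `e₆`. Here `-t` is
their product, and `w` completes `t` to a hyperbolic pair perpendicular to `x` and `y`; the vector
`x + w y` is a unit vector orthogonal to the quaternion algebra of `t` and `w`. -/
theorem exists_act_hexTriple {t x y w : V K} (ht : quad t = 0) (hx : quad x = 0)
    (hw : quad w = 0) (hxy : toZorn K x ⋆ toZorn K y = -toZorn K t) (htx : Hex t x)
    (hty : Hex t y) (htw : form t w = 1) (hxw : form x w = 0) (hyw : form y w = 0) :
    ∃ g : G2 K, act g (bv K 5) = x ∧ act g (bv K 6) = y := by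
  have z0 : ∀ a : Zorn K, pol a 0 = 0 := fun a => by simp [pol]
  have hW : toZorn K w ⋆ toZorn K w = 0 := hex_self hw
  have hX : toZorn K t ⋆ toZorn K x = 0 := htx
  have hY : toZorn K t ⋆ toZorn K y = 0 := hty
  have cT := cj_of_tr (tr_toZorn t)
  have cW := cj_of_tr (tr_toZorn w)
  have hv0 : tr (toZorn K w ⋆ toZorn K y) = 0 := by
    have := tr_mul_cj (toZorn K w) (toZorn K y)
    rw [cj_of_tr (tr_toZorn y), mul_neg', tr_neg, pol_toZorn, form_comm, hyw] at this
    simpa using this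
  have hv := toZorn_fromZorn hv0
  set v := fromZorn K (toZorn K w ⋆ toZorn K y)
  have f1 : toZorn K t ⋆ (toZorn K w ⋆ toZorn K y) = -toZorn K y := by
    have := mul_mul_cj_add (toZorn K t) (toZorn K w) (toZorn K y)
    rw [cT, cW, neg_mul', neg_mul', hY, neg_zero, mul_zero', add_zero, pol_toZorn, htw, one_smul,
      mul_neg'] at this
    exact neg_eq_iff_eq_neg.1 this
  have f2 : tri t w x = 0 := by
    rw [tri_rotate, tri_rotate, tri_swap, tri_eq_pol, hX, pol_comm, z0]; simp
  have f3 : (toZorn K w ⋆ toZorn K t) ⋆ toZorn K x = -toZorn K x := by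
    rw [← mul_mul_perp (tr_toZorn x)]
    · have := mul_mul_cj_add (toZorn K t) (toZorn K w) (toZorn K x)
      rw [cT, cW, neg_mul', neg_mul', hX, neg_zero, mul_zero', add_zero, pol_toZorn, htw, one_smul,
        mul_neg'] at this
      exact neg_eq_iff_eq_neg.1 this
    · rw [pol_toZorn, htx.form]
    · rw [pol_toZorn, form_comm, hxw]
    · have := tri_eq_pol w t x
      rw [tri_swap, f2] at this
      simpa using this.symm
  have f4 : (toZorn K w ⋆ toZorn K t) ⋆ (toZorn K w ⋆ toZorn K y) = 0 := by
    have : toZorn K w ⋆ toZorn K y = -(toZorn K y ⋆ toZorn K w) := by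
      have := mul_cj_add (toZorn K w) (toZorn K y)
      rw [cj_of_tr (tr_toZorn y), cW, pol_toZorn, form_comm, hyw, zero_smul, mul_neg', mul_neg',
        ← neg_add, neg_eq_zero] at this
      exact eq_neg_of_add_eq_zero_left this
    rw [this, mul_neg', moufang, hY, mul_zero', zero_mul', neg_zero]
  obtain ⟨g, -, -, -, h5, h6⟩ := exists_act_eq (x := t) (y := w) (k := x + v) ht hw htw
    (by
      rw [form_add_right, htx.form, form_comm, ← pol_toZorn, hv, pol_mul_left, cW, neg_mul',
        pol_neg_right, pol_comm]
      have := tri_eq_pol w t y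
      rw [tri_rotate, tri_eq_pol, hY, pol_comm, z0] at this
      rw [show pol (toZorn K w ⋆ toZorn K t) (toZorn K y) = 0 by simpa using this.symm]
      simp)
    (by
      rw [form_add_right, form_comm, hxw, form_comm, ← pol_toZorn, hv, pol_mul_left, cW, neg_mul',
        hW]
      simp [z0])
    (by
      rw [tri_add_right, f2, zero_add, tri, hv, left_alt, hW, zero_mul', mul_zero']
      simp [tr])
    (by
      rw [quad_add, hx, ← nm_toZorn v, hv, nm_mul, nm_toZorn, hw, zero_mul, zero_add, zero_add,
        ← pol_toZorn, hv]
      have h1 := tr_mul_cj (toZorn K x) (toZorn K w ⋆ toZorn K y)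
      rw [cj_of_tr hv0, mul_neg', tr_neg] at h1
      rw [← h1]
      change -tri x w y = 1
      rw [tri_swap, tri_rotate, tri_eq_pol, hxy, pol_neg_left, pol_toZorn, htw]; simp)
  refine ⟨g, toZorn_injective ?_, toZorn_injective ?_⟩
  · rw [h5, map_add, mul_add', hv, f3, f4, add_zero, neg_neg]
  · rw [h6, map_add, mul_add', hv, hX, zero_add, f1, neg_neg]

theorem hex_bv_zero {x : V K} (h : Hex (bv K 0) x) : x 1 = 0 ∧ x 2 = 0 ∧ x 3 = 0 ∧ x 4 = 0 := by
  obtain ⟨⟨h1, h2⟩, h3, h4, h5, h6, h7, h8⟩ := (hex_iff _ _).1 h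
  simp [grass] at h1 h2 h3 h4 h5 h6 h7 h8
  exact ⟨h6, h7, h4.symm, h1.symm⟩

/-- `G₂(K)` is transitive on the ordered pairs of vectors that span an ideal line. -/
theorem exists_act_ideal {x y : V K} (h : IdealPair x y) :
    ∃ g : G2 K, act g (bv K 5) = x ∧ act g (bv K 6) = y := by
  have hX : toZorn K x ⋆ toZorn K x = 0 := hex_self h.left
  have hY : toZorn K y ⋆ toZorn K y = 0 := hex_self h.right
  have htr : tr (-(toZorn K x ⋆ toZorn K y)) = 0 := by
    have := tr_mul_cj (toZorn K x) (toZorn K y)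
    rwa [cj_of_tr (tr_toZorn y), mul_neg', pol_toZorn, h.form] at this
  have ht := toZorn_fromZorn htr
  set t := fromZorn K (-(toZorn K x ⋆ toZorn K y)) with htdef
  have hqt : quad t = 0 := by
    rw [← nm_toZorn, ht, ← neg_one_smul K, nm_smul, nm_mul, nm_toZorn, h.left]; simp
  have ht0 : t ≠ 0 := by
    intro h0
    rw [h0, map_zero] at ht
    exact h.not_hex (neg_eq_zero.1 ht.symm)
  have hxt : Hex x t := by
    rw [Hex, ht, mul_neg', left_alt, hX, zero_mul', neg_zero]
  have hty : Hex t y := by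
    rw [Hex, ht, neg_mul', right_alt, hY, mul_zero', neg_zero]
  obtain ⟨g, hg⟩ := exists_act_point hqt ht0
  obtain ⟨x, rfl⟩ := (act g).surjective x
  obtain ⟨y, rfl⟩ := (act g).surjective y
  rw [← hg, hex_act] at hxt hty
  have hxy : toZorn K x ⋆ toZorn K y = -toZorn K (bv K 0) := by
    apply (g : Zorn K ≃ₗ[K] Zorn K).injective
    rw [G2.mul, map_neg, ← toZorn_act, ← toZorn_act, ← toZorn_act, hg, ht, neg_neg]
  obtain ⟨x1, x2, x3, x4⟩ := hex_bv_zero hxt.symm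
  obtain ⟨y1, y2, y3, y4⟩ := hex_bv_zero hty
  have hD : x 5 * y 6 - x 6 * y 5 = 1 := by
    have := congrArg (fun z : Zorn K => z.2.1 0) hxy
    rw [zornMul_def, toZorn_def, toZorn_def, toZorn_def] at this
    simp [x1, x2, x3, x4, y1, y2, y3, y4] at this
    linear_combination -this
  have hqx : quad x = 0 := by simp [quad, x1, x2, x3, x4]
  -- `w` is the singular vector with `w₃ = 0`, `w₄ = 1` and `w₅ = w₆ = 0` perpendicular to `x` and
  -- `y`.
  obtain ⟨g', h5, h6⟩ := exists_act_hexTriple (t := bv K 0) (x := x) (y := y)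
    (w := ![0, -(x 0 * y 6) + y 0 * x 6, -(y 0 * x 5) + x 0 * y 5, 0, 1, 0, 0])
    (by simp [quad]) hqx (by simp [quad]) hxy hxt.symm hty (by simp [form_def])
    (by
      simp [form_def, x1, x2, x3, x4]
      linear_combination -x 0 * hD)
    (by
      simp [form_def, y1, y2, y3, y4]
      linear_combination -y 0 * hD)
  exact ⟨g * g', by rw [act_mul, h5], by rw [act_mul, h6]⟩

/-- Every triangle of points that are pairwise on ideal lines multiplies correctly. -/
theorem fills_of_ideal {x y z : V K} (hxy : IdealPair x y) (hyz : IdealPair y z)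
    (hxz : IdealPair x z) : Fills x y z := by
  by_cases ht : tri x y z = 0
  swap
  · exact fun G _ ψ h => h.plane x y z hxy hyz hxz ht
  by_cases hsp : z ∈ Submodule.span K {x, y}
  · exact fun G _ ψ h => h.line x y z hxy hyz hxz hsp
  obtain ⟨g, rfl, rfl⟩ := exists_act_ideal hxy
  obtain ⟨z, rfl⟩ := (act g).surjective z
  refine Fills.act ?_ g
  rw [tri_act] at ht
  rw [idealPair_act] at hxz hyz
  have hz4 : z 4 = 0 := by simpa [tri_def] using ht
  have hz1 : z 1 = 0 := by simpa [form_def] using hxz.form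
  have hz2 : z 2 = 0 := by simpa [form_def] using hyz.form
  have hz3 : z 3 = 0 := by simpa [quad, hz1, hz2, hz4] using hxz.right
  have hz5 : z 5 ≠ 0 := fun h5 => hyz.not_hex (by
    rw [hex_iff]; simp [grass, hz1, hz2, hz3, hz4, h5])
  have hz6 : z 6 ≠ 0 := fun h6 => hxz.not_hex (by
    rw [hex_iff]; simp [grass, hz1, hz2, hz3, hz4, h6])
  have hz0 : z 0 ≠ 0 := fun h0 => hsp (by
    refine Submodule.mem_span_pair.2 ⟨z 5, z 6, ?_⟩
    rw [← map_smul, ← map_smul, ← map_add]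
    congr 1
    ext i; fin_cases i <;> simp [hz1, hz2, hz3, hz4, h0])
  -- A diagonal automorphism takes `e₀ + e₅ + e₆` to `l • z`. Since `e₀` is minus the product of
  -- `e₅` and `e₆`, the scalar `l` has to satisfy `l z₀ = (l z₅) (l z₆)`.
  set l : K := z 0 / (z 5 * z 6) with hl
  have hl0 : l ≠ 0 := div_ne_zero hz0 (mul_ne_zero hz5 hz6)
  have h55 : (l * z 5) ≠ 0 := mul_ne_zero hl0 hz5
  have h66 : (l * z 6) ≠ 0 := mul_ne_zero hl0 hz6
  obtain ⟨g', e5, e6⟩ := exists_act_hexTriple (t := (l * z 0) • bv K 0)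
    (x := (l * z 5) • bv K 5) (y := (l * z 6) • bv K 6) (w := (l * z 0)⁻¹ • bv K 4)
    (by simp [quad]) (by simp [quad]) (by simp [quad])
    (by
      rw [zornMul_def, toZorn_def, toZorn_def, toZorn_def]
      apply zorn_ext <;> simp
      rw [hl]; field_simp)
    (by rw [hex_iff]; simp [grass]) (by rw [hex_iff]; simp [grass])
    (by simp [form_def]; field_simp) (by simp [form_def]) (by simp [form_def])
  have e0 : act g' (bv K 0) = (l * z 0) • bv K 0 := by
    have m : toZorn K (bv K 5) ⋆ toZorn K (bv K 6) = -toZorn K (bv K 0) := by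
      rw [zornMul_def, toZorn_def, toZorn_def, toZorn_def]
      apply zorn_ext <;> simp
    have m2 := congrArg (g' : Zorn K ≃ₗ[K] Zorn K) m
    rw [G2.mul, map_neg, ← toZorn_act, ← toZorn_act, ← toZorn_act, e5, e6, map_smul, map_smul,
      smul_mul', mul_smul', m, smul_neg, smul_neg, neg_inj, smul_smul, ← map_smul] at m2
    rw [← toZorn_injective m2]
    congr 1
    rw [hl]; field_simp
  have hf := (fills_octahedron (K := K)).act g'
  have b5 : (![0, 0, 0, 0, 0, 1, 0] : V K) = bv K 5 := by ext i; fin_cases i <;> simp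
  have b6 : (![0, 0, 0, 0, 0, 0, 1] : V K) = bv K 6 := by ext i; fin_cases i <;> simp
  have b7 : (![1, 0, 0, 0, 0, 1, 1] : V K) = bv K 0 + bv K 5 + bv K 6 := by
    ext i; fin_cases i <;> simp
  have b8 : (l * z 0) • bv K 0 + (l * z 5) • bv K 5 + (l * z 6) • bv K 6 = l • z := by
    ext i; fin_cases i <;> simp [hz1, hz2, hz3, hz4]
  rw [b5, b6, b7, map_add, map_add, e0, e5, e6, b8] at hf
  exact (fills_smul h55 h66 hl0).1 hf

/-! ### Extension of a cocycle to all lines of the quadric -/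

/-- The paths `x, z, y` and `x, w, y` have the same value for every cocycle. -/
def SamePath (x z w y : V K) : Prop :=
  ∀ (G : Type u) [Group G] (ψ : V K → V K → G), IdealCocycle ψ → ψ x z * ψ z y = ψ x w * ψ w y

theorem SamePath.act {x z w y : V K} (h : SamePath x z w y) (g : G2 K) :
    SamePath (act g x) (act g z) (act g w) (act g y) := fun G _ _ hψ => h G _ (hψ.act g)

theorem samePath_smul {a b c d : K} (ha : a ≠ 0) (hb : b ≠ 0) (hc : c ≠ 0) (hd : d ≠ 0)
    {x z w y : V K} : SamePath (a • x) (b • z) (c • w) (d • y) ↔ SamePath x z w y := by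
  unfold SamePath
  constructor <;> intro h G _ ψ hψ <;> have := h G ψ hψ <;>
    simpa only [hψ.smul_left _ _ _ ha, hψ.smul_left _ _ _ hb, hψ.smul_right _ _ _ hb,
      hψ.smul_left _ _ _ hc, hψ.smul_right _ _ _ hc, hψ.smul_right _ _ _ hd] using this

theorem samePath_of_perp {x y z w : V K} (hxz : IdealPair x z) (hzy : IdealPair z y)
    (hxw : IdealPair x w) (hwy : IdealPair w y) (h : IdealPair z w) : SamePath x z w y := by
  intro G _ ψ hψ
  rw [← fills_of_ideal hxz h hxw G ψ hψ, mul_assoc, fills_of_ideal h hwy hzy G ψ hψ]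

/-- Two common neighbours of the collinear points `x` and `y` that are perpendicular to each other
yield the same value; if they are not adjacent then `x + z` is adjacent to all four points. -/
theorem samePath_of_form_eq_zero {x y z w : V K} (hxy : Hex x y) (hxz : IdealPair x z)
    (hzy : IdealPair z y) (hxw : IdealPair x w) (hwy : IdealPair w y) (h : form z w = 0) :
    SamePath x z w y := by
  by_cases hzw : Hex z w
  swap
  · exact samePath_of_perp hxz hzy hxw hwy ⟨hxz.right, hxw.right, h, hzw⟩
  have hu : quad (x + z) = 0 := by rw [quad_add, hxz.left, hxz.right, hxz.form]; ring
  have ux : IdealPair x (x + z) := by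
    refine ⟨hxz.left, hu, ?_, ?_⟩
    · rw [form_add_right, hxz.form, form_self, hxz.left]; ring
    · rw [hex_add_right (hex_self hxz.left)]; exact hxz.not_hex
  have uy : IdealPair (x + z) y := by
    refine ⟨hu, hzy.right, ?_, ?_⟩
    · rw [form_add_left, hxy.form, hzy.form]; ring
    · rw [hex_comm, hex_add_right hxy.symm, hex_comm]; exact hzy.not_hex
  have uz : IdealPair z (x + z) := by
    refine ⟨hxz.right, hu, ?_, ?_⟩
    · rw [form_add_right, form_comm, hxz.form, form_self, hxz.right]; ring
    · rw [add_comm, hex_add_right (hex_self hxz.right), hex_comm]; exact hxz.not_hex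
  have uw : IdealPair (x + z) w := by
    refine ⟨hu, hxw.right, ?_, ?_⟩
    · rw [form_add_left, h, hxw.form]; ring
    · rw [hex_comm, add_comm, hex_add_right hzw.symm, hex_comm]; exact hxw.not_hex
  intro G _ ψ hψ
  rw [samePath_of_perp hxz hzy ux uy uz G ψ hψ, samePath_of_perp ux uy hxw hwy uw G ψ hψ]

theorem hex_bv_four {x : V K} (h : Hex (bv K 4) x) : x 5 = 0 ∧ x 6 = 0 ∧ x 3 = 0 ∧ x 0 = 0 := by
  obtain ⟨⟨h1, h2⟩, h3, h4, h5, h6, h7, h8⟩ := (hex_iff _ _).1 h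
  simp [grass] at h1 h2 h3 h4 h5 h6 h7 h8
  exact ⟨h5, h8, h3, h2.symm⟩

theorem hex_bv_zero_iff {x : V K} : Hex (bv K 0) x ↔ x 1 = 0 ∧ x 2 = 0 ∧ x 3 = 0 ∧ x 4 = 0 := by
  refine ⟨hex_bv_zero, ?_⟩
  rintro ⟨h1, h2, h3, h4⟩
  rw [hex_iff]
  simp [grass, h1, h2, h3, h4]

theorem hex_bv_four_iff {x : V K} : Hex (bv K 4) x ↔ x 5 = 0 ∧ x 6 = 0 ∧ x 3 = 0 ∧ x 0 = 0 := by
  refine ⟨hex_bv_four, ?_⟩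
  rintro ⟨h1, h2, h3, h4⟩
  rw [hex_iff]
  simp [grass, h1, h2, h3, h4]

/-- Two points of a hexagon line that are common neighbours of `e₀` and `e₄`: the paths through `e₀`
and through `e₄` agree since both have the value of a path of length three whose vertices are
adjacent to `e₀` and to `e₄`. -/
theorem samePath_grid {s1 s2 t1 t2 k m : K} (hst : t1 * s1 + t2 * s2 = 1) (hk : k ≠ 0)
    (hm : m ≠ 0) (hkm : k ≠ m) :
    SamePath (![0, -k * s2, k * s1, 0, 0, s1, s2] : V K) (bv K 0) (bv K 4)
      ![0, -m * s2, m * s1, 0, 0, s1, s2] := by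
  have hs : ¬ (s1 = 0 ∧ s2 = 0) := by rintro ⟨rfl, rfl⟩; simp at hst
  have ht : ¬ (t1 = 0 ∧ t2 = 0) := by rintro ⟨rfl, rfl⟩; simp at hst
  -- The path is `X k`, `A k`, `A m`, `X m`.
  let X : K → V K := fun k => ![0, -k * s2, k * s1, 0, 0, s1, s2]
  let A : K → V K := fun k => ![0, -k * t1 - s2, -k * t2 + s1, 1, 0, -t2, t1]
  have qX : ∀ k, quad (X k) = 0 := fun k => by simp [X, quad]; ring
  have qA : ∀ k, quad (A k) = 0 := fun k => by
    simp [A, quad]; linear_combination hst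
  have q0 : quad (bv K 0) = 0 := by simp [quad]
  have q4 : quad (bv K 4) = 0 := by simp [quad]
  have x0 : ∀ k, k ≠ 0 → IdealPair (bv K 0) (X k) := fun k hk => by
    refine ⟨q0, qX k, by simp [X, form_def], ?_⟩
    rw [hex_bv_zero_iff]
    rintro ⟨h1, h2, -⟩
    simp [X, hk] at h1 h2
    exact hs ⟨h2, h1⟩
  have x4 : ∀ k, IdealPair (bv K 4) (X k) := fun k => by
    refine ⟨q4, qX k, by simp [X, form_def], ?_⟩
    rw [hex_bv_four_iff]
    rintro ⟨h1, h2, -⟩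
    exact hs ⟨h1, h2⟩
  have a0 : ∀ k, IdealPair (bv K 0) (A k) := fun k => by
    refine ⟨q0, qA k, by simp [A, form_def], ?_⟩
    rw [hex_bv_zero_iff]
    rintro ⟨-, -, h3, -⟩
    simp [A] at h3
  have a4 : ∀ k, IdealPair (bv K 4) (A k) := fun k => by
    refine ⟨q4, qA k, by simp [A, form_def], ?_⟩
    rw [hex_bv_four_iff]
    rintro ⟨-, -, h3, -⟩
    simp [A] at h3
  have xa : ∀ k, k ≠ 0 → IdealPair (X k) (A k) := fun k hk => by
    refine ⟨qX k, qA k, ?_, ?_⟩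
    · simp [X, A, form_def]; linear_combination (-k) * hst + k * hst
    · rw [hex_iff]
      rintro ⟨-, -, -, h5, -, -, h8⟩
      simp [grass, X, A, hk] at h5 h8
      exact hs ⟨by tauto, by tauto⟩
  have ab : IdealPair (A k) (A m) := by
    refine ⟨qA k, qA m, ?_, ?_⟩
    · simp [A, form_def]; linear_combination 2 * hst
    · rw [hex_iff]
      rintro ⟨-, -, -, h5, -, -, h8⟩
      simp only [grass, A] at h5 h8
      simp at h5 h8
      have h9 : (k - m) * t1 = 0 := by linear_combination -h8
      have h10 : (k - m) * t2 = 0 := by linear_combination h5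
      have := sub_ne_zero.2 hkm
      exact ht ⟨by simpa [this] using h9, by simpa [this] using h10⟩
  intro G _ ψ hψ
  change ψ (X k) _ * ψ _ (X m) = ψ (X k) _ * ψ _ (X m)
  have key : ∀ z, IdealPair z (X k) → IdealPair z (A k) → IdealPair z (A m) → IdealPair z (X m) →
      ψ (X k) z * ψ z (X m) = ψ (X k) (A k) * ψ (A k) (A m) * ψ (A m) (X m) := by
    intro z h1 h2 h3 h4
    rw [← fills_of_ideal (xa k hk) h2.symm h1.symm G ψ hψ,
      ← fills_of_ideal h3 (xa m hm).symm h4 G ψ hψ,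
      ← fills_of_ideal h2.symm h3 ab G ψ hψ]
    group
  rw [key _ (x0 k hk) (a0 k) (a0 m) (x0 m hm), key _ (x4 k) (a4 k) (a4 m) (x4 m)]

/-- Any two common neighbours of points `x` and `y` of a hexagon line yield the same value. -/
theorem samePath_of_hex {x y z w : V K} (hxy : Hex x y) (hxz : IdealPair x z)
    (hzy : IdealPair z y) (hxw : IdealPair x w) (hwy : IdealPair w y) : SamePath x z w y := by
  by_cases h : form z w = 0
  · exact samePath_of_form_eq_zero hxy hxz hzy hxw hwy h
  by_cases hdep : ∃ c : K, y = c • x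
  · obtain ⟨c, rfl⟩ := hdep
    have hc : c ≠ 0 := by
      rintro rfl
      exact hzy.ne_zero_right (zero_smul K x)
    intro G _ ψ hψ
    rw [hψ.smul_right _ _ _ hc, hψ.smul_right _ _ _ hc, hψ.symm, hψ.symm]
  have hz0 : (form z w)⁻¹ ≠ 0 := inv_ne_zero h
  obtain ⟨g, rfl, hg⟩ := exists_act_pair (x := z) (y := (form z w)⁻¹ • w) hxz.right
    (by rw [quad_smul, hxw.right, mul_zero]) (by rw [form_smul_right, inv_mul_cancel₀ h])
  rw [← idealPair_smul_right hz0, ← hg] at hxw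
  rw [← idealPair_smul_left hz0, ← hg] at hwy
  rw [← samePath_smul one_ne_zero one_ne_zero hz0 one_ne_zero, one_smul, one_smul, one_smul, ← hg]
  clear hg h hz0
  obtain ⟨x, rfl⟩ := (act g).surjective x
  obtain ⟨y, rfl⟩ := (act g).surjective y
  rw [hex_act] at hxy
  rw [idealPair_act] at hxz hzy hxw hwy
  have hdep' : ¬ ∃ c : K, y = c • x := fun ⟨c, hc⟩ => hdep ⟨c, by rw [hc, map_smul]⟩
  clear hdep
  refine SamePath.act ?_ g
  have hx4 : x 4 = 0 := by simpa [form_def] using hxz.form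
  have hx0 : x 0 = 0 := by simpa [form_def] using hxw.form
  have hy4 : y 4 = 0 := by simpa [form_def] using hzy.form
  have hy0 : y 0 = 0 := by simpa [form_def] using hwy.form
  obtain ⟨-, h3, h4, h5, h6, h7, h8⟩ := (hex_iff _ _).1 hxy
  simp only [grass, hx4, hx0, hy4, hy0, mul_zero, zero_mul, sub_zero] at h3 h4 h5 h6 h7 h8
  have hx3 : x 3 = 0 := by
    by_contra hx3
    refine hdep' ⟨y 3 / x 3, ?_⟩
    ext i
    fin_cases i <;> simp [hx0, hx4, hy0, hy4] <;> field_simp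
    · linear_combination -h8
    · linear_combination h5
    · linear_combination h7
    · linear_combination -h6
  have hy3 : y 3 = 0 := by
    by_contra hy3
    apply hxz.ne_zero_left
    ext i
    simp only [hx3, zero_mul, zero_sub, sub_zero] at h5 h6 h7 h8
    fin_cases i <;> simp [hx0, hx4, hx3]
    · simpa [hy3] using h8
    · simpa [hy3] using h5
    · simpa [hy3] using h7
    · simpa [hy3] using h6
  have hs : x 5 ≠ 0 ∨ x 6 ≠ 0 := by
    by_contra! hs
    exact hxw.symm.not_hex (hex_bv_four_iff.2 ⟨hs.1, hs.2, hx3, hx0⟩)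
  have hr : ¬ (x 1 = 0 ∧ x 2 = 0) := fun hs =>
    hxz.symm.not_hex (hex_bv_zero_iff.2 ⟨hs.1, hs.2, hx3, hx4⟩)
  have hs' : ¬ (y 5 = 0 ∧ y 6 = 0) := fun hs =>
    hwy.not_hex (hex_bv_four_iff.2 ⟨hs.1, hs.2, hy3, hy0⟩)
  have hr' : ¬ (y 1 = 0 ∧ y 2 = 0) := fun hs =>
    hzy.not_hex (hex_bv_zero_iff.2 ⟨hs.1, hs.2, hy3, hy4⟩)
  obtain ⟨t1, t2, hst⟩ : ∃ t1 t2 : K, t1 * x 5 + t2 * x 6 = 1 := by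
    rcases hs with h | h
    · exact ⟨(x 5)⁻¹, 0, by field_simp; ring⟩
    · exact ⟨0, (x 6)⁻¹, by field_simp; ring⟩
  have hqx : x 1 * x 5 + x 2 * x 6 = 0 := by
    have := hxz.left
    simp [quad, hx0, hx3] at this
    exact this
  have hqy : y 1 * y 5 + y 2 * y 6 = 0 := by
    have := hzy.right
    simp [quad, hy0, hy3] at this
    exact this
  -- `y` is rescaled so that its coordinates `5` and `6` agree with those of `x`.
  set d := t1 * y 5 + t2 * y 6 with hd
  have d5 : y 5 = d * x 5 := by rw [hd]; linear_combination (-y 5) * hst - t2 * h4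
  have d6 : y 6 = d * x 6 := by rw [hd]; linear_combination (-y 6) * hst + t1 * h4
  have hd0 : d ≠ 0 := fun h0 => hs' ⟨by rw [d5, h0, zero_mul], by rw [d6, h0, zero_mul]⟩
  have hqy' : y 1 * x 5 + y 2 * x 6 = 0 := by
    rw [d5, d6] at hqy
    have : d * (y 1 * x 5 + y 2 * x 6) = 0 := by linear_combination hqy
    simpa [hd0] using this
  set k := x 2 * t1 - x 1 * t2 with hk
  set m := (y 2 * t1 - y 1 * t2) with hm
  have k1 : x 1 = -k * x 6 := by rw [hk]; linear_combination (-x 1) * hst + t1 * hqx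
  have k2 : x 2 = k * x 5 := by rw [hk]; linear_combination (-x 2) * hst + t2 * hqx
  have m1 : y 1 = -m * x 6 := by rw [hm]; linear_combination (-y 1) * hst + t1 * hqy'
  have m2 : y 2 = m * x 5 := by rw [hm]; linear_combination (-y 2) * hst + t2 * hqy'
  have hk0 : k ≠ 0 := fun h0 => hr ⟨by rw [k1, h0]; ring, by rw [k2, h0]; ring⟩
  have hm0 : m ≠ 0 := fun h0 => hr' ⟨by rw [m1, h0]; ring, by rw [m2, h0]; ring⟩
  have hX : x = ![0, -k * x 6, k * x 5, 0, 0, x 5, x 6] := by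
    ext i; fin_cases i <;> simp [hx0, hx3, hx4, ← k2]
    rw [k1]; ring
  have hY : y = d • ![0, -(m / d) * x 6, (m / d) * x 5, 0, 0, x 5, x 6] := by
    ext i; fin_cases i <;> simp [hy0, hy3, hy4, d5, d6]
    · rw [m1]; field_simp
    · rw [m2]; field_simp
  have hne : k ≠ m / d := fun hkm => hdep' ⟨d, by rw [hY, ← hkm, ← hX]⟩
  have := samePath_grid hst hk0 (div_ne_zero hm0 hd0) hne
  rw [← hX] at this
  rw [← samePath_smul one_ne_zero one_ne_zero one_ne_zero hd0, ← hY] at this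
  simpa using this

/-- Two points of a hexagon line have a common neighbour. -/
theorem exists_ideal_neighbour {x y : V K} (hx : quad x = 0) (hx0 : x ≠ 0) (hy0 : y ≠ 0)
    (hxy : Hex x y) : ∃ z, IdealPair x z ∧ IdealPair z y := by
  obtain ⟨g, rfl⟩ := exists_act_point hx hx0
  obtain ⟨y, rfl⟩ := (act g).surjective y
  rw [hex_act] at hxy
  have hy0' : y ≠ 0 := by rintro rfl; simp at hy0
  suffices H : ∃ z, IdealPair (bv K 0) z ∧ IdealPair y z by
    obtain ⟨z, h1, h2⟩ := H
    exact ⟨act g z, (idealPair_act g).2 h1, ((idealPair_act g).2 h2).symm⟩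
  obtain ⟨y1, y2, y3, y4⟩ := hex_bv_zero hxy
  have q0 : quad (bv K 0) = 0 := by simp [quad]
  have qy : quad y = 0 := by simp [quad, y1, y2, y3, y4]
  by_cases h : y 5 = 0 ∧ y 6 = 0
  · have h0 : y 0 ≠ 0 := fun h0 => hy0' (by ext i; fin_cases i <;> simp [*])
    refine ⟨bv K 2, ⟨q0, by simp [quad], by simp [form_def], ?_⟩,
      ⟨qy, by simp [quad], by simp [form_def, h], ?_⟩⟩
    · rw [hex_bv_zero_iff]; simp
    · rw [hex_iff]; simp [grass, h0, y1, y2, y3, y4, h]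
  by_cases h0 : y 0 = 0
  · obtain ⟨z5, z6, hz⟩ : ∃ z5 z6 : K, y 6 * z5 - y 5 * z6 = 1 := by
      by_cases h6 : y 6 = 0
      · have h5 : y 5 ≠ 0 := fun h5 => h ⟨h5, h6⟩
        exact ⟨0, -(y 5)⁻¹, by field_simp; ring⟩
      · exact ⟨(y 6)⁻¹, 0, by field_simp; ring⟩
    have qz : quad (![0, y 6, -y 5, 1, 0, z5, z6] : V K) = 0 := by
      simp [quad]; linear_combination hz
    refine ⟨![0, y 6, -y 5, 1, 0, z5, z6], ⟨q0, qz, by simp [form_def], ?_⟩,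
      ⟨qy, qz, by simp [form_def, y1, y2, y3, y4]; ring, ?_⟩⟩
    · rw [hex_bv_zero_iff]; simp
    · rw [hex_iff]
      rintro ⟨-, -, h3, -⟩
      simp [grass, h0, y3] at h3
      have : (0 : K) = 1 := by linear_combination h3 + hz
      simp at this
  · have qz : quad (![0, y 6, -y 5, 0, 0, 0, 0] : V K) = 0 := by simp [quad]
    refine ⟨![0, y 6, -y 5, 0, 0, 0, 0], ⟨q0, qz, by simp [form_def], ?_⟩,
      ⟨qy, qz, by simp [form_def, y1, y2, y3, y4]; ring, ?_⟩⟩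
    · rw [hex_bv_zero_iff]
      rintro ⟨h1, h2, -⟩
      simp at h1 h2
      exact h ⟨h2, h1⟩
    · rw [hex_iff]
      rintro ⟨-, -, -, -, h3, h4, -⟩
      simp [grass, h0, y1, y2, y3] at h3 h4
      exact h ⟨h4, h3⟩

open Classical in
/-- The extension of a cocycle from ideal lines to all lines of the quadric: along a hexagon line it
takes the value of a path of length two through a common neighbour. -/
noncomputable def hat {G : Type*} [Group G] (ψ : V K → V K → G) (x y : V K) : G :=
  if Hex x y then
    if h : ∃ z, IdealPair x z ∧ IdealPair z y then ψ x h.choose * ψ h.choose y else 1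
  else ψ x y

/-- A nonzero singular vector, i.e. one that represents a point of the quadric. -/
def IsSing (x : V K) : Prop := quad x = 0 ∧ x ≠ 0

theorem IdealPair.isSing_left {x y : V K} (h : IdealPair x y) : IsSing x := ⟨h.left, h.ne_zero_left⟩
theorem IdealPair.isSing_right {x y : V K} (h : IdealPair x y) : IsSing y := h.symm.isSing_left

theorem isSing_act (g : G2 K) {x : V K} : IsSing (act g x) ↔ IsSing x := by
  simp [IsSing, quad_act]

theorem hat_of_idealPair {G : Type*} [Group G] {ψ : V K → V K → G} {x y : V K}
    (h : IdealPair x y) : hat ψ x y = ψ x y := by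
  rw [hat, if_neg h.not_hex]

namespace IdealCocycle
variable {G : Type u} [Group G] {ψ : V K → V K → G}

/-- The choice of the common neighbour in the definition of `hat` does not matter. -/
theorem hat_of_hex (hψ : IdealCocycle ψ) {x y z : V K} (h : Hex x y) (h1 : IdealPair x z)
    (h2 : IdealPair z y) : hat ψ x y = ψ x z * ψ z y := by
  have H : ∃ z, IdealPair x z ∧ IdealPair z y := ⟨z, h1, h2⟩
  rw [hat, if_pos h, dif_pos H]
  exact samePath_of_hex h H.choose_spec.1 H.choose_spec.2 h1 h2 G ψ hψ

theorem hat_mul_of_hex (hψ : IdealCocycle ψ) {x y z : V K} (h : Hex x y) (h1 : IdealPair x z)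
    (h2 : IdealPair z y) : hat ψ x z * hat ψ z y = hat ψ x y := by
  rw [hψ.hat_of_hex h h1 h2, hat_of_idealPair h1, hat_of_idealPair h2]

theorem hat_symm (hψ : IdealCocycle ψ) {x y : V K} (hx : IsSing x) (hy : IsSing y) :
    hat ψ x y * hat ψ y x = 1 := by
  by_cases h : Hex x y
  · obtain ⟨z, h1, h2⟩ := exists_ideal_neighbour hx.1 hx.2 hy.2 h
    rw [hψ.hat_of_hex h h1 h2, hψ.hat_of_hex h.symm h2.symm h1.symm]
    calc ψ x z * ψ z y * (ψ y z * ψ z x) = ψ x z * (ψ z y * ψ y z) * ψ z x := by group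
      _ = 1 := by rw [hψ.symm, mul_one, hψ.symm]
  · rw [hat, if_neg h, hat, if_neg fun h' => h h'.symm, hψ.symm]

/-- Two points of an ideal line and the point that is joined to both by hexagon lines. -/
theorem hat_mul_of_two_hex (hψ : IdealCocycle ψ) {x y t : V K} (ht0 : t ≠ 0) (hx : Hex x t)
    (hy : Hex t y) (hxy : IdealPair x y) : hat ψ x t * hat ψ t y = hat ψ x y := by
  obtain ⟨g, rfl, rfl⟩ := exists_act_ideal hxy
  obtain ⟨t, rfl⟩ := (Cayley.act g).surjective t
  rw [hex_act] at hx hy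
  rw [idealPair_act] at hxy
  have ht0' : t ≠ 0 := by rintro rfl; simp at ht0
  obtain ⟨⟨-, h1⟩, -, h6, h4, -, h3, -⟩ := (hex_iff _ _).1 hx
  obtain ⟨⟨h2, -⟩, -, h5, -⟩ := (hex_iff _ _).1 hy
  simp [grass, eq_comm (a := (0 : K))] at h1 h2 h3 h4 h5 h6
  have htt : t = t 0 • bv K 0 := by
    ext i; fin_cases i <;> simp [h1, h2, h3, h4, h5, h6]
  have ht : t 0 ≠ 0 := fun h => ht0' (by rw [htt, h, zero_smul])
  -- The points are in position `x = e₅`, `y = e₆`, `t = e₀`. The point `z` is adjacent to `x` and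
  -- `t`, the point `w` is adjacent to `t`, `y` and `z`, and `e₄` is adjacent to `x`, `z`, `w`, `y`.
  set z : V K := ![0, 0, 1, -1, 0, 1, 1] with hz
  set w : V K := ![0, 1, 0, -1, 0, 1, 1] with hw
  have H : ∀ {x y : V K}, quad x = 0 → quad y = 0 → form x y = 0 → ¬ Hex x y → IdealPair x y :=
    fun h1 h2 h3 h4 => ⟨h1, h2, h3, h4⟩
  have xz : IdealPair (bv K 5) z := by
    apply H <;> simp [quad, z, form_def, hex_iff, grass]
  have xc : IdealPair (bv K 5) (bv K 4) := by
    apply H <;> simp [quad, form_def, hex_iff, grass]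
  have cy : IdealPair (bv K 4) (bv K 6) := by
    apply H <;> simp [quad, form_def, hex_iff, grass]
  have cz : IdealPair (bv K 4) z := by
    apply H <;> simp [quad, z, form_def, hex_iff, grass]
  have cw : IdealPair (bv K 4) w := by
    apply H <;> simp [quad, w, form_def, hex_iff, grass]
  have zw : IdealPair z w := by
    apply H <;> simp [quad, w, z, form_def, hex_iff, grass]
    norm_num
  have wy : IdealPair w (bv K 6) := by
    apply H <;> simp [quad, w, form_def, hex_iff, grass]
  have zt : IdealPair z t := by
    rw [htt, idealPair_smul_right ht]
    apply H <;> simp [quad, z, form_def, hex_iff, grass]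
  have tw : IdealPair t w := by
    rw [htt, idealPair_smul_left ht]
    apply H <;> simp [quad, w, form_def, hex_iff, grass]
  have hψg := hψ.act g
  have e0 := fills_of_ideal zt tw zw G _ hψg
  have e1 := fills_of_ideal xc cz xz G _ hψg
  have e2 := fills_of_ideal cz.symm cw zw G _ hψg
  have e3 := fills_of_ideal cw.symm cy wy G _ hψg
  have e4 := fills_of_ideal xc cy hxy G _ hψg
  beta_reduce at e0 e1 e2 e3 e4
  rw [hψ.hat_of_hex ((hex_act g).2 hx) ((idealPair_act g).2 xz) ((idealPair_act g).2 zt),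
    hψ.hat_of_hex ((hex_act g).2 hy) ((idealPair_act g).2 tw) ((idealPair_act g).2 wy),
    hat_of_idealPair ((idealPair_act g).2 hxy), ← e4]
  have s1 := hψ.symm (Cayley.act g (bv K 4)) (Cayley.act g z)
  have s2 := hψ.symm (Cayley.act g (bv K 4)) (Cayley.act g w)
  rw [mul_assoc, ← mul_assoc (ψ (Cayley.act g z) _), e0, ← e1, ← e2, ← e3]
  calc _ = ψ (Cayley.act g (bv K 5)) (Cayley.act g (bv K 4)) *
      (ψ (Cayley.act g (bv K 4)) (Cayley.act g z) * ψ (Cayley.act g z) (Cayley.act g (bv K 4))) *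
      (ψ (Cayley.act g (bv K 4)) (Cayley.act g w) * ψ (Cayley.act g w) (Cayley.act g (bv K 4))) *
      ψ (Cayley.act g (bv K 4)) (Cayley.act g (bv K 6)) := by group
    _ = _ := by rw [s1, s2, mul_one, mul_one]

/-- Three points of a hexagon line. -/
theorem hat_mul_of_three_hex (hψ : IdealCocycle ψ) {x p y : V K} (hx : IsSing x) (hp : IsSing p)
    (hy : IsSing y) (hxp : Hex x p) (hpy : Hex p y) (hxy : Hex x y) :
    hat ψ x p * hat ψ p y = hat ψ x y := by
  by_cases H : ∃ z, IdealPair x z ∧ IdealPair p z ∧ IdealPair y z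
  · obtain ⟨z, h1, h2, h3⟩ := H
    rw [hψ.hat_of_hex hxp h1 h2.symm, hψ.hat_of_hex hpy h2 h3.symm, hψ.hat_of_hex hxy h1 h3.symm]
    calc _ = ψ x z * (ψ z p * ψ p z) * ψ z y := by group
      _ = _ := by rw [hψ.symm, mul_one]
  -- A common neighbour `z` of `x` and `y` on another hexagon line through `p` reduces the claim to
  -- ideal lines with a third point joined to both by hexagon lines.
  suffices H : ∃ z, Hex p z ∧ IdealPair x z ∧ IdealPair z y by
    obtain ⟨z, h1, h2, h3⟩ := H
    have h0 := h3.isSing_left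
    rw [← hψ.hat_mul_of_hex hxy h2 h3, ← hψ.hat_mul_of_two_hex hp.2 hxp h1 h2,
      ← hψ.hat_mul_of_two_hex hp.2 h1.symm hpy h3]
    calc _ = hat ψ x p * 1 * hat ψ p y := by group
      _ = _ := by rw [← hψ.hat_symm hp h0]; group
  have nxp : ∀ c : K, x ≠ c • p := by
    rintro c rfl
    have hc : c ≠ 0 := by rintro rfl; simp [IsSing] at hx
    obtain ⟨z, h1, h2⟩ := exists_ideal_neighbour hp.1 hp.2 hy.2 hpy
    exact H ⟨z, (idealPair_smul_left hc).2 h1, h1, h2.symm⟩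
  have nyp : ∀ c : K, y ≠ c • p := by
    rintro c rfl
    have hc : c ≠ 0 := by rintro rfl; simp [IsSing] at hy
    obtain ⟨z, h1, h2⟩ := exists_ideal_neighbour hx.1 hx.2 hp.2 hxp
    exact H ⟨z, h1, h2.symm, (idealPair_smul_left hc).2 h2.symm⟩
  clear H
  obtain ⟨g, rfl⟩ := exists_act_point hp.1 hp.2
  obtain ⟨x, rfl⟩ := (Cayley.act g).surjective x
  obtain ⟨y, rfl⟩ := (Cayley.act g).surjective y
  simp only [isSing_act, hex_act] at hx hy hxp hpy hxy
  suffices H : ∃ z, Hex (bv K 0) z ∧ IdealPair x z ∧ IdealPair z y by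
    obtain ⟨z, h1, h2, h3⟩ := H
    exact ⟨Cayley.act g z, (hex_act g).2 h1, (idealPair_act g).2 h2, (idealPair_act g).2 h3⟩
  obtain ⟨x1, x2, x3, x4⟩ := hex_bv_zero hxp.symm
  obtain ⟨y1, y2, y3, y4⟩ := hex_bv_zero hpy
  have hxn : ¬ (x 5 = 0 ∧ x 6 = 0) := fun h => nxp (x 0) (by
    rw [← map_smul]; congr 1; ext i; fin_cases i <;> simp [*])
  have hyn : ¬ (y 5 = 0 ∧ y 6 = 0) := fun h => nyp (y 0) (by
    rw [← map_smul]; congr 1; ext i; fin_cases i <;> simp [*])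
  have hd : x 5 * y 6 = x 6 * y 5 := by
    obtain ⟨-, -, h, -⟩ := (hex_iff _ _).1 hxy
    simp [grass, x3, y3] at h
    linear_combination h
  by_cases h5 : x 5 = 0
  · have h6 : x 6 ≠ 0 := fun h6 => hxn ⟨h5, h6⟩
    have hy5 : y 5 = 0 := by simpa [h5, h6] using hd.symm
    have hy6 : y 6 ≠ 0 := fun h6 => hyn ⟨hy5, h6⟩
    refine ⟨bv K 5, by simp [hex_bv_zero_iff], ⟨hx.1, by simp [quad], by simp [form_def, x1], ?_⟩,
      IdealPair.symm ⟨hy.1, by simp [quad], by simp [form_def, y1], ?_⟩⟩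
    · simp [hex_iff, grass, *]
    · simp [hex_iff, grass, *]
  · have hy5 : y 5 ≠ 0 := fun hy5 => hyn ⟨hy5, by simpa [h5, hy5] using hd⟩
    refine ⟨bv K 6, by simp [hex_bv_zero_iff], ⟨hx.1, by simp [quad], by simp [form_def, x2], ?_⟩,
      IdealPair.symm ⟨hy.1, by simp [quad], by simp [form_def, y2], ?_⟩⟩
    · simp [hex_iff, grass, *]
    · simp [hex_iff, grass, *]

/-- The extended cocycle multiplies correctly along all triangles of the polar space of the quadric.
-/
theorem hat_mul (hψ : IdealCocycle ψ) {x y z : V K} (hx : IsSing x) (hy : IsSing y)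
    (hz : IsSing z) (hxy : form x y = 0) (hyz : form y z = 0) (hxz : form x z = 0) :
    hat ψ x y * hat ψ y z = hat ψ x z := by
  have sw1 : hat ψ x z * hat ψ z y = hat ψ x y → hat ψ x y * hat ψ y z = hat ψ x z := fun h => by
    rw [← h, mul_assoc, hψ.hat_symm hz hy, mul_one]
  have sw2 : hat ψ y x * hat ψ x z = hat ψ y z → hat ψ x y * hat ψ y z = hat ψ x z := fun h => by
    rw [← h, ← mul_assoc, hψ.hat_symm hx hy, one_mul]
  have P : ∀ {x y : V K}, IsSing x → IsSing y → form x y = 0 → ¬ Hex x y → IdealPair x y :=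
    fun h1 h2 h3 h4 => ⟨h1.1, h2.1, h3, h4⟩
  by_cases h1 : Hex x y <;> by_cases h2 : Hex y z <;> by_cases h3 : Hex x z
  · exact hψ.hat_mul_of_three_hex hx hy hz h1 h2 h3
  · exact hψ.hat_mul_of_two_hex hy.2 h1 h2 (P hx hz hxz h3)
  · exact sw2 (hψ.hat_mul_of_two_hex hx.2 h1.symm h3 (P hy hz hyz h2))
  · exact sw1 (hψ.hat_mul_of_hex h1 (P hx hz hxz h3) (P hy hz hyz h2).symm)
  · exact sw1 (hψ.hat_mul_of_two_hex hz.2 h3 h2.symm (P hx hy hxy h1))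
  · exact sw2 (hψ.hat_mul_of_hex h2 (P hx hy hxy h1).symm (P hx hz hxz h3))
  · exact hψ.hat_mul_of_hex h3 (P hx hy hxy h1) (P hy hz hyz h2)
  · have a := P hx hy hxy h1
    have b := P hy hz hyz h2
    have c := P hx hz hxz h3
    rw [hat_of_idealPair a, hat_of_idealPair b, hat_of_idealPair c]
    exact fills_of_ideal a b c G ψ hψ

end IdealCocycle

/-! ### The potential of a cocycle on the quadric -/

/-- Two points of the polar space of the quadric have a common neighbour. -/
theorem exists_sing_perp {x y : V K} (hx : IsSing x) (hy : IsSing y) :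
    ∃ u, IsSing u ∧ form x u = 0 ∧ form u y = 0 := by
  by_cases h : form x y = 0
  · exact ⟨x, hx, by rw [form_self, hx.1, mul_zero], h⟩
  obtain ⟨g, h1, h2⟩ := exists_act_pair (x := x) (y := (form x y)⁻¹ • y) hx.1
    (by rw [quad_smul, hy.1, mul_zero]) (by rw [form_smul_right, inv_mul_cancel₀ h])
  refine ⟨act g (bv K 1), (isSing_act g).2 ⟨by simp [quad], by simp⟩, ?_, ?_⟩
  · rw [← h1, form_act]; simp [form_def]
  · have : y = form x y • act g (bv K 4) := by rw [h2, smul_smul, mul_inv_cancel₀ h, one_smul]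
    rw [this, form_smul_right, form_act]; simp [form_def]

/-- Two points `b`, `y` and two common neighbours of them in the polar space of the quadric are all
collinear with a further point. -/
theorem exists_sing_perp_four {u v b y : V K} (hu : quad u = 0) (hv : quad v = 0)
    (huv : form u v = 1) (hb : IsSing b) (hy : quad y = 0) (hub : form u b = 0)
    (hvb : form v b = 0) (huy : form u y = 0) (hvy : form v y = 0) :
    ∃ c, IsSing c ∧ form b c = 0 ∧ form c y = 0 ∧ form u c = 0 ∧ form v c = 0 := by
  by_cases hby : form b y = 0
  · exact ⟨b, hb, by rw [form_self, hb.1, mul_zero], hby, hub, hvb⟩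
  obtain ⟨g, rfl, rfl⟩ := exists_act_pair hu hv huv
  obtain ⟨b, rfl⟩ := (act g).surjective b
  obtain ⟨y, rfl⟩ := (act g).surjective y
  simp only [form_act, quad_act, isSing_act] at *
  suffices H : ∃ c, IsSing c ∧ form b c = 0 ∧ form c y = 0 ∧ form (bv K 0) c = 0 ∧
      form (bv K 4) c = 0 by
    obtain ⟨c, h⟩ := H
    exact ⟨act g c, by simpa only [form_act, isSing_act] using h⟩
  have b4 : b 4 = 0 := by simpa [form_def] using hub
  have b0 : b 0 = 0 := by simpa [form_def] using hvb
  -- A second point `a` of the polar space of `u` and `v` that is collinear with `b`; the required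
  -- point is the one on the line of `a` and `b` that is collinear with `y`.
  obtain ⟨a, qa, ba, a0, a4, hne⟩ : ∃ a : V K, quad a = 0 ∧ form b a = 0 ∧ a 0 = 0 ∧ a 4 = 0 ∧
      ∀ r s : K, r ≠ 0 → r • a - s • b ≠ 0 := by
    by_cases h : b 5 = 0 ∧ b 6 = 0
    · have b3 : b 3 = 0 := by
        have := hb.1
        simpa [quad, b0, h] using this
      refine ⟨![0, 0, 0, 0, 0, -b 2, b 1], by simp [quad], by simp [form_def, b3]; ring, by simp,
        by simp, fun r s hr h0 => hb.2 ?_⟩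
      have h5 := congrFun h0 5
      have h6 := congrFun h0 6
      simp [h, hr] at h5 h6
      ext i; fin_cases i <;> simp [b0, b3, b4, h, h5, h6]
    · refine ⟨![0, -b 6, b 5, 0, 0, 0, 0], by simp [quad], by simp [form_def]; ring, by simp,
        by simp, fun r s hr h0 => ?_⟩
      have h1 := congrFun h0 1
      have h2 := congrFun h0 2
      have h5 := congrFun h0 5
      have h6 := congrFun h0 6
      simp at h1 h2 h5 h6
      have hs : s = 0 := by tauto
      simp [hs, hr] at h1 h2
      exact h ⟨h2, h1⟩
  refine ⟨form b y • a - form a y • b, ⟨?_, hne _ _ hby⟩, ?_, ?_, ?_, ?_⟩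
  · rw [sub_eq_add_neg, ← neg_smul, quad_add, quad_smul, quad_smul, form_smul_left,
      form_smul_right, form_comm a b, ba, qa, hb.1]; ring
  · rw [form_sub_right, form_smul_right, form_smul_right, ba, form_self, hb.1]; ring
  · rw [form_sub_left, form_smul_left, form_smul_left]; ring
  · simp [form_def, a4, b4]
  · simp [form_def, a0, b0]

/-- In the polar space of the quadric, any point is collinear with some point of a given line. -/
theorem exists_sing_perp_three {b y z : V K} (hb : IsSing b) (hy : IsSing y) (hz : IsSing z)
    (hyz : form y z = 0) : ∃ u, IsSing u ∧ form b u = 0 ∧ form u y = 0 ∧ form u z = 0 := by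
  by_cases h : form b y = 0
  · exact ⟨y, hy, h, by rw [form_self, hy.1, mul_zero], hyz⟩
  by_cases h0 : form b z • y - form b y • z = 0
  · obtain ⟨u, hu, h1, h2⟩ := exists_sing_perp hb hy
    have hz' : z = ((form b y)⁻¹ * form b z) • y := by
      rw [mul_smul, sub_eq_zero.1 h0, smul_smul, inv_mul_cancel₀ h, one_smul]
    exact ⟨u, hu, h1, h2, by rw [hz', form_smul_right, h2, mul_zero]⟩
  · refine ⟨_, ⟨?_, h0⟩, ?_, ?_, ?_⟩
    · rw [sub_eq_add_neg, ← neg_smul, quad_add, quad_smul, quad_smul, form_smul_left,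
        form_smul_right, hyz, hy.1, hz.1]; ring
    · rw [form_sub_right, form_smul_right, form_smul_right]; ring
    · rw [form_sub_left, form_smul_left, form_smul_left, form_self, form_comm z, hyz, hy.1]; ring
    · rw [form_sub_left, form_smul_left, form_smul_left, form_self, hyz, hz.1]; ring

/-- Every cocycle on the ideal lines is a coboundary. -/
theorem IdealCocycle.exists_potential {G : Type u} [Group G] {ψ : V K → V K → G}
    (hψ : IdealCocycle ψ) :
    ∃ g : V K → G, ∀ y z, IdealPair y z → ψ y z = (g y)⁻¹ * g z := by
  classical
  have hb : IsSing (bv K 0) := ⟨by simp [quad], by simp⟩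
  set b := bv K 0
  -- The value at `y` is that of any path of length two from `b` to `y` in the polar space.
  have hex := fun y (hy : IsSing y) => exists_sing_perp hb hy
  let g : V K → G := fun y => if hy : IsSing y then
    hat ψ b (hex y hy).choose * hat ψ (hex y hy).choose y else 1
  have perp_indep : ∀ y u v, IsSing y → IsSing u → IsSing v → form b u = 0 → form u y = 0 →
      form b v = 0 → form v y = 0 → form u v = 0 →
      hat ψ b u * hat ψ u y = hat ψ b v * hat ψ v y := by
    intro y u v hy hu hv h1 h2 h3 h4 h
    rw [← hψ.hat_mul hb hu hv h1 h h3, mul_assoc, hψ.hat_mul hu hv hy h h4 h2]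
  have indep : ∀ y u v, IsSing y → IsSing u → IsSing v → form b u = 0 → form u y = 0 →
      form b v = 0 → form v y = 0 → hat ψ b u * hat ψ u y = hat ψ b v * hat ψ v y := by
    intro y u v hy hu hv h1 h2 h3 h4
    by_cases h : form u v = 0
    · exact perp_indep y u v hy hu hv h1 h2 h3 h4 h
    obtain ⟨c, hc, h5, h6, h7, h8⟩ := exists_sing_perp_four (u := u) (v := (form u v)⁻¹ • v)
      (b := b) (y := y) hu.1 (by rw [quad_smul, hv.1, mul_zero])
      (by rw [form_smul_right, inv_mul_cancel₀ h]) hb hy.1 (by rw [form_comm, h1])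
      (by rw [form_smul_left, form_comm v, h3, mul_zero]) h2 (by rw [form_smul_left, h4, mul_zero])
    have h8' : form c v = 0 := by
      rw [form_smul_left, mul_eq_zero, form_comm v] at h8
      exact h8.resolve_left (inv_ne_zero h)
    rw [perp_indep y u c hy hu hc h1 h2 h5 h6 h7, perp_indep y c v hy hc hv h5 h6 h3 h4 h8']
  have hg : ∀ y u, IsSing y → IsSing u → form b u = 0 → form u y = 0 →
      g y = hat ψ b u * hat ψ u y := by
    intro y u hy hu h1 h2
    simp only [g, dif_pos hy]
    have hs := (hex y hy).choose_spec
    exact indep y _ u hy hs.1 hu hs.2.1 hs.2.2 h1 h2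
  refine ⟨g, fun y z h => ?_⟩
  have hy := h.isSing_left
  have hz := h.isSing_right
  obtain ⟨u, hu, h1, h2, h3⟩ := exists_sing_perp_three hb hy hz h.form
  rw [hg y u hy hu h1 h2, hg z u hz hu h1 h3, ← hψ.hat_mul hu hy hz h2 h.form h3,
    hat_of_idealPair h]
  group

/-! ### The geometry of ideal lines and ideal planes -/

theorem onQuadric_pair {x y : V K} (hx : quad x = 0) (hy : quad y = 0) (hxy : form x y = 0) :
    OnQuadric (K ∙ x ⊔ K ∙ y) := by
  intro z hz
  obtain ⟨a, b, rfl⟩ := mem_pair.1 hz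
  rw [quad_add, quad_smul, quad_smul, form_smul_left, form_smul_right, hx, hy, hxy]; ring

theorem onQuadric_singleton {x : V K} (hx : quad x = 0) : OnQuadric (K ∙ x) := by
  intro z hz
  obtain ⟨a, rfl⟩ := Submodule.mem_span_singleton.1 hz
  rw [quad_smul, hx, mul_zero]

theorem isHexagonPoint_span {x : V K} (h : IsSing x) : IsHexagonPoint (K ∙ x) :=
  ⟨finrank_span_singleton h.2, onQuadric_singleton h.1⟩

theorem OnQuadric.form {U : Submodule K (V K)} (h : OnQuadric U) {x y : V K} (hx : x ∈ U)
    (hy : y ∈ U) : form x y = 0 := by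
  rw [Cayley.form, h _ (U.add_mem hx hy), h x hx, h y hy]; ring

theorem isHexagonLine_pair {x y : V K} (hx : quad x = 0) (hy : quad y = 0) (h : Hex x y)
    (hi : LinearIndependent K ![x, y]) : IsHexagonLine (K ∙ x ⊔ K ∙ y) := by
  rw [isHexagonLine_iff]
  refine ⟨finrank_pair hi, ?_⟩
  intro u hu v hv
  obtain ⟨a, b, rfl⟩ := mem_pair.1 hu
  obtain ⟨c, d, rfl⟩ := mem_pair.1 hv
  have h1 : Hex x (c • x + d • y) := ((hex_self hx).smul_right c).add_right (h.smul_right d)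
  have h2 : Hex y (c • x + d • y) := (h.symm.smul_right c).add_right ((hex_self hy).smul_right d)
  exact ((h1.symm.smul_right a).add_right (h2.symm.smul_right b)).symm

theorem IdealPair.indep {x y : V K} (h : IdealPair x y) : LinearIndependent K ![x, y] := by
  rw [LinearIndependent.pair_iff' h.ne_zero_left]
  rintro a rfl
  exact h.not_hex ((hex_self h.left).smul_right a)

theorem IdealPair.isIdealLine {x y : V K} (h : IdealPair x y) : IsIdealLine (K ∙ x ⊔ K ∙ y) :=
  ⟨finrank_pair h.indep, onQuadric_pair h.left h.right h.form, fun h' => h.not_hex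
    (((isHexagonLine_iff _).1 h').2 _ (left_mem_pair x y) _ (right_mem_pair x y))⟩

theorem IsIdealLine.idealPair {x y : V K} (h : IsIdealLine (K ∙ x ⊔ K ∙ y)) : IdealPair x y := by
  have hx := h.2.1 _ (left_mem_pair x y)
  have hy := h.2.1 _ (right_mem_pair x y)
  exact ⟨hx, hy, h.2.1.form (left_mem_pair x y) (right_mem_pair x y), fun h' =>
    h.2.2 (isHexagonLine_pair hx hy h' (indep_of_finrank_pair h.1))⟩

theorem tri_add_left (x y z w : V K) : tri (x + y) z w = tri x z w + tri y z w := by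
  rw [tri_rotate, tri_add_right, tri_rotate x, tri_rotate y]
theorem tri_add_mid (x y z w : V K) : tri x (y + z) w = tri x y w + tri x z w := by
  rw [tri_rotate, tri_add_left, tri_rotate x, tri_rotate x]
theorem tri_self (x y : V K) : tri x x y = 0 := by simp only [tri_def]; ring
theorem tri_self' (x y : V K) : tri x y x = 0 := by simp only [tri_def]; ring
theorem tri_self'' (x y : V K) : tri y x x = 0 := by simp only [tri_def]; ring

/-- A nonzero value of the alternating trilinear form shows that a plane is ideal. -/
theorem isIdealPlane_of_tri {x y z : V K} (hx : quad x = 0) (hy : quad y = 0) (hz : quad z = 0)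
    (hxy : form x y = 0) (hyz : form y z = 0) (hxz : form x z = 0) (ht : tri x y z ≠ 0) :
    IsIdealPlane (K ∙ x ⊔ K ∙ y ⊔ K ∙ z) := by
  have hex_zero : ∀ {u v : V K}, Hex u v → ∀ w, tri u v w = 0 := fun h w => by
    by_contra h'
    exact not_hex_of_tri h' h
  refine ⟨finrank_triple ?_, ?_, ?_⟩
  · refine linearIndependent_triple fun a b c h => ?_
    have h1 : tri (a • x + b • y + c • z) y z = 0 := by rw [h]; simp [tri_def]
    have h2 : tri x (a • x + b • y + c • z) z = 0 := by rw [h]; simp [tri_def]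
    have h3 : tri x y (a • x + b • y + c • z) = 0 := by rw [h]; simp [tri_def]
    simp only [tri_add_left, tri_smul_left, tri_self, tri_self'', tri_add_mid, tri_smul_mid,
      tri_add_right, tri_smul_right, tri_self', mul_zero, add_zero, zero_add, mul_eq_zero, ht,
      or_false] at h1 h2 h3
    exact ⟨h1, h2, h3⟩
  · intro w hw
    obtain ⟨a, b, c, rfl⟩ := mem_triple.1 hw
    simp only [quad_add, quad_smul, form_add_left, form_smul_left, form_smul_right, hx, hy, hz,
      hxy, hyz, hxz]
    ring
  · intro W hW h
    rw [isHexagonLine_iff] at h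
    obtain ⟨u, v, hi, rfl⟩ := exists_eq_pair h.1
    obtain ⟨a, b, c, hu⟩ := mem_triple.1 (hW (left_mem_pair u v))
    obtain ⟨d, e, f, hv⟩ := mem_triple.1 (hW (right_mem_pair u v))
    have h0 := hex_zero (h.2 u (left_mem_pair u v) v (right_mem_pair u v))
    have e1 := h0 x
    have e2 := h0 y
    have e3 := h0 z
    have r1 : tri y z x = tri x y z := (tri_rotate x y z).symm
    have r2 : tri z x y = tri x y z := tri_rotate z x y
    have r3 : tri z y x = -tri x y z := by rw [tri_swap, r1]
    have r4 : tri x z y = -tri x y z := by rw [tri_swap, r2]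
    have r5 : tri y x z = -tri x y z := by rw [tri_swap]
    rw [hu, hv] at e1 e2 e3
    simp only [tri_add_left, tri_add_mid, tri_smul_left, tri_smul_mid, tri_self, tri_self',
      tri_self'', r1, r2, r3, r4, r5] at e1 e2 e3
    -- All minors of the coordinates of `u` and `v` vanish, so that these are dependent.
    have m1 : b * f - c * e = 0 := by
      apply (mul_eq_zero.1 (_ : _ * tri x y z = 0)).resolve_right ht
      linear_combination e1
    have m2 : a * f - c * d = 0 := by
      apply (mul_eq_zero.1 (_ : _ * tri x y z = 0)).resolve_right ht
      linear_combination -e2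
    have m3 : a * e - b * d = 0 := by
      apply (mul_eq_zero.1 (_ : _ * tri x y z = 0)).resolve_right ht
      linear_combination e3
    have hne := LinearIndependent.pair_iff.1 hi
    have g1 := hne d (-a) (by
      rw [hu, hv]
      ext i
      simp
      linear_combination (-y i) * m3 - z i * m2)
    have g2 := hne e (-b) (by
      rw [hu, hv]
      ext i
      simp
      linear_combination x i * m3 - z i * m1)
    have g3 := hne f (-c) (by
      rw [hu, hv]
      ext i
      simp
      linear_combination x i * m2 + y i * m1)
    have g4 := hne 1 0 (by
      rw [hu, neg_eq_zero.1 g1.2, neg_eq_zero.1 g2.2, neg_eq_zero.1 g3.2]; simp)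
    exact one_ne_zero g4.1

theorem IdealPair.exists_plane {x y : V K} (h : IdealPair x y) :
    ∃ e, IsIdealPlane e ∧ K ∙ x ⊔ K ∙ y ≤ e := by
  obtain ⟨g, rfl, rfl⟩ := exists_act_ideal h
  refine ⟨K ∙ act g (bv K 5) ⊔ K ∙ act g (bv K 6) ⊔ K ∙ act g (bv K 4), ?_, le_sup_left⟩
  apply isIdealPlane_of_tri <;> simp only [quad_act, form_act, tri_act] <;>
    simp [quad, form_def, tri_def]

theorem IsIdealPlane.isIdealLine {e l : Submodule K (V K)} (h : IsIdealPlane e) (hl : l ≤ e)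
    (hd : Module.finrank K l = 2) : IsIdealLine l :=
  ⟨hd, fun x hx => h.2.1 x (hl hx), h.2.2 l hl⟩

variable (K) in
theorem isRankThree_ideal : IsRankThree {U : Submodule K (V K) | IsHexagonPoint U}
    {U | IsIdealLine U} {U | IsIdealPlane U} fun p e => p ≤ e where
  dimP p hp := hp.1
  dimL l hl := hl.1
  dimE e he := he.1
  point_mem l hl x hx hx0 := isHexagonPoint_span ⟨hl.2.1 x hx, hx0⟩
  exists_line p hp := by
    obtain ⟨x, hx0, rfl⟩ := exists_eq_span_singleton hp.1
    have hx := hp.2 x (Submodule.mem_span_singleton_self x)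
    obtain ⟨z, hz, -⟩ := exists_ideal_neighbour hx hx0 hx0 (hex_self hx)
    exact ⟨_, hz.isIdealLine, le_sup_left⟩
  exists_plane l hl := by
    obtain ⟨x, y, -, rfl⟩ := exists_eq_pair hl.1
    exact hl.idealPair.exists_plane
  exists_line_le e he := by
    obtain ⟨x, hx, y, hy, hxy⟩ := exists_indep_pair (e := e) (by rw [he.1]; norm_num)
    have hle : K ∙ x ⊔ K ∙ y ≤ e := sup_le (by simpa) (by simpa)
    exact ⟨_, he.isIdealLine hle (finrank_pair hxy), hle⟩
  rel_iff p hp e he := by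
    constructor
    · intro h
      obtain ⟨x, hx0, rfl⟩ := exists_eq_span_singleton hp.1
      have hx : x ∈ e := by simpa using h
      obtain ⟨y, hy, hxy⟩ := exists_indep_mem (e := e) (by rw [he.1]; norm_num) hx hx0
      have hle : K ∙ x ⊔ K ∙ y ≤ e := sup_le (by simpa) (by simpa)
      exact ⟨_, he.isIdealLine hle (finrank_pair hxy), le_sup_left, hle⟩
    · rintro ⟨l, -, h1, h2⟩
      exact h1.trans h2
  nonempty := ⟨K ∙ bv K 0, isHexagonPoint_span ⟨by simp [quad], by simp⟩⟩

variable (K) in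
theorem gamma3_isGeometry : (Gamma3 K).IsGeometry := (isRankThree_ideal K).isGeometry

/-- The graph of ideal lines has diameter at most two. -/
theorem exists_common_ideal_neighbour {x y : V K} (hx : IsSing x) (hy : IsSing y) :
    ∃ z, IdealPair x z ∧ (IdealPair z y ∨ z = y) := by
  by_cases h : form x y = 0
  · by_cases h' : Hex x y
    · obtain ⟨z, h1, h2⟩ := exists_ideal_neighbour hx.1 hx.2 hy.2 h'
      exact ⟨z, h1, Or.inl h2⟩
    · exact ⟨y, ⟨hx.1, hy.1, h, h'⟩, Or.inr rfl⟩
  obtain ⟨g, h1, h2⟩ := exists_act_pair (x := x) (y := (form x y)⁻¹ • y) hx.1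
    (by rw [quad_smul, hy.1, mul_zero]) (by rw [form_smul_right, inv_mul_cancel₀ h])
  have q : quad (![0, 1, 0, 1, 0, 1, 0] : V K) = 0 := by simp [quad]
  refine ⟨act g ![0, 1, 0, 1, 0, 1, 0], ?_, Or.inl ?_⟩
  · rw [← h1, idealPair_act]
    exact ⟨by simp [quad], q, by simp [form_def], by simp [hex_bv_zero_iff]⟩
  · rw [← idealPair_smul_right (inv_ne_zero h), ← h2, idealPair_act]
    exact ⟨q, by simp [quad], by simp [form_def], fun h => by
      simpa using (hex_bv_four_iff.1 h.symm)⟩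

/-- A cocycle of the geometry, as a function of vectors. -/
theorem IsEdgeCocycle.idealCocycle {G : Type*} [Group G]
    {Ψ : Submodule K (V K) → Submodule K (V K) → G}
    (hΨ : IsEdgeCocycle {U : Submodule K (V K) | IsHexagonPoint U} {U | IsIdealLine U}
      {U | IsIdealPlane U} Ψ) : IdealCocycle fun x y => Ψ (K ∙ x) (K ∙ y) where
  smul_left c x y hc := by rw [Submodule.span_singleton_smul_eq (IsUnit.mk0 c hc)]
  smul_right c x y hc := by rw [Submodule.span_singleton_smul_eq (IsUnit.mk0 c hc)]
  self x := hΨ.self _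
  symm x y := hΨ.symm _ _
  plane x y z hxy hyz hxz ht := by
    refine hΨ.tri _ (isHexagonPoint_span hxy.isSing_left) _
      (isHexagonPoint_span hxy.isSing_right) _ (isHexagonPoint_span hxz.isSing_right)
      hxy.isIdealLine hyz.isIdealLine hxz.isIdealLine ⟨_, Or.inr
      (isIdealPlane_of_tri hxy.left hxy.right hyz.right hxy.form hyz.form hxz.form ht),
      le_sup_left.trans le_sup_left, le_sup_right.trans le_sup_left, le_sup_right⟩
  line x y z hxy hyz hxz hz := by
    refine hΨ.tri _ (isHexagonPoint_span hxy.isSing_left) _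
      (isHexagonPoint_span hxy.isSing_right) _ (isHexagonPoint_span hxz.isSing_right)
      hxy.isIdealLine hyz.isIdealLine hxz.isIdealLine
      ⟨_, Or.inl hxy.isIdealLine, le_sup_left, le_sup_right, ?_⟩
    rwa [Submodule.span_singleton_le_iff_mem, ← Submodule.span_insert]

variable (K) in
theorem gamma3_simplyConnected : (Gamma3 K).SimplyConnected := by
  refine (isRankThree_ideal K).simplyConnected ?_ ?_
  · intro p hp q hq
    obtain ⟨x, hx0, rfl⟩ := exists_eq_span_singleton hp.1
    obtain ⟨y, hy0, rfl⟩ := exists_eq_span_singleton hq.1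
    obtain ⟨z, h1, h2⟩ := exists_common_ideal_neighbour
      (x := x) (y := y) ⟨hp.2 x (by simp), hx0⟩ ⟨hq.2 y (by simp), hy0⟩
    refine ⟨K ∙ z, isHexagonPoint_span h1.isSing_right, Or.inr h1.isIdealLine, ?_⟩
    rcases h2 with h2 | rfl
    · exact Or.inr h2.isIdealLine
    · exact Or.inl rfl
  · intro G _ Ψ hΨ
    obtain ⟨g, hg⟩ := hΨ.idealCocycle.exists_potential
    obtain ⟨r, hr⟩ := exists_repr (K := K) (V K)
    refine ⟨fun p => g (r p), fun p hp q hq hpq => ?_⟩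
    have h : IdealPair (r p) (r q) := by
      apply IsIdealLine.idealPair
      rw [← hr p hp.1, ← hr q hq.1]
      exact hpq
    have := hg _ _ h
    beta_reduce at this
    rwa [← hr p hp.1, ← hr q hq.1] at this

/-! ### The symplectic space in characteristic two -/

section CharTwo
variable [CharP K 2]

theorem form_self_two (x : V K) : form x x = 0 := by
  rw [form_self, CharTwo.two_eq_zero, zero_mul]

theorem form_bv_three (x : V K) : form x (bv K 3) = 0 := by
  simp [form_def, CharTwo.two_eq_zero]

theorem quad_bv_three : quad (bv K 3) = 1 := by
  simp [quad, CharTwo.neg_eq]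

/-- Contraction of the trilinear form with the unit octonion yields the symplectic form. -/
theorem tri_bv_three (x y : V K) : tri x y (bv K 3) = form x y := by
  simp [tri_def, form_def]
  linear_combination (-(x 4 * y 0 + x 5 * y 1 + x 6 * y 2) + x 3 * y 3) *
    (CharTwo.two_eq_zero : (2 : K) = 0)

omit [CharP K 2] in
theorem proj₃_apply (x : V K) (i : Fin 7) : proj₃ K x i = if i = 3 then 0 else x i := by
  by_cases h : i = 3 <;> simp [proj₃, h]

omit [CharP K 2] in
theorem proj₃_add (x : V K) : proj₃ K x + x 3 • bv K 3 = x := by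
  ext i; fin_cases i <;> simp [proj₃_apply]

omit [CharP K 2] in
theorem proj₃_mem (x : V K) : proj₃ K x ∈ hyp K := by
  simp [hyp, proj₃_apply]

omit [CharP K 2] in
theorem proj₃_of_mem {x : V K} (hx : x ∈ hyp K) : proj₃ K x = x := by
  have h3 : x 3 = 0 := by simpa [hyp] using hx
  have := proj₃_add x
  rwa [h3, zero_smul, add_zero] at this

omit [CharP K 2] in
theorem proj₃_bv_three : proj₃ K (bv K 3) = 0 := by
  ext i; fin_cases i <;> simp [proj₃_apply]

theorem form_proj₃_right (x y : V K) : form x (proj₃ K y) = form x y := by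
  conv_rhs => rw [← proj₃_add y, form_add_right, form_smul_right, form_bv_three, mul_zero, add_zero]

theorem form_proj₃_left (x y : V K) : form (proj₃ K x) y = form x y := by
  rw [form_comm, form_proj₃_right, form_comm]

omit [CharP K 2] in
theorem exists_form_ne_zero {x : V K} (h : proj₃ K x ≠ 0) : ∃ y, form x y ≠ 0 := by
  by_contra! hcon
  apply h
  have h0 := hcon (bv K 4)
  have h1 := hcon (bv K 5)
  have h2 := hcon (bv K 6)
  have h4 := hcon (bv K 0)
  have h5 := hcon (bv K 1)
  have h6 := hcon (bv K 2)
  simp [form_def] at h0 h1 h2 h4 h5 h6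
  ext i; fin_cases i <;> simp [proj₃_apply, *]

theorem proj₃_ne_zero {x y : V K} (h : form x y ≠ 0) : proj₃ K x ≠ 0 := by
  intro h0
  rw [← form_proj₃_left, h0] at h
  simp [form_def] at h

omit [CharP K 2] in
/-- Any two points are both non-perpendicular to some third point. -/
theorem exists_common_symp {x y : V K} (hx : proj₃ K x ≠ 0) (hy : proj₃ K y ≠ 0) :
    ∃ u, form x u ≠ 0 ∧ form u y ≠ 0 := by
  obtain ⟨s, hs⟩ := exists_form_ne_zero hx
  obtain ⟨t, ht⟩ := exists_form_ne_zero hy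
  by_cases h1 : form s y = 0
  · by_cases h2 : form x t = 0
    · refine ⟨s + t, ?_, ?_⟩
      · rwa [form_add_right, h2, add_zero]
      · rwa [form_add_left, h1, zero_add, form_comm]
    · exact ⟨t, h2, by rwa [form_comm]⟩
  · exact ⟨s, hs, h1⟩

/-- A function on pairs of vectors that multiplies correctly along all triangles of pairwise
non-perpendicular points is a coboundary. -/
theorem exists_symp_potential {G : Type*} [Group G] {ψ : V K → V K → G}
    (symm : ∀ x y, ψ x y * ψ y x = 1)
    (tri : ∀ x y z, form x y ≠ 0 → form y z ≠ 0 → form x z ≠ 0 → ψ x y * ψ y z = ψ x z) :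
    ∃ g : V K → G, ∀ y z, form y z ≠ 0 → ψ y z = (g y)⁻¹ * g z := by
  classical
  set b := bv K 0 with hb
  have b0 : proj₃ K b ≠ 0 := fun h => by
    have := congrFun h 0
    simp [hb, proj₃_apply] at this
  -- The value at `y` is that of any path of length two from `b` to `y`.
  have hex := fun y (hy : proj₃ K y ≠ 0) => exists_common_symp b0 hy
  let g : V K → G := fun y => if hy : proj₃ K y ≠ 0 then
    ψ b (hex y hy).choose * ψ (hex y hy).choose y else 1
  have adj_indep : ∀ y u v, form b u ≠ 0 → form u y ≠ 0 → form b v ≠ 0 → form v y ≠ 0 →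
      form u v ≠ 0 → ψ b u * ψ u y = ψ b v * ψ v y := by
    intro y u v h1 h2 h3 h4 h
    rw [← tri b u v h1 h h3, mul_assoc, tri u v y h h4 h2]
  have indep : ∀ y u v, form b u ≠ 0 → form u y ≠ 0 → form b v ≠ 0 → form v y ≠ 0 →
      ψ b u * ψ u y = ψ b v * ψ v y := by
    intro y u v h1 h2 h3 h4
    by_cases h : form u v = 0
    swap
    · exact adj_indep y u v h1 h2 h3 h4 h
    by_cases hy : form b y = 0
    swap
    · rw [tri b u y h1 h2 hy, tri b v y h3 h4 hy]
    have e1 : form b (u + b) ≠ 0 := by rwa [form_add_right, form_self_two, add_zero]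
    have e2 : form (u + b) y ≠ 0 := by rwa [form_add_left, hy, add_zero]
    rw [adj_indep y u (u + b) h1 h2 e1 e2
        (by rwa [form_add_right, form_self_two, zero_add, form_comm]),
      adj_indep y (u + b) v e1 e2 h3 h4 (by rwa [form_add_left, h, zero_add])]
  have hg : ∀ y u, form b u ≠ 0 → form u y ≠ 0 → g y = ψ b u * ψ u y := by
    intro y u h1 h2
    have hy : proj₃ K y ≠ 0 := proj₃_ne_zero (y := u) (by rwa [form_comm])
    simp only [g, dif_pos hy]
    have hs := (hex y hy).choose_spec
    exact indep y _ u hs.1 hs.2 h1 h2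
  have key : ∀ y z u, form b u ≠ 0 → form u y ≠ 0 → form u z ≠ 0 → form y z ≠ 0 →
      ψ y z = (g y)⁻¹ * g z := by
    intro y z u h1 h2 h3 h
    rw [hg y u h1 h2, hg z u h1 h3, ← tri u y z h2 h h3]
    group
  have hadj : ∀ y, form b y ≠ 0 → g y = ψ b y := by
    intro y hy
    obtain ⟨u, h1, h2⟩ := hex y (proj₃_ne_zero (y := b) (by rwa [form_comm]))
    rw [hg y u h1 h2, tri b u y h1 h2 hy]
  have mixed : ∀ y z, form b y ≠ 0 → form y z ≠ 0 → ψ y z = (g y)⁻¹ * g z := by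
    intro y z hy h
    rw [hg z y hy h, hadj y hy]; group
  refine ⟨g, fun y z h => ?_⟩
  by_cases hy : form b y = 0
  swap
  · exact mixed y z hy h
  by_cases hz : form b z = 0
  swap
  · rw [eq_inv_of_mul_eq_one_left (symm y z), mixed z y hz (by rwa [form_comm])]; group
  -- If `b` is perpendicular to `y` and `z`, a point not perpendicular to `b` can be changed by
  -- multiples of `y` and `z` such that it has inner product one with both.
  obtain ⟨s, hs⟩ := exists_form_ne_zero b0
  obtain ⟨r, hr⟩ : ∃ r, form s y + r * form z y = 1 :=
    ⟨(1 - form s y) / form z y, by rw [form_comm] at h; field_simp; ring⟩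
  obtain ⟨t, ht⟩ : ∃ t, form s z + t * form y z = 1 :=
    ⟨(1 - form s z) / form y z, by field_simp; ring⟩
  refine key y z (s + t • y + r • z) ?_ ?_ ?_ h
  · rwa [form_add_right, form_add_right, form_smul_right, form_smul_right, hy, hz, mul_zero,
      mul_zero, add_zero, add_zero]
  · rw [form_add_left, form_add_left, form_smul_left, form_smul_left, form_self_two, mul_zero,
      add_zero, hr]
    exact one_ne_zero
  · rw [form_add_left, form_add_left, form_smul_left, form_smul_left, form_self_two, mul_zero,
      add_zero, ht]
    exact one_ne_zero

/-! ### Nonsingular planes -/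

theorem indep_of_form {x y : V K} (h : form x y ≠ 0) : LinearIndependent K ![x, y] := by
  have hx : x ≠ 0 := by rintro rfl; simp [form_def] at h
  rw [LinearIndependent.pair_iff' hx]
  rintro a rfl
  rw [form_smul_right, form_self_two, mul_zero] at h
  exact h rfl

theorem isNonsymplecticLine_pair {x y : V K} (hx : x ∈ hyp K) (hy : y ∈ hyp K)
    (h : form x y ≠ 0) : IsNonsymplecticLine (K ∙ x ⊔ K ∙ y) :=
  ⟨⟨sup_le (by simpa) (by simpa), finrank_pair (indep_of_form h)⟩,
    x, left_mem_pair x y, y, right_mem_pair x y, h⟩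

theorem form_pair (x y : V K) (a b c d : K) :
    form (a • x + b • y) (c • x + d • y) = (a * d - b * c) * form x y := by
  simp only [form_add_left, form_add_right, form_smul_left, form_smul_right, form_self_two]
  rw [form_comm y x]
  linear_combination b * c * form x y * (CharTwo.two_eq_zero : (2 : K) = 0)

theorem IsNonsymplecticLine.form_ne_zero {x y : V K} (h : IsNonsymplecticLine (K ∙ x ⊔ K ∙ y)) :
    form x y ≠ 0 := by
  obtain ⟨-, u, hu, v, hv, huv⟩ := h
  obtain ⟨a, b, rfl⟩ := mem_pair.1 hu
  obtain ⟨c, d, rfl⟩ := mem_pair.1 hv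
  rw [form_pair] at huv
  exact right_ne_zero_of_mul huv

omit [CharP K 2] in
theorem IsNonsingularPlane.exists_form_ne_zero {U : Submodule K (V K)} (hU : IsNonsingularPlane U) :
    ∃ x ∈ U, ∃ y ∈ U, form x y ≠ 0 := by
  obtain ⟨h3, p, hpU, hp, h⟩ := hU
  obtain ⟨x, hx0, rfl⟩ := exists_eq_span_singleton hp.2
  have hxU : x ∈ U := by simpa using hpU
  obtain ⟨y, hy, hxy⟩ := exists_indep_mem (e := U) (by rw [h3.2]; norm_num) hxU hx0
  have hlt : K ∙ x ⊔ K ∙ y < U := by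
    refine lt_of_le_of_ne (sup_le (by simpa) (by simpa)) fun h' => ?_
    have := finrank_pair hxy
    rw [h', h3.2] at this
    omega
  obtain ⟨z, hz, hz'⟩ := SetLike.exists_of_lt hlt
  have hx' : x ∉ K ∙ y ⊔ K ∙ z := by
    intro hx
    obtain ⟨a, b, hab⟩ := mem_pair.1 hx
    by_cases hb : b = 0
    · have := (LinearIndependent.pair_iff.1 hxy 1 (-a) (by rw [hab, hb]; simp)).1
      exact one_ne_zero this
    · refine hz' (mem_pair.2 ⟨b⁻¹, -(b⁻¹ * a), ?_⟩)
      rw [hab, smul_add, smul_smul b⁻¹ b, inv_mul_cancel₀ hb]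
      module
  have hyz : LinearIndependent K ![y, z] := by
    have hy0 : y ≠ 0 := by
      rintro rfl
      exact hxy.ne_zero 1 rfl
    rw [LinearIndependent.pair_iff' hy0]
    rintro a rfl
    exact hz' (mem_pair.2 ⟨0, a, by simp⟩)
  have hle : K ∙ y ⊔ K ∙ z ≤ U := sup_le (by simpa) (by simpa)
  obtain ⟨-, u, hu, v, hv, huv⟩ := (h _ hle ⟨hle.trans h3.1, finrank_pair hyz⟩).2 (by simpa)
  exact ⟨u, hle hu, v, hle hv, huv⟩

/-- A plane is nonsingular if it is not totally isotropic; the point missed by its non-symplectic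
lines is the radical. -/
theorem isNonsingularPlane_of_form {U : Submodule K (V K)} (h3 : IsPG 3 U) {x y : V K} (hx : x ∈ U)
    (hy : y ∈ U) (hxy : form x y ≠ 0) : IsNonsingularPlane U := by
  refine ⟨h3, ?_⟩
  have hle : K ∙ x ⊔ K ∙ y ≤ U := sup_le (by simpa) (by simpa)
  have hlt : K ∙ x ⊔ K ∙ y < U := by
    refine lt_of_le_of_ne hle fun h' => ?_
    have := (isNonsymplecticLine_pair (h3.1 hx) (h3.1 hy) hxy).1.2
    rw [h', h3.2] at this
    omega
  obtain ⟨z, hz, hz'⟩ := SetLike.exists_of_lt hlt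
  -- The radical of the plane.
  obtain ⟨r, hr⟩ : ∃ r, r = form x y • z - (form z y • x + form x z • y) := ⟨_, rfl⟩
  have hr0 : r ≠ 0 := by
    intro h0
    rw [hr] at h0
    refine hz' (mem_pair.2 ⟨(form x y)⁻¹ * form z y, (form x y)⁻¹ * form x z, ?_⟩)
    rw [mul_smul, mul_smul, ← smul_add, ← sub_eq_zero.1 h0, smul_smul, inv_mul_cancel₀ hxy,
      one_smul]
  have hrU : r ∈ U := hr ▸ U.sub_mem (U.smul_mem _ hz)
    (U.add_mem (U.smul_mem _ hx) (U.smul_mem _ hy))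
  have hrx : form x r = 0 := by
    rw [hr, form_sub_right, form_add_right, form_smul_right, form_smul_right, form_smul_right,
      form_self_two]; ring
  have hry : form y r = 0 := by
    rw [hr, form_sub_right, form_add_right, form_smul_right, form_smul_right, form_smul_right,
      form_self_two, form_comm y z, form_comm y x]; ring
  have hi : LinearIndependent K ![x, y, r] := by
    refine linearIndependent_triple fun a b c h => ?_
    have h1 : form x (a • x + b • y + c • r) = 0 := by rw [h]; simp [form_def]
    have h2 : form (a • x + b • y + c • r) y = 0 := by rw [h]; simp [form_def]
    simp only [form_add_right, form_add_left, form_smul_left, form_smul_right, form_self_two, hrx,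
      form_comm r y, hry, mul_zero, zero_add, add_zero, mul_eq_zero, hxy, or_false] at h1 h2
    subst h1 h2
    simpa [hr0] using h
  have hU := eq_triple h3.2 hx hy hrU hi
  have hrU' : ∀ u ∈ U, form u r = 0 := by
    intro u hu
    rw [hU] at hu
    obtain ⟨a, b, c, rfl⟩ := mem_triple.1 hu
    simp [form_add_left, form_smul_left, hrx, hry, form_self_two]
  refine ⟨K ∙ r, by simpa, ⟨by simpa using h3.1 hrU, finrank_span_singleton hr0⟩,
    fun l hl hlp => ⟨?_, ?_⟩⟩
  · intro hn hrl
    have hrl' : r ∈ l := by simpa using hrl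
    obtain ⟨s, hs, hrs⟩ := exists_indep_mem (e := l) (by rw [hlp.2]; norm_num) hrl' hr0
    rw [eq_pair hlp.2 hrl' hs hrs] at hn
    exact hn.form_ne_zero (by rw [form_comm, hrU' s (hl hs)])
  · intro hrl
    obtain ⟨u, v, huv, rfl⟩ := exists_eq_pair hlp.2
    refine ⟨hlp, u, left_mem_pair u v, v, right_mem_pair u v, fun h0 => hxy ?_⟩
    have hu : u ∈ U := hl (left_mem_pair u v)
    have hv : v ∈ U := hl (right_mem_pair u v)
    have hi' : LinearIndependent K ![u, v, r] := by
      refine linearIndependent_triple fun a b c h => ?_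
      have hc : c = 0 := by
        by_contra hc
        apply hrl
        simp only [Submodule.span_singleton_le_iff_mem]
        refine mem_pair.2 ⟨-(c⁻¹ * a), -(c⁻¹ * b), ?_⟩
        have : c⁻¹ • (a • u + b • v + c • r) = 0 := by rw [h, smul_zero]
        rw [smul_add, smul_smul c⁻¹ c, inv_mul_cancel₀ hc, one_smul] at this
        rw [← sub_eq_zero, ← this]
        module
      subst hc
      have := LinearIndependent.pair_iff.1 huv a b (by simpa using h)
      exact ⟨this.1, this.2, rfl⟩
    have hU' := eq_triple h3.2 hu hv hrU hi'
    rw [hU'] at hx hy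
    obtain ⟨a, b, c, rfl⟩ := mem_triple.1 hx
    obtain ⟨d, e, f, rfl⟩ := mem_triple.1 hy
    simp [form_add_left, form_smul_left, form_add_right, form_smul_right, form_self_two,
      hrU' u hu, hrU' v hv, form_comm r, form_comm v u, h0]

/-! ### Special planes -/

/-- In characteristic two, `e₃` is the unit octonion and has trace zero, so it is fixed by `G₂(K)`.
-/
theorem act_bv_three (g : G2 K) : act g (bv K 3) = bv K 3 := by
  apply toZorn_injective
  have h : toZorn K (bv K 3) = oct1 K := by
    apply zorn_ext <;> simp [toZorn_def, oct1, CharTwo.neg_eq]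
  rw [toZorn_act, h, G2.one]

/-- The projections of the vectors `a`, `b`, `k` span a nonsingular plane: `a` and `b` are singular
and not perpendicular, and `k`, which represents the radical of the plane, is orthogonal to the
quaternion algebra generated by `a` and `b`. -/
structure IsPlaneFrame (a b k : V K) : Prop where
  quad_left : quad a = 0
  quad_right : quad b = 0
  form_ne : form a b ≠ 0
  form_left : form a k = 0
  form_right : form b k = 0
  tri_eq : tri a b k = 0
  proj_ne : proj₃ K k ≠ 0

/-- The plane of `PG(5, K)` spanned by the projections of three vectors. -/
abbrev plane (a b c : V K) : Submodule K (V K) := K ∙ proj₃ K a ⊔ K ∙ proj₃ K b ⊔ K ∙ proj₃ K c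

omit [CharP K 2] in
theorem exists_eq_of_mem_plane {a b k u : V K} (hu : proj₃ K u ∈ plane a b k) :
    ∃ r s t m : K, u = r • a + s • b + t • k + m • bv K 3 := by
  obtain ⟨r, s, t, hr⟩ := mem_triple.1 hu
  refine ⟨r, s, t, (u - (r • a + s • b + t • k)) 3, ?_⟩
  have h0 : proj₃ K (u - (r • a + s • b + t • k)) = 0 := by
    rw [map_sub, map_add, map_add, map_smul, map_smul, map_smul, hr, sub_self]
  have := proj₃_add (u - (r • a + s • b + t • k))
  rw [h0, zero_add] at this
  rw [this]; abel

namespace IsPlaneFrame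
variable {a b k : V K} (h : IsPlaneFrame a b k)
include h

theorem indep : LinearIndependent K ![proj₃ K a, proj₃ K b, proj₃ K k] := by
  refine linearIndependent_triple fun r s t hrst => ?_
  have h1 : form a (r • proj₃ K a + s • proj₃ K b + t • proj₃ K k) = 0 := by
    rw [hrst]; simp [form_def]
  have h2 : form (r • proj₃ K a + s • proj₃ K b + t • proj₃ K k) b = 0 := by
    rw [hrst]; simp [form_def]
  simp only [form_add_right, form_add_left, form_smul_left, form_smul_right, form_proj₃_left,
    form_proj₃_right, form_self_two, h.form_left, form_comm k, h.form_right, mul_zero, zero_add,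
    add_zero, mul_eq_zero, h.form_ne, or_false] at h1 h2
  subst h1 h2
  simpa [h.proj_ne] using hrst

theorem isNonsingularPlane : IsNonsingularPlane (plane a b k) := by
  refine isNonsingularPlane_of_form (x := proj₃ K a) (y := proj₃ K b)
    ⟨sup_le (sup_le ?_ ?_) ?_, finrank_triple h.indep⟩ ?_ ?_ ?_
  · simpa using proj₃_mem a
  · simpa using proj₃_mem b
  · simpa using proj₃_mem k
  · exact mem_triple.2 ⟨1, 0, 0, by simp⟩
  · exact mem_triple.2 ⟨0, 1, 0, by simp⟩
  · rw [form_proj₃_left, form_proj₃_right]; exact h.form_ne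

theorem quad_eq_zero_of_hexagonLine {l : Submodule K (V K)} (hl : IsHexagonLine l)
    (hle : l.map (proj₃ K) ≤ plane a b k) : quad k = 0 := by
  rw [isHexagonLine_iff] at hl
  obtain ⟨u, v, huv, rfl⟩ := exists_eq_pair hl.1
  have hx := hl.2 u (left_mem_pair u v) v (right_mem_pair u v)
  have hsing : ∀ w ∈ K ∙ u ⊔ K ∙ v, quad w = 0 := fun w hw => by
    have := hl.2 w hw w hw
    rw [Hex, sq_eq, tr_toZorn, nm_toZorn] at this
    have := congrArg (fun z : Zorn K => z.1) this
    simpa [oct1] using this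
  obtain ⟨r, s, t, m, hu⟩ :=
    exists_eq_of_mem_plane (hle (Submodule.mem_map_of_mem (left_mem_pair u v)))
  obtain ⟨r', s', t', m', hv⟩ :=
    exists_eq_of_mem_plane (hle (Submodule.mem_map_of_mem (right_mem_pair u v)))
  have fba : form b a = form a b := form_comm b a
  have fka : form k a = 0 := by rw [form_comm, h.form_left]
  have fkb : form k b = 0 := by rw [form_comm, h.form_right]
  have fn : ∀ x : V K, form (bv K 3) x = 0 := fun x => by rw [form_comm, form_bv_three]
  have hf := hx.form
  have ha : tri u v a = 0 := by
    by_contra h'; exact not_hex_of_tri h' hx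
  have hb : tri u v b = 0 := by
    by_contra h'; exact not_hex_of_tri h' hx
  rw [hu, hv] at hf ha hb
  have t1 : tri b k a = 0 := by rw [← tri_rotate, h.tri_eq]
  have t2 : tri k b a = 0 := by rw [tri_swap, t1, neg_zero]
  have t3 : tri b (bv K 3) a = form a b := by rw [← tri_rotate, tri_bv_three]
  have t4 : tri (bv K 3) b a = -form a b := by rw [tri_swap, t3]
  have t5 : tri k (bv K 3) a = 0 := by rw [← tri_rotate, tri_bv_three, h.form_left]
  have t6 : tri (bv K 3) k a = 0 := by rw [tri_swap, t5, neg_zero]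
  have t7 : tri k a b = 0 := by rw [tri_rotate, h.tri_eq]
  have t8 : tri a k b = 0 := by rw [tri_swap, t7, neg_zero]
  have t9 : tri (bv K 3) a b = form a b := by rw [tri_rotate, tri_bv_three]
  have t10 : tri a (bv K 3) b = -form a b := by rw [tri_swap, t9]
  have t11 : tri k (bv K 3) b = 0 := by rw [← tri_rotate, tri_bv_three, h.form_right]
  have t12 : tri (bv K 3) k b = 0 := by rw [tri_swap, t11, neg_zero]
  simp only [tri_add_left, tri_add_mid, tri_smul_left, tri_smul_mid, tri_self, tri_self',
    tri_self'', t1, t2, t3, t4, t5, t6, t7, t8, t9, t10, t11, t12] at ha hb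
  simp only [form_add_left, form_add_right, form_smul_left, form_smul_right, form_self_two, fba,
    fka, fkb, fn, form_bv_three, h.form_left, h.form_right] at hf
  have m1 : s * m' - m * s' = 0 := by
    apply (mul_eq_zero.1 (_ : _ * form a b = 0)).resolve_right h.form_ne
    linear_combination ha
  have m2 : r * m' - m * r' = 0 := by
    apply (mul_eq_zero.1 (_ : _ * form a b = 0)).resolve_right h.form_ne
    linear_combination -hb
  have m3 : r * s' - s * r' = 0 := by
    apply (mul_eq_zero.1 (_ : _ * form a b = 0)).resolve_right h.form_ne
    linear_combination hf - s * r' * form a b * (CharTwo.two_eq_zero : (2 : K) = 0)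
  -- The three minors vanish, so some point of the line is the radical of the plane.
  have key : ∀ c d : K, ¬ (c = 0 ∧ d = 0) → c * r + d * r' = 0 → c * s + d * s' = 0 →
      c * m + d * m' = 0 → quad k = 0 := by
    intro c d hcd e1 e2 e3
    have hmem : c • u + d • v ∈ K ∙ u ⊔ K ∙ v := mem_pair.2 ⟨c, d, rfl⟩
    have hne : c • u + d • v ≠ 0 := fun h0 => hcd (LinearIndependent.pair_iff.1 huv c d h0)
    have heq : c • u + d • v = (c * t + d * t') • k := by
      rw [hu, hv]
      ext i
      simp
      linear_combination a i * e1 + b i * e2 + (Pi.single 3 1 : V K) i * e3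
    have h0 := hsing _ hmem
    rw [heq, quad_smul] at h0
    refine (mul_eq_zero.1 h0).resolve_left (pow_ne_zero _ fun h1 => hne ?_)
    rw [heq, h1, zero_smul]
  by_contra hk
  have z1 : r = 0 ∧ r' = 0 := by
    by_contra hr
    exact hk (key r' (-r) (fun h => hr ⟨neg_eq_zero.1 h.2, h.1⟩) (by ring)
      (by linear_combination -m3) (by linear_combination -m2))
  have z2 : s = 0 ∧ s' = 0 := by
    by_contra hr
    exact hk (key s' (-s) (fun h => hr ⟨neg_eq_zero.1 h.2, h.1⟩) (by linear_combination m3)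
      (by ring) (by linear_combination -m1))
  have z3 : m = 0 ∧ m' = 0 := by
    by_contra hr
    exact hk (key m' (-m) (fun h => hr ⟨neg_eq_zero.1 h.2, h.1⟩) (by linear_combination m2)
      (by linear_combination m1) (by ring))
  exact hk (key 1 0 (by simp) (by simp [z1]) (by simp [z2]) (by simp [z3]))

theorem exists_hexagonLine (hk : quad k = 0) :
    ∃ l, IsHexagonLine l ∧ l.map (proj₃ K) ≤ plane a b k := by
  obtain ⟨g, hga, hgb⟩ := exists_act_pair (x := a) (y := (form a b)⁻¹ • b) h.quad_left
    (by rw [quad_smul, h.quad_right, mul_zero])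
    (by rw [form_smul_right, inv_mul_cancel₀ h.form_ne])
  obtain ⟨r, rfl⟩ := (act g).surjective k
  have r4 : r 4 = 0 := by
    have := h.form_left
    rw [← hga, form_act] at this
    simpa [form_def] using this
  have r0 : r 0 = 0 := by
    have : form ((form a b)⁻¹ • b) (act g r) = 0 := by
      rw [form_smul_left, h.form_right, mul_zero]
    rw [← hgb, form_act] at this
    simpa [form_def] using this
  have r3 : r 3 = 0 := by
    have : tri a ((form a b)⁻¹ • b) (act g r) = 0 := by
      rw [tri_smul_mid, h.tri_eq, mul_zero]
    rw [← hgb, ← hga, tri_act] at this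
    simpa [tri_def] using this
  have hq : r 1 * r 5 + r 2 * r 6 = 0 := by
    rw [quad_act] at hk
    simpa [quad, r0, r3] using hk
  have hr0 : r ≠ 0 := by
    rintro rfl
    exact h.proj_ne (by simp)
  -- The line is spanned by `k` and a vector of trace zero in the quaternion algebra of `a` and `b`
  -- whose product with `k` vanishes; in two-by-two matrices this is a nilpotent matrix of rank one.
  have main : ∀ p q s : K, ¬ (p = 0 ∧ q = 0 ∧ s = 0) → quad (![p, 0, 0, s, q, 0, 0] : V K) = 0 →
      Hex r ![p, 0, 0, s, q, 0, 0] → ∃ l, IsHexagonLine l ∧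
        l.map (proj₃ K) ≤ plane a b (act g r) := by
    intro p q s hne hw hrw
    refine ⟨_, isHexagonLine_pair (x := act g r) (y := act g ![p, 0, 0, s, q, 0, 0]) hk
      (by rw [quad_act, hw]) ((hex_act g).2 hrw) ?_, ?_⟩
    · rw [LinearIndependent.pair_iff' (by simpa using hr0)]
      intro c hc
      rw [← map_smul] at hc
      have hc' := (act g).injective hc
      have c0 := congrFun hc' 0
      have c3 := congrFun hc' 3
      have c4 := congrFun hc' 4
      simp [r0, r3, r4] at c0 c3 c4
      exact hne ⟨c0.symm, c4.symm, c3.symm⟩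
    · rw [Submodule.map_sup, Submodule.map_span, Submodule.map_span, Set.image_singleton,
        Set.image_singleton]
      refine sup_le le_sup_right ?_
      rw [Submodule.span_singleton_le_iff_mem]
      refine mem_triple.2 ⟨p, q * (form a b)⁻¹, 0, ?_⟩
      have e : (![p, 0, 0, s, q, 0, 0] : V K) = p • bv K 0 + q • bv K 4 + s • bv K 3 := by
        ext i; fin_cases i <;> simp
      rw [e]
      simp only [map_add, map_smul, hga, hgb, act_bv_three, proj₃_bv_three, smul_zero, smul_smul,
        zero_smul]
  by_cases h16 : r 1 = 0 ∧ r 6 = 0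
  · have h25 : ¬ (r 2 = 0 ∧ r 5 = 0) := fun h25 => hr0 (by
      ext i; fin_cases i <;> simp [*])
    refine main (r 5 ^ 2) (r 2 ^ 2) (-(r 2 * r 5)) ?_ ?_ ?_
    · rintro ⟨h1, h2, -⟩
      exact h25 ⟨pow_eq_zero_iff two_ne_zero |>.1 h2, pow_eq_zero_iff two_ne_zero |>.1 h1⟩
    · simp [quad]; ring
    · simp only [hex_iff, grass]
      simp [r0, r3, r4, h16]
      exact ⟨by ring, by ring⟩
  · refine main (r 6 ^ 2) (r 1 ^ 2) (r 1 * r 6) ?_ ?_ ?_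
    · rintro ⟨h1, h2, -⟩
      exact h16 ⟨pow_eq_zero_iff two_ne_zero |>.1 h2, pow_eq_zero_iff two_ne_zero |>.1 h1⟩
    · simp [quad]; ring
    · simp only [hex_iff, grass]
      simp [r0, r3, r4]
      exact ⟨by linear_combination (-r 1) * hq, by ring, by linear_combination (-r 6) * hq, by ring⟩

theorem isSpecialPlane_iff : IsSpecialPlane (plane a b k) ↔ quad k = 0 :=
  ⟨fun ⟨_, _, hl, hle⟩ => h.quad_eq_zero_of_hexagonLine hl hle,
    fun hk => ⟨h.isNonsingularPlane, h.exists_hexagonLine hk⟩⟩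

end IsPlaneFrame

/-- A nonzero invariant exactly for triples of points that span a nonspecial plane. -/
def disc (x y z : V K) : K := tri x y z ^ 2 + form x y * form y z * form x z

omit [CharP K 2] in
theorem disc_act (g : G2 K) (x y z : V K) : disc (act g x) (act g y) (act g z) = disc x y z := by
  simp only [disc, tri_act, form_act]

omit [CharP K 2] in
theorem disc_smul (a b c : K) (x y z : V K) :
    disc (a • x) (b • y) (c • z) = (a * b * c) ^ 2 * disc x y z := by
  simp only [disc, tri_smul_left, tri_smul_mid, tri_smul_right, form_smul_left, form_smul_right]
  ring

/-- The component of `z` orthogonal to the quaternion algebra generated by `x` and `y`, up to a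
scalar factor. -/
def altitude (x y z : V K) : V K :=
  form x y • z + (form z y • x + form x z • y) + tri x y z • bv K 3

theorem quad_altitude {x y z : V K} (hx : quad x = 0) (hy : quad y = 0) (hz : quad z = 0) :
    quad (altitude x y z) = disc x y z := by
  simp only [altitude, disc, quad_add, quad_smul, form_add_right, form_smul_left,
    form_smul_right, form_bv_three, quad_bv_three, hx, hy, hz, form_comm z x, form_comm z y]
  linear_combination (form x y * form y z * form x z) * (CharTwo.two_eq_zero : (2 : K) = 0)

theorem form_altitude_left (x y z : V K) : form x (altitude x y z) = 0 := by
  simp only [altitude, form_add_right, form_smul_right, form_bv_three, form_self_two]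
  linear_combination (form x y * form x z) * (CharTwo.two_eq_zero : (2 : K) = 0)

theorem form_altitude_right (x y z : V K) : form y (altitude x y z) = 0 := by
  simp only [altitude, form_add_right, form_smul_right, form_bv_three, form_self_two,
    form_comm y x, form_comm z y]
  linear_combination (form x y * form y z) * (CharTwo.two_eq_zero : (2 : K) = 0)

theorem tri_altitude (x y z : V K) : tri x y (altitude x y z) = 0 := by
  simp only [altitude, tri_add_right, tri_smul_right, tri_bv_three, tri_self', tri_self'']
  linear_combination (form x y * tri x y z) * (CharTwo.two_eq_zero : (2 : K) = 0)

omit [CharP K 2] in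
theorem proj₃_altitude (x y z : V K) : proj₃ K (altitude x y z) =
    form x y • proj₃ K z + (form z y • proj₃ K x + form x z • proj₃ K y) := by
  simp only [altitude, map_add, map_smul, proj₃_bv_three, smul_zero, add_zero]

theorem isPlaneFrame_altitude {x y z : V K} (hx : quad x = 0) (hy : quad y = 0)
    (hxy : form x y ≠ 0) (hz : proj₃ K (altitude x y z) ≠ 0) :
    IsPlaneFrame x y (altitude x y z) :=
  ⟨hx, hy, hxy, form_altitude_left x y z, form_altitude_right x y z, tri_altitude x y z, hz⟩

omit [CharP K 2] in
/-- Passing from `z` to the radical of the plane does not change the plane. -/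
theorem plane_altitude {x y z : V K} (hxy : form x y ≠ 0) :
    plane x y (altitude x y z) = plane x y z := by
  apply le_antisymm <;> refine sup_le le_sup_left ?_ <;> rw [Submodule.span_singleton_le_iff_mem]
  · rw [proj₃_altitude]
    exact mem_triple.2 ⟨form z y, form x z, form x y, by abel⟩
  · refine mem_triple.2 ⟨-((form x y)⁻¹ * form z y), -((form x y)⁻¹ * form x z), (form x y)⁻¹, ?_⟩
    rw [proj₃_altitude, smul_add, smul_add, smul_smul _ (form x y), inv_mul_cancel₀ hxy]
    module

omit [CharP K 2] in
/-- A triple of points that does not span a plane lies on a line. -/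
theorem mem_of_proj₃_altitude {x y z : V K} (hxy : form x y ≠ 0)
    (hz : proj₃ K (altitude x y z) = 0) : proj₃ K z ∈ K ∙ proj₃ K x ⊔ K ∙ proj₃ K y := by
  rw [proj₃_altitude] at hz
  refine mem_pair.2 ⟨-((form x y)⁻¹ * form z y), -((form x y)⁻¹ * form x z), ?_⟩
  have : (form x y)⁻¹ •
      (form x y • proj₃ K z + (form z y • proj₃ K x + form x z • proj₃ K y)) = 0 := by
    rw [hz, smul_zero]
  rw [smul_add, smul_smul, inv_mul_cancel₀ hxy, one_smul] at this
  rw [← sub_eq_zero, ← this]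
  module

/-! ### Filling triangles by special and by nonspecial planes -/

/-- The point `u` is non-perpendicular to `x`, `y`, `z`, and the planes that it spans with any two
of them satisfy the condition `C` on the discriminant. -/
structure IsFan (C : K → Prop) (x y z u : V K) : Prop where
  quad : quad u = 0
  form₁ : form x u ≠ 0
  form₂ : form y u ≠ 0
  form₃ : form z u ≠ 0
  disc₁₂ : C (disc x y u)
  disc₂₃ : C (disc y z u)
  disc₁₃ : C (disc x z u)

omit [CharP K 2] in
theorem IsFan.act {C : K → Prop} {x y z u : V K} (h : IsFan C x y z u) (g : G2 K) :
    IsFan C (act g x) (act g y) (act g z) (act g u) := by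
  obtain ⟨h1, h2, h3, h4, h5, h6, h7⟩ := h
  constructor <;> simpa only [quad_act, form_act, disc_act]

omit [CharP K 2] in
theorem isFan_smul {C : K → Prop} (hC : ∀ c d : K, c ≠ 0 → (C (c ^ 2 * d) ↔ C d)) {a b c : K}
    (ha : a ≠ 0) (hb : b ≠ 0) (hc : c ≠ 0) {x y z u : V K} :
    IsFan C (a • x) (b • y) (c • z) u ↔ IsFan C x y z u := by
  have hd : ∀ {p q : K} (s t w : V K), p ≠ 0 → q ≠ 0 →
      (C (disc (p • s) (q • t) w) ↔ C (disc s t w)) := by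
    intro p q s t w hp hq
    rw [← one_smul K w, disc_smul, hC _ _ (by simp [hp, hq]), one_smul]
  constructor
  · rintro ⟨h1, h2, h3, h4, h5, h6, h7⟩
    rw [hd _ _ _ ‹_› ‹_›] at h5 h6 h7
    rw [form_smul_left] at h2 h3 h4
    exact ⟨h1, right_ne_zero_of_mul h2, right_ne_zero_of_mul h3, right_ne_zero_of_mul h4, h5, h6,
      h7⟩
  · rintro ⟨h1, h2, h3, h4, h5, h6, h7⟩
    refine ⟨h1, ?_, ?_, ?_, ?_, ?_, ?_⟩
    · rw [form_smul_left]; exact mul_ne_zero ha h2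
    · rw [form_smul_left]; exact mul_ne_zero hb h3
    · rw [form_smul_left]; exact mul_ne_zero hc h4
    · rwa [hd _ _ _ ha hb]
    · rwa [hd _ _ _ hb hc]
    · rwa [hd _ _ _ ha hc]

omit [CharP K 2] in
/-- Three pairwise non-perpendicular points can be moved so that the first two are `e₀` and `e₄` and
the third has equal inner products with them. -/
theorem exists_act_triple (hs : Function.Surjective fun x : K => x ^ 2) {x y z : V K}
    (hx : quad x = 0) (hy : quad y = 0) (hxy : form x y ≠ 0) (hxz : form x z ≠ 0)
    (hyz : form y z ≠ 0) : ∃ (g : G2 K) (a b : K) (z' : V K), a ≠ 0 ∧ b ≠ 0 ∧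
      act g (bv K 0) = a • x ∧ act g (bv K 4) = b • y ∧ act g z' = z ∧ z' 0 ≠ 0 ∧ z' 4 = z' 0 := by
  obtain ⟨a, ha⟩ := hs (form y z / (form x z * form x y))
  have ha' : a ^ 2 = form y z / (form x z * form x y) := ha
  have ha0 : a ≠ 0 := by
    rintro rfl
    have : form y z / (form x z * form x y) ≠ 0 := div_ne_zero hyz (mul_ne_zero hxz hxy)
    exact this (by rw [← ha']; simp)
  obtain ⟨g, h1, h2⟩ := exists_act_pair (x := a • x) (y := (a * form x y)⁻¹ • y)
    (by rw [quad_smul, hx, mul_zero]) (by rw [quad_smul, hy, mul_zero])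
    (by rw [form_smul_left, form_smul_right]; field_simp)
  obtain ⟨z', rfl⟩ := (act g).surjective z
  have e1 : form (bv K 0) z' = a * form x (act g z') := by
    rw [← form_act g, h1, form_smul_left]
  have e2 : form (bv K 4) z' = (a * form x y)⁻¹ * form y (act g z') := by
    rw [← form_act g, h2, form_smul_left]
  have e3 : z' 4 = form (bv K 0) z' := by simp [form_def]
  have e4 : z' 0 = form (bv K 4) z' := by simp [form_def]
  refine ⟨g, a, _, z', ha0, inv_ne_zero (mul_ne_zero ha0 hxy), h1, h2, rfl, ?_, ?_⟩
  · rw [e4, e2]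
    exact mul_ne_zero (inv_ne_zero (mul_ne_zero ha0 hxy)) hyz
  · rw [e3, e4, e1, e2]
    have : a ^ 2 * (form x (act g z') * form x y) = form y (act g z') := by
      rw [ha']; field_simp
    field_simp
    linear_combination this

/-- Every triangle in a nonspecial plane is filled by three special planes. -/
theorem exists_fan_special (hs : Function.Surjective fun x : K => x ^ 2) {x y z : V K}
    (hx : quad x = 0) (hy : quad y = 0) (hz : quad z = 0) (hxy : form x y ≠ 0) (hxz : form x z ≠ 0)
    (hyz : form y z ≠ 0) (hd : disc x y z ≠ 0) : ∃ u, IsFan (· = 0) x y z u := by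
  have two : (2 : K) = 0 := CharTwo.two_eq_zero
  obtain ⟨g, a, b, w, ha, hb, hgx, hgy, rfl, hw0, hw4⟩ := exists_act_triple hs hx hy hxy hxz hyz
  have hq : w 0 ^ 2 + w 1 * w 5 + w 2 * w 6 - w 3 ^ 2 = 0 := by
    rw [quad_act, quad, hw4] at hz
    linear_combination hz
  have hdw : disc (bv K 0) (bv K 4) w ≠ 0 := by
    rw [← disc_act g, hgx, hgy, ← one_smul K (act g w), disc_smul]
    simp [ha, hb, hd]
  have hdw' : w 3 ^ 2 + w 0 ^ 2 ≠ 0 := by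
    intro h0
    apply hdw
    simp [disc, tri_def, form_def, hw4]
    linear_combination h0
  obtain ⟨n, hn⟩ := hs ((w 3 ^ 2 + w 0 ^ 2)⁻¹)
  have hn' : n ^ 2 * (w 3 ^ 2 + w 0 ^ 2) = 1 := by
    have : n ^ 2 = (w 3 ^ 2 + w 0 ^ 2)⁻¹ := hn
    rw [this, inv_mul_cancel₀ hdw']
  have hn0 : n ≠ 0 := by rintro rfl; simp at hn'
  -- After rescaling by `n` the discriminant of `e₀`, `e₄`, `v` becomes `1`.
  set v := n • w with hv
  have hvv : act g v = n • act g w := by rw [hv, map_smul]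
  suffices H : ∃ u, IsFan (· = 0) (bv K 0) (bv K 4) v u by
    obtain ⟨u, hu⟩ := H
    have := hu.act g
    rw [hgx, hgy, hvv] at this
    exact ⟨_, (isFan_smul (fun c d hc => by simp [hc]) ha hb hn0).1 this⟩
  have v0 : v 0 ≠ 0 := by simp [hv, hn0, hw0]
  have v4 : v 4 = v 0 := by simp [hv, hw4]
  have v3 : v 3 = v 0 + 1 := by
    have : (v 3 - (v 0 + 1)) ^ 2 = 0 := by
      simp only [hv, Pi.smul_apply, smul_eq_mul]
      linear_combination hn' + (- n * w 3 * (n * w 0 + 1) + n * w 0 + 1) * two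
    exact sub_eq_zero.1 (pow_eq_zero_iff two_ne_zero |>.1 this)
  have vq : v 1 * v 5 + v 2 * v 6 = 1 := by
    have : v 0 ^ 2 + v 1 * v 5 + v 2 * v 6 - v 3 ^ 2 = 0 := by
      simp only [hv, Pi.smul_apply, smul_eq_mul]
      linear_combination n ^ 2 * hq
    rw [v3] at this
    linear_combination this + v 0 * two
  clear_value v
  have f3 : form v ![1, 0, 0, 1, 1, v 5 / v 0, v 6 / v 0] = (v 0)⁻¹ := by
    simp [form_def, v4]
    field_simp
    linear_combination vq + (v 0 ^ 2 - v 3 * v 0) * two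
  -- The discriminant with `e₀` and `e₄` vanishes by `u₀ = u₃ = u₄ = 1`, and the remaining
  -- coordinates are such that the inner product `v₀⁻¹` with `v` makes the other two vanish.
  refine ⟨![1, 0, 0, 1, 1, v 5 / v 0, v 6 / v 0], ?_, ?_, ?_, ?_, ?_, ?_, ?_⟩
  · simp [quad]
  · simp [form_def]
  · simp [form_def]
  · rw [f3]; exact inv_ne_zero v0
  · simp [disc, tri_def, form_def]
    linear_combination two
  · rw [disc, f3]
    simp [tri_def, form_def, v4, v3]
    field_simp
    linear_combination v 0 ^ 2 * two
  · rw [disc, f3]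
    simp [tri_def, form_def, v4, v3]
    field_simp
    linear_combination two

/-- Over a field with more than two elements, every triangle in a special plane is filled by three
nonspecial planes. -/
theorem exists_fan_nonspecial (hs : Function.Surjective fun x : K => x ^ 2)
    {a : K} (a0 : a ≠ 0) (a1 : a ≠ 1) {x y z : V K}
    (hx : quad x = 0) (hy : quad y = 0) (hz : quad z = 0) (hxy : form x y ≠ 0) (hxz : form x z ≠ 0)
    (hyz : form y z ≠ 0) (hd : disc x y z = 0) (hk : proj₃ K (altitude x y z) ≠ 0) :
    ∃ u, IsFan (· ≠ 0) x y z u := by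
  have two : (2 : K) = 0 := CharTwo.two_eq_zero
  obtain ⟨g, b, c, w, hb, hc, hgx, hgy, rfl, hw0, hw4⟩ := exists_act_triple hs hx hy hxy hxz hyz
  have hq : w 0 ^ 2 + w 1 * w 5 + w 2 * w 6 - w 3 ^ 2 = 0 := by
    rw [quad_act, quad, hw4] at hz
    linear_combination hz
  have hdw : disc (bv K 0) (bv K 4) w = 0 := by
    rw [← disc_act g, hgx, hgy, ← one_smul K (act g w), disc_smul, hd, mul_zero]
  have hdw' : w 3 = w 0 := by
    simp [disc, tri_def, form_def, hw4] at hdw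
    have : (w 3 - w 0) ^ 2 = 0 := by linear_combination hdw - w 3 * w 0 * two
    exact sub_eq_zero.1 (pow_eq_zero_iff two_ne_zero |>.1 this)
  set v := (w 0)⁻¹ • w with hv
  have hvv : act g v = (w 0)⁻¹ • act g w := by rw [hv, map_smul]
  suffices H : ∃ u, IsFan (· ≠ 0) (bv K 0) (bv K 4) v u by
    obtain ⟨u, hu⟩ := H
    have := hu.act g
    rw [hgx, hgy, hvv] at this
    exact ⟨_, (isFan_smul (fun c d hc => by simp [hc]) hb hc (inv_ne_zero hw0)).1 this⟩
  have v0 : v 0 = 1 := by simp [hv, hw0]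
  have v4 : v 4 = 1 := by simp [hv, hw4, hw0]
  have v3 : v 3 = 1 := by simp [hv, hdw', hw0]
  have vq : v 1 * v 5 + v 2 * v 6 = 0 := by
    simp only [hv, Pi.smul_apply, smul_eq_mul]
    rw [hdw'] at hq
    linear_combination ((w 0)⁻¹) ^ 2 * hq
  have hr : ¬ ((v 1 = 0 ∧ v 2 = 0) ∧ v 5 = 0 ∧ v 6 = 0) := by
    rintro ⟨⟨h1, h2⟩, h5, h6⟩
    simp [hv, hw0] at h1 h2 h5 h6
    apply hk
    have e : w = w 0 • bv K 0 + w 0 • bv K 4 + w 0 • bv K 3 := by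
      ext i; fin_cases i <;> simp [*]
    have e' : act g w = (w 0 * b) • x + (w 0 * c) • y + w 0 • bv K 3 := by
      conv_lhs => rw [e]
      simp only [map_add, map_smul, hgx, hgy, act_bv_three, smul_smul]
    rw [proj₃_altitude, e']
    simp only [map_add, map_smul, proj₃_bv_three, form_add_left, form_add_right, form_smul_left,
      form_smul_right, form_self_two, form_bv_three, form_comm (bv K 3)]
    ext i
    simp
    linear_combination (form x y * w 0 * (b * proj₃ K x i + c * proj₃ K y i)) * two
  clear_value v
  -- The point `u` is sought in the form `e₀ + e₄ + s`, where `s` is orthogonal to the quaternion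
  -- algebra of `e₀` and `e₄` and `quad s = 1`. The discriminant with `e₀` and `e₄` is then `1`, and
  -- the hypotheses say that `v` is not perpendicular to `u` and that the other two discriminants
  -- are nonzero.
  have main : ∀ s1 s2 s5 s6 : K, s1 * s5 + s2 * s6 = 1 →
      (v 1 * s5 + v 5 * s1 + v 2 * s6 + v 6 * s2 ≠ 0) →
      ((v 1 * s2 + v 2 * s1 + 1) ^ 2 + (v 1 * s5 + v 5 * s1 + v 2 * s6 + v 6 * s2) ≠ 0) →
      ((v 5 * s6 + v 6 * s5 + 1) ^ 2 + (v 1 * s5 + v 5 * s1 + v 2 * s6 + v 6 * s2) ≠ 0) →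
      ∃ u, IsFan (· ≠ 0) (bv K 0) (bv K 4) v u := by
    intro s1 s2 s5 s6 h1 h2 h3 h4
    have f3 : form v ![1, s1, s2, 0, 1, s5, s6] =
        v 1 * s5 + v 5 * s1 + v 2 * s6 + v 6 * s2 := by
      simp [form_def, v0, v4]
      linear_combination two
    refine ⟨![1, s1, s2, 0, 1, s5, s6], ?_, ?_, ?_, ?_, ?_, ?_, ?_⟩
    · simp [quad]
      linear_combination h1 + two
    · simp [form_def]
    · simp [form_def]
    · rwa [f3]
    · simp [disc, tri_def, form_def]
    · rw [disc, f3]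
      simp [tri_def, form_def, v0, v4, v3]
      exact fun h => h4 (by
        linear_combination h + 2 * (v 6 * s5) * (v 5 * s6 + 1) * two)
    · rw [disc, f3]
      simp [tri_def, form_def, v0, v4, v3]
      exact fun h => h3 (by
        linear_combination h + 2 * (1 + v 2 * s1) * (v 1 * s2) * two)
  by_cases h12 : v 1 = 0 ∧ v 2 = 0
  · have h56 : ¬ (v 5 = 0 ∧ v 6 = 0) := fun h => hr ⟨h12, h⟩
    obtain ⟨s1, s2, hs⟩ : ∃ s1 s2 : K, v 5 * s1 + v 6 * s2 = a := by
      by_cases h5 : v 5 = 0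
      · have h6 : v 6 ≠ 0 := fun h6 => h56 ⟨h5, h6⟩
        exact ⟨0, a / v 6, by field_simp; ring⟩
      · exact ⟨a / v 5, 0, by field_simp; ring⟩
    have e : v 1 * (v 5 / a) + v 5 * s1 + v 2 * (v 6 / a) + v 6 * s2 = a := by
      rw [h12.1, h12.2]; linear_combination hs
    have ha1 : 1 + a ≠ 0 := fun h => a1 (by linear_combination h - two)
    refine main s1 s2 (v 5 / a) (v 6 / a) (by field_simp; linear_combination hs) ?_ ?_ ?_
    · rwa [e]
    · rw [e, h12.1, h12.2]; simpa using ha1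
    · rw [e, show v 5 * (v 6 / a) + v 6 * (v 5 / a) = 0 by
        field_simp; linear_combination v 5 * v 6 * two]
      simpa using ha1
  · obtain ⟨s1, s2, hs⟩ : ∃ s1 s2 : K, v 1 * s2 + v 2 * s1 = 1 := by
      by_cases h1 : v 1 = 0
      · have h2 : v 2 ≠ 0 := fun h2 => h12 ⟨h1, h2⟩
        exact ⟨(v 2)⁻¹, 0, by field_simp; ring⟩
      · exact ⟨0, (v 1)⁻¹, by field_simp; ring⟩
    -- The component of `v` orthogonal to the quaternion algebra is singular, so that it has
    -- coordinates `(v₁, v₂; κ v₂, κ v₁)`.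
    obtain ⟨κ, h5, h6⟩ : ∃ κ, v 5 = κ * v 2 ∧ v 6 = κ * v 1 := by
      refine ⟨v 5 * s1 + v 6 * s2, ?_, ?_⟩
      · linear_combination (-v 5) * hs + s2 * vq - v 2 * v 6 * s2 * two
      · linear_combination (-v 6) * hs + s1 * vq - v 1 * v 5 * s1 * two
    have e : ∀ t, v 1 * (t * s2 + v 2) + v 5 * s1 + v 2 * (t * s1 + v 1) + v 6 * s2 = t + κ := by
      intro t
      rw [h5, h6]
      linear_combination (t + κ) * hs + v 1 * v 2 * two
    have e2 : ∀ t, v 5 * (t * s1 + v 1) + v 6 * (t * s2 + v 2) = κ * t := by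
      intro t
      rw [h5, h6]
      linear_combination (t * κ) * hs + κ * v 1 * v 2 * two
    obtain ⟨t, ht1, ht2⟩ : ∃ t, t + κ ≠ 0 ∧ (κ * t + 1) ^ 2 + (t + κ) ≠ 0 := by
      by_cases k0 : κ = 0
      · refine ⟨a, by rwa [k0, add_zero], fun h => a1 ?_⟩
        rw [k0] at h
        linear_combination h - two
      by_cases k1 : κ = 1
      · refine ⟨a, fun h => a1 ?_, fun h => ?_⟩
        · rw [k1] at h
          linear_combination h - two
        · rw [k1] at h
          have : a * (a + 1) = 0 := by linear_combination h - (1 + a) * two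
          rcases mul_eq_zero.1 this with h | h
          · exact a0 h
          · exact a1 (by linear_combination h - two)
      · refine ⟨0, by rwa [zero_add], fun h => k1 ?_⟩
        linear_combination h - two
    refine main s1 s2 (t * s2 + v 2) (t * s1 + v 1) ?_ ?_ ?_ ?_
    · linear_combination hs + t * s1 * s2 * two
    · rwa [e]
    · rw [e, hs]
      intro h
      exact ht1 (by linear_combination h - 2 * two)
    · rw [e, e2]
      exact ht2

/-! ### The geometries of nonsingular planes -/

/-- Over a perfect field of characteristic two, every point of `PG(5, K)` is the projection of a
point of the quadric. -/
theorem exists_lift (hs : Function.Surjective fun x : K => x ^ 2) (x : V K) :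
    ∃ a, quad a = 0 ∧ proj₃ K a = proj₃ K x := by
  obtain ⟨c, hc⟩ := hs (quad x)
  have hc' : c ^ 2 = quad x := hc
  refine ⟨x + c • bv K 3, ?_, ?_⟩
  · rw [quad_add, quad_smul, quad_bv_three, form_smul_right, form_bv_three, hc']
    linear_combination quad x * (CharTwo.two_eq_zero : (2 : K) = 0)
  · rw [map_add, map_smul, proj₃_bv_three, smul_zero, add_zero]

/-- A hyperbolic line lies in nonsingular planes of each kind. -/
theorem exists_isPlaneFrame {a b : V K} (ha : quad a = 0) (hb : quad b = 0) (hab : form a b ≠ 0)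
    (c : K) : ∃ k, IsPlaneFrame a b k ∧ quad k = c := by
  obtain ⟨g, h1, h2⟩ := exists_act_pair (x := a) (y := (form a b)⁻¹ • b) ha
    (by rw [quad_smul, hb, mul_zero]) (by rw [form_smul_right, inv_mul_cancel₀ hab])
  have hb' : b = form a b • act g (bv K 4) := by rw [h2, smul_smul, mul_inv_cancel₀ hab, one_smul]
  refine ⟨act g ![0, 1, 0, 0, 0, c, 0], ⟨ha, hb, hab, ?_, ?_, ?_, ?_⟩, ?_⟩
  · rw [← h1, form_act]; simp [form_def]
  · rw [hb', form_smul_left, form_act]; simp [form_def]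
  · rw [hb', tri_smul_mid, ← h1, tri_act]; simp [tri_def]
  · intro h0
    have := proj₃_add (act g ![0, 1, 0, 0, 0, c, 0])
    rw [h0, zero_add, ← act_bv_three g, ← map_smul] at this
    have := congrFun ((act g).injective this) 1
    simp at this
  · rw [quad_act]; simp [quad]

/-- A set of nonsingular planes defines a rank three geometry if every hyperbolic line lies in one
of them. -/
theorem isRankThree_symplectic (hs : Function.Surjective fun x : K => x ^ 2)
    {E : Set (Submodule K (V K))} (hE : ∀ U ∈ E, IsNonsingularPlane U)
    (hex : ∀ a b : V K, quad a = 0 → quad b = 0 → form a b ≠ 0 → ∃ k, plane a b k ∈ E) :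
    IsRankThree {U : Submodule K (V K) | IsPG 1 U} {U | IsNonsymplecticLine U} E
      fun p e => ∃ l, IsNonsymplecticLine l ∧ p ≤ l ∧ l ≤ e where
  dimP p hp := hp.2
  dimL l hl := hl.1.2
  dimE e he := (hE e he).1.2
  point_mem l hl x hx hx0 := ⟨by simpa using hl.1.1 hx, finrank_span_singleton hx0⟩
  exists_line p hp := by
    obtain ⟨x, hx0, rfl⟩ := exists_eq_span_singleton hp.2
    have hx : x ∈ hyp K := by simpa using hp.1
    obtain ⟨y, hy⟩ := exists_form_ne_zero (x := x) (by rwa [proj₃_of_mem hx])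
    exact ⟨_, isNonsymplecticLine_pair (y := proj₃ K y) hx (proj₃_mem y)
      (by rwa [form_proj₃_right]), le_sup_left⟩
  exists_plane l hl := by
    obtain ⟨x, y, -, rfl⟩ := exists_eq_pair hl.1.2
    have hx : x ∈ hyp K := hl.1.1 (left_mem_pair x y)
    have hy : y ∈ hyp K := hl.1.1 (right_mem_pair x y)
    obtain ⟨a, ha, hax⟩ := exists_lift hs x
    obtain ⟨b, hb, hby⟩ := exists_lift hs y
    rw [proj₃_of_mem hx] at hax
    rw [proj₃_of_mem hy] at hby
    obtain ⟨k, hk⟩ := hex a b ha hb (by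
      rw [← form_proj₃_left, ← form_proj₃_right, hax, hby]; exact hl.form_ne_zero)
    refine ⟨_, hk, ?_⟩
    rw [← hax, ← hby]
    exact le_sup_left
  exists_line_le e he := by
    obtain ⟨x, hx, y, hy, hxy⟩ := (hE e he).exists_form_ne_zero
    exact ⟨_, isNonsymplecticLine_pair ((hE e he).1.1 hx) ((hE e he).1.1 hy) hxy,
      sup_le (by simpa) (by simpa)⟩
  rel_iff p hp e he := Iff.rfl
  nonempty := ⟨K ∙ bv K 0, by simp [hyp], finrank_span_singleton (by simp)⟩

theorem isRankThree_nonsingular (hs : Function.Surjective fun x : K => x ^ 2) :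
    IsRankThree {U : Submodule K (V K) | IsPG 1 U} {U | IsNonsymplecticLine U}
      {U | IsNonsingularPlane U} fun p e => ∃ l, IsNonsymplecticLine l ∧ p ≤ l ∧ l ≤ e :=
  isRankThree_symplectic hs (fun _ h => h) fun a b ha hb hab => by
    obtain ⟨k, hk, -⟩ := exists_isPlaneFrame ha hb hab 0
    exact ⟨k, hk.isNonsingularPlane⟩

theorem isRankThree_nonspecial (hs : Function.Surjective fun x : K => x ^ 2) :
    IsRankThree {U : Submodule K (V K) | IsPG 1 U} {U | IsNonsymplecticLine U}
      {U | IsNonsingularPlane U ∧ ¬ IsSpecialPlane U}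
      fun p e => ∃ l, IsNonsymplecticLine l ∧ p ≤ l ∧ l ≤ e :=
  isRankThree_symplectic hs (fun _ h => h.1) fun a b ha hb hab => by
    obtain ⟨k, hk, h1⟩ := exists_isPlaneFrame ha hb hab 1
    exact ⟨k, hk.isNonsingularPlane, by rw [hk.isSpecialPlane_iff, h1]; exact one_ne_zero⟩

theorem isRankThree_special (hs : Function.Surjective fun x : K => x ^ 2) :
    IsRankThree {U : Submodule K (V K) | IsPG 1 U} {U | IsNonsymplecticLine U}
      {U | IsSpecialPlane U} fun p e => ∃ l, IsNonsymplecticLine l ∧ p ≤ l ∧ l ≤ e :=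
  isRankThree_symplectic hs (fun _ h => h.1) fun a b ha hb hab => by
    obtain ⟨k, hk, h0⟩ := exists_isPlaneFrame ha hb hab 0
    exact ⟨k, hk.isSpecialPlane_iff.2 h0⟩

section Cocycle
variable {E : Set (Submodule K (V K))} {G : Type u} [Group G]
  {Ψ : Submodule K (V K) → Submodule K (V K) → G}
  (hΨ : IsEdgeCocycle {U : Submodule K (V K) | IsPG 1 U} {U | IsNonsymplecticLine U} E Ψ)
include hΨ

/-- A triangle multiplies correctly if it lies on a line or in a plane of the geometry. -/
theorem IsEdgeCocycle.symp_mul {x y z : V K} (hxy : form x y ≠ 0) (hyz : form y z ≠ 0)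
    (hxz : form x z ≠ 0)
    (h : proj₃ K (altitude x y z) ≠ 0 → plane x y (altitude x y z) ∈ E) :
    Ψ (K ∙ proj₃ K x) (K ∙ proj₃ K y) * Ψ (K ∙ proj₃ K y) (K ∙ proj₃ K z) =
      Ψ (K ∙ proj₃ K x) (K ∙ proj₃ K z) := by
  have hpt : ∀ {x y : V K}, form x y ≠ 0 → IsPG 1 (K ∙ proj₃ K x) := fun {x y} h =>
    ⟨by simpa using proj₃_mem x, finrank_span_singleton (proj₃_ne_zero h)⟩
  have hln : ∀ {x y : V K}, form x y ≠ 0 → IsNonsymplecticLine (K ∙ proj₃ K x ⊔ K ∙ proj₃ K y) :=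
    fun {x y} h => isNonsymplecticLine_pair (proj₃_mem x) (proj₃_mem y)
      (by rwa [form_proj₃_left, form_proj₃_right])
  refine hΨ.tri _ (hpt hxy) _ (hpt hyz) _ (hpt (y := x) (by rwa [form_comm])) (hln hxy) (hln hyz)
    (hln hxz) ?_
  by_cases h0 : proj₃ K (altitude x y z) = 0
  · exact ⟨_, Or.inl (hln hxy), le_sup_left, le_sup_right,
      by simpa using mem_of_proj₃_altitude hxy h0⟩
  · have := h h0
    rw [plane_altitude hxy] at this
    exact ⟨_, Or.inr this, le_sup_left.trans le_sup_left, le_sup_right.trans le_sup_left,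
      le_sup_right⟩

end Cocycle

omit [CharP K 2] in
/-- A triangle with a fan multiplies correctly if the three triangles of the fan do. -/
theorem mul_of_isFan {G : Type*} [Group G] {ψ : V K → V K → G} {C : K → Prop}
    (hC : ∀ {x y z : V K}, quad x = 0 → quad y = 0 → quad z = 0 → form x y ≠ 0 → form y z ≠ 0 →
      form x z ≠ 0 → C (disc x y z) → ψ x y * ψ y z = ψ x z)
    {x y z u : V K} (hu : IsFan C x y z u) (hx : quad x = 0) (hy : quad y = 0) (hz : quad z = 0)
    (hxy : form x y ≠ 0) (hyz : form y z ≠ 0) (hxz : form x z ≠ 0) :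
    ψ x y * ψ y z = ψ x z := by
  have e1 := hC hx hy hu.quad hxy hu.form₂ hu.form₁ hu.disc₁₂
  have e2 := hC hy hz hu.quad hyz hu.form₃ hu.form₂ hu.disc₂₃
  have e3 := hC hx hz hu.quad hxz hu.form₃ hu.form₁ hu.disc₁₃
  rw [← e2, ← mul_assoc, ← e3] at e1
  exact mul_right_cancel e1

/-- A geometry of nonsingular planes is simply connected if all triangles of points of the quadric
multiply correctly. -/
theorem symplectic_simplyConnected (hs : Function.Surjective fun x : K => x ^ 2)
    {E : Set (Submodule K (V K))} {R : Submodule K (V K) → Submodule K (V K) → Prop}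
    (hR : IsRankThree {U : Submodule K (V K) | IsPG 1 U} {U | IsNonsymplecticLine U} E R)
    (hfill : ∀ (G : Type u) [Group G] (Ψ : Submodule K (V K) → Submodule K (V K) → G),
      IsEdgeCocycle {U : Submodule K (V K) | IsPG 1 U} {U | IsNonsymplecticLine U} E Ψ →
      ∀ x y z : V K, quad x = 0 → quad y = 0 → quad z = 0 → form x y ≠ 0 → form y z ≠ 0 →
      form x z ≠ 0 →
      Ψ (K ∙ proj₃ K x) (K ∙ proj₃ K y) * Ψ (K ∙ proj₃ K y) (K ∙ proj₃ K z) =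
        Ψ (K ∙ proj₃ K x) (K ∙ proj₃ K z)) :
    (subspacePregeometry {U : Submodule K (V K) | IsPG 1 U} {U | IsNonsymplecticLine U}
      E R).SimplyConnected := by
  refine hR.simplyConnected ?_ ?_
  · intro p hp q hq
    obtain ⟨x, hx0, rfl⟩ := exists_eq_span_singleton hp.2
    obtain ⟨y, hy0, rfl⟩ := exists_eq_span_singleton hq.2
    have hx : x ∈ hyp K := by simpa using hp.1
    have hy : y ∈ hyp K := by simpa using hq.1
    obtain ⟨u, h1, h2⟩ := exists_common_symp (x := x) (y := y) (by rwa [proj₃_of_mem hx])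
      (by rwa [proj₃_of_mem hy])
    exact ⟨K ∙ proj₃ K u, ⟨by simpa using proj₃_mem u, finrank_span_singleton (proj₃_ne_zero h2)⟩,
      Or.inr (isNonsymplecticLine_pair hx (proj₃_mem u) (by rwa [form_proj₃_right])),
      Or.inr (isNonsymplecticLine_pair (proj₃_mem u) hy (by rwa [form_proj₃_left]))⟩
  · intro G _ Ψ hΨ
    obtain ⟨g, hg⟩ := exists_symp_potential (K := K)
      (ψ := fun x y => Ψ (K ∙ proj₃ K x) (K ∙ proj₃ K y)) (fun x y => hΨ.symm _ _) (by
        intro x y z hxy hyz hxz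
        obtain ⟨a, ha, hax⟩ := exists_lift hs x
        obtain ⟨b, hb, hby⟩ := exists_lift hs y
        obtain ⟨c, hc, hcz⟩ := exists_lift hs z
        have hf : ∀ {x y a b : V K}, proj₃ K a = proj₃ K x → proj₃ K b = proj₃ K y →
            form x y ≠ 0 → form a b ≠ 0 := by
          intro x y a b h1 h2 h
          rwa [← form_proj₃_left, ← form_proj₃_right, h1, h2, form_proj₃_left, form_proj₃_right]
        have := hfill G Ψ hΨ a b c ha hb hc (hf hax hby hxy) (hf hby hcz hyz) (hf hax hcz hxz)
        rwa [hax, hby, hcz] at this)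
    obtain ⟨r, hr⟩ := exists_repr (K := K) (V K)
    refine ⟨fun p => g (r p), fun p hp q hq hpq => ?_⟩
    have hp' : r p ∈ hyp K := by
      have := hp.1
      rw [hr p hp.2] at this
      simpa using this
    have hq' : r q ∈ hyp K := by
      have := hq.1
      rw [hr q hq.2] at this
      simpa using this
    have h : form (r p) (r q) ≠ 0 := by
      apply IsNonsymplecticLine.form_ne_zero
      rw [← hr p hp.2, ← hr q hq.2]
      exact hpq
    have := hg _ _ h
    beta_reduce at this
    rwa [proj₃_of_mem hp', proj₃_of_mem hq', ← hr p hp.2, ← hr q hq.2] at this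

theorem gamma0_simplyConnected (hs : Function.Surjective fun x : K => x ^ 2) :
    (Gamma0 K).SimplyConnected :=
  symplectic_simplyConnected hs (isRankThree_nonsingular hs)
    fun _ _ _ hΨ _ _ _ hx hy _ hxy hyz hxz => hΨ.symp_mul hxy hyz hxz fun h =>
      (isPlaneFrame_altitude hx hy hxy h).isNonsingularPlane

theorem gamma1_simplyConnected (hs : Function.Surjective fun x : K => x ^ 2) {a : K} (a0 : a ≠ 0)
    (a1 : a ≠ 1) : (Gamma1 K).SimplyConnected := by
  refine symplectic_simplyConnected hs (isRankThree_nonspecial hs)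
    fun G _ Ψ hΨ x y z hx hy hz hxy hyz hxz => ?_
  have hC : ∀ {x y z : V K}, quad x = 0 → quad y = 0 → quad z = 0 → form x y ≠ 0 → form y z ≠ 0 →
      form x z ≠ 0 → disc x y z ≠ 0 →
      Ψ (K ∙ proj₃ K x) (K ∙ proj₃ K y) * Ψ (K ∙ proj₃ K y) (K ∙ proj₃ K z) =
        Ψ (K ∙ proj₃ K x) (K ∙ proj₃ K z) := by
    intro x y z hx hy hz hxy hyz hxz hd
    refine hΨ.symp_mul hxy hyz hxz fun h => ?_
    have hf := isPlaneFrame_altitude hx hy hxy h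
    exact ⟨hf.isNonsingularPlane, by rwa [hf.isSpecialPlane_iff, quad_altitude hx hy hz]⟩
  by_cases hd : disc x y z = 0
  · by_cases hk : proj₃ K (altitude x y z) = 0
    · exact hΨ.symp_mul hxy hyz hxz fun h => absurd hk h
    · obtain ⟨u, hu⟩ := exists_fan_nonspecial hs a0 a1 hx hy hz hxy hxz hyz hd hk
      exact mul_of_isFan (ψ := fun x y => Ψ (K ∙ proj₃ K x) (K ∙ proj₃ K y)) hC hu hx hy hz hxy
        hyz hxz
  · exact hC hx hy hz hxy hyz hxz hd

theorem gamma2_simplyConnected (hs : Function.Surjective fun x : K => x ^ 2) :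
    (Gamma2 K).SimplyConnected := by
  refine symplectic_simplyConnected hs (isRankThree_special hs)
    fun G _ Ψ hΨ x y z hx hy hz hxy hyz hxz => ?_
  have hC : ∀ {x y z : V K}, quad x = 0 → quad y = 0 → quad z = 0 → form x y ≠ 0 → form y z ≠ 0 →
      form x z ≠ 0 → disc x y z = 0 →
      Ψ (K ∙ proj₃ K x) (K ∙ proj₃ K y) * Ψ (K ∙ proj₃ K y) (K ∙ proj₃ K z) =
        Ψ (K ∙ proj₃ K x) (K ∙ proj₃ K z) := by
    intro x y z hx hy hz hxy hyz hxz hd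
    refine hΨ.symp_mul hxy hyz hxz fun h => ?_
    have hf := isPlaneFrame_altitude hx hy hxy h
    exact hf.isSpecialPlane_iff.2 (by rwa [quad_altitude hx hy hz])
  by_cases hd : disc x y z = 0
  · exact hC hx hy hz hxy hyz hxz hd
  · obtain ⟨u, hu⟩ := exists_fan_special hs hx hy hz hxy hxz hyz hd
    exact mul_of_isFan (ψ := fun x y => Ψ (K ∙ proj₃ K x) (K ∙ proj₃ K y)) hC hu hx hy hz hxy
      hyz hxz

/-! ### The action of `G₂(K)` on the geometry of nonspecial planes -/

omit [CharP K 2] in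
theorem map_eq_proj₃_act (g : G2 K) (x : V K) : G2.map g x = proj₃ K (act g x) := by
  ext i
  fin_cases i <;> simp [G2.map, ofZorn, act, fromZorn, proj₃_apply]

theorem map_proj₃ (g : G2 K) (x : V K) : G2.map g (proj₃ K x) = proj₃ K (act g x) := by
  conv_rhs => rw [← proj₃_add x]
  rw [map_add, map_smul, act_bv_three, map_add, map_smul, proj₃_bv_three, smul_zero, add_zero,
    map_eq_proj₃_act]

omit [CharP K 2] in
theorem act_one (x : V K) : act (1 : G2 K) x = x := by
  apply toZorn_injective
  rw [toZorn_act]; rfl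

theorem map_mul (g h : G2 K) : G2.map (g * h) = G2.map g ∘ₗ G2.map h := by
  refine LinearMap.ext fun x => ?_
  rw [LinearMap.comp_apply, map_eq_proj₃_act h, map_proj₃, map_eq_proj₃_act, act_mul]

theorem submodule_map_mul (g h : G2 K) (U : Submodule K (V K)) :
    U.map (G2.map (g * h)) = (U.map (G2.map h)).map (G2.map g) := by
  rw [map_mul, Submodule.map_comp]

omit [CharP K 2] in
theorem submodule_map_one {U : Submodule K (V K)} (hU : U ≤ hyp K) :
    U.map (G2.map (1 : G2 K)) = U := by
  have h : ∀ x ∈ U, G2.map (1 : G2 K) x = x := fun x hx => by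
    rw [map_eq_proj₃_act, act_one, proj₃_of_mem (hU hx)]
  ext x
  constructor
  · rintro ⟨y, hy, rfl⟩
    rwa [h y hy]
  · exact fun hx => ⟨x, hx, h x hx⟩

theorem IsPG.map {d : ℕ} {U : Submodule K (V K)} (h : IsPG d U) (g : G2 K) :
    IsPG d (U.map (G2.map g)) := by
  refine ⟨?_, ?_⟩
  · rintro _ ⟨x, -, rfl⟩
    rw [map_eq_proj₃_act]
    exact proj₃_mem _
  · have h1 := Submodule.finrank_map_le (G2.map g) U
    have h2 := Submodule.finrank_map_le (G2.map g⁻¹) (U.map (G2.map g))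
    rw [← submodule_map_mul, inv_mul_cancel, submodule_map_one h.1] at h2
    rw [← h.2]
    exact le_antisymm h1 h2

theorem form_map (g : G2 K) (x y : V K) : form (G2.map g x) (G2.map g y) = form x y := by
  rw [map_eq_proj₃_act, map_eq_proj₃_act, form_proj₃_left, form_proj₃_right, form_act]

theorem IsNonsymplecticLine.map {U : Submodule K (V K)} (h : IsNonsymplecticLine U) (g : G2 K) :
    IsNonsymplecticLine (U.map (G2.map g)) := by
  obtain ⟨h1, x, hx, y, hy, hxy⟩ := h
  exact ⟨h1.map g, _, Submodule.mem_map_of_mem hx, _, Submodule.mem_map_of_mem hy,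
    by rwa [form_map]⟩

theorem IsNonsingularPlane.map {U : Submodule K (V K)} (h : IsNonsingularPlane U) (g : G2 K) :
    IsNonsingularPlane (U.map (G2.map g)) := by
  obtain ⟨x, hx, y, hy, hxy⟩ := h.exists_form_ne_zero
  exact isNonsingularPlane_of_form (h.1.map g) (Submodule.mem_map_of_mem hx)
    (Submodule.mem_map_of_mem hy) (by rwa [form_map])

omit [CharP K 2] in
theorem IsHexagonLine.map {l : Submodule K (V K)} (h : IsHexagonLine l) (g : G2 K) :
    IsHexagonLine (l.map (act g).toLinearMap) := by
  rw [isHexagonLine_iff] at h ⊢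
  refine ⟨by rw [← h.1]; exact LinearEquiv.finrank_map_eq (act g) l, ?_⟩
  rintro _ ⟨x, hx, rfl⟩ _ ⟨y, hy, rfl⟩
  exact (hex_act g).2 (h.2 x hx y hy)

theorem IsSpecialPlane.map {U : Submodule K (V K)} (h : IsSpecialPlane U) (g : G2 K) :
    IsSpecialPlane (U.map (G2.map g)) := by
  obtain ⟨h1, l, hl, hle⟩ := h
  refine ⟨h1.map g, _, hl.map g, ?_⟩
  rintro _ ⟨_, ⟨x, hx, rfl⟩, rfl⟩
  refine ⟨proj₃ K x, hle (Submodule.mem_map_of_mem hx), ?_⟩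
  exact map_proj₃ g x

theorem not_isSpecialPlane_map {U : Submodule K (V K)} (hU : U ≤ hyp K) (h : ¬ IsSpecialPlane U)
    (g : G2 K) : ¬ IsSpecialPlane (U.map (G2.map g)) := by
  intro h'
  have := h'.map g⁻¹
  rw [← submodule_map_mul, inv_mul_cancel, submodule_map_one hU] at this
  exact h this

/-- A chamber of the geometry of nonspecial planes is the image of a standard one. -/
theorem exists_act_chamber (hs : Function.Surjective fun x : K => x ^ 2)
    {p l e : Submodule K (V K)} (hp : IsPG 1 p) (hl : IsNonsymplecticLine l)
    (he : IsNonsingularPlane e) (he' : ¬ IsSpecialPlane e) (hpl : p ≤ l) (hle : l ≤ e) :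
    ∃ g : G2 K, p = (K ∙ bv K 0).map (G2.map g) ∧ l = (K ∙ bv K 0 ⊔ K ∙ bv K 4).map (G2.map g) ∧
      e = (K ∙ bv K 0 ⊔ K ∙ bv K 4 ⊔ K ∙ (bv K 1 + bv K 5)).map (G2.map g) := by
  obtain ⟨x, hx0, rfl⟩ := exists_eq_span_singleton hp.2
  have hxl : x ∈ l := by simpa using hpl
  obtain ⟨y, hyl, hxy⟩ := exists_indep_mem (e := l) (by rw [hl.1.2]; norm_num) hxl hx0
  have hl' := eq_pair hl.1.2 hxl hyl hxy
  have hf : form x y ≠ 0 := by rw [hl'] at hl; exact hl.form_ne_zero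
  have hlt : l < e := lt_of_le_of_ne hle fun h => by
    have h2 := hl.1.2
    rw [h, he.1.2] at h2
    omega
  obtain ⟨z, hze, hzl⟩ := SetLike.exists_of_lt hlt
  obtain ⟨a, ha, hax⟩ := exists_lift hs x
  obtain ⟨b, hb, hby⟩ := exists_lift hs ((form x y)⁻¹ • y)
  obtain ⟨c, hc, hcz⟩ := exists_lift hs z
  have hxh := hl.1.1 hxl
  have hyh := hl.1.1 hyl
  rw [proj₃_of_mem hxh] at hax
  rw [map_smul, proj₃_of_mem hyh] at hby
  rw [proj₃_of_mem (he.1.1 hze)] at hcz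
  have hab : form a b = 1 := by
    rw [← form_proj₃_left, ← form_proj₃_right, hax, hby, form_smul_right, inv_mul_cancel₀ hf]
  have hab0 : form a b ≠ 0 := by rw [hab]; exact one_ne_zero
  have hyspan : K ∙ proj₃ K b = K ∙ y := by
    rw [hby, Submodule.span_singleton_smul_eq (IsUnit.mk0 _ (inv_ne_zero hf))]
  have hl'' : l = K ∙ proj₃ K a ⊔ K ∙ proj₃ K b := by rw [hax, hyspan, hl']
  have hk0 : proj₃ K (altitude a b c) ≠ 0 := fun h0 => hzl (by
    have := mem_of_proj₃_altitude hab0 h0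
    rwa [hcz, ← hl''] at this)
  have hfr := isPlaneFrame_altitude ha hb hab0 hk0
  have hple : plane a b (altitude a b c) ≤ e := by
    rw [plane_altitude hab0, plane, ← hl'', hcz]
    exact sup_le hle (by simpa)
  have hpe : e = plane a b (altitude a b c) :=
    (Submodule.eq_of_le_of_finrank_le hple
      (by rw [he.1.2, finrank_triple hfr.indep])).symm
  have hq : quad (altitude a b c) ≠ 0 := by
    rwa [hpe, hfr.isSpecialPlane_iff] at he'
  obtain ⟨n, hn⟩ := hs (quad (altitude a b c))⁻¹
  have hn' : n ^ 2 = (quad (altitude a b c))⁻¹ := hn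
  have hn0 : n ≠ 0 := by
    rintro rfl
    exact inv_ne_zero hq (by rw [← hn']; simp)
  obtain ⟨g, h1, h2, h3, -⟩ := exists_act_eq (k := n • altitude a b c) ha hb hab
    (by rw [form_smul_right, hfr.form_left, mul_zero])
    (by rw [form_smul_right, hfr.form_right, mul_zero])
    (by rw [tri_smul_right, hfr.tri_eq, mul_zero])
    (by rw [quad_smul, hn', inv_mul_cancel₀ hq])
  refine ⟨g, ?_, ?_, ?_⟩
  · rw [Submodule.map_span, Set.image_singleton, map_eq_proj₃_act, h1, hax]
  · rw [Submodule.map_sup, Submodule.map_span, Submodule.map_span, Set.image_singleton,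
      Set.image_singleton, map_eq_proj₃_act, map_eq_proj₃_act, h1, h2, ← hl'']
  · rw [Submodule.map_sup, Submodule.map_sup, Submodule.map_span, Submodule.map_span,
      Submodule.map_span, Set.image_singleton, Set.image_singleton, Set.image_singleton,
      map_eq_proj₃_act, map_eq_proj₃_act, map_eq_proj₃_act, h1, h2, h3, map_smul,
      Submodule.span_singleton_smul_eq (IsUnit.mk0 _ hn0), hpe]

/-- The action of `G₂(K)` on `PG(5, K)` induces a flag-transitive action on `Γ₁`. -/
theorem exists_gamma1_action (hs : Function.Surjective fun x : K => x ^ 2) :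
    ∃ ρ : G2 K →* (Gamma1 K).Aut,
      (∀ (g : G2 K) (x : (Gamma1 K).X),
        Gamma1.subspace K ((ρ g : Equiv.Perm (Gamma1 K).X) x) =
          (Gamma1.subspace K x).map (G2.map g)) ∧
      (Gamma1 K).FlagTransitive ρ := by
  have hle : ∀ i, ∀ U ∈ (![{U | IsPG 1 U}, {U | IsNonsymplecticLine U},
      {U | IsNonsingularPlane U ∧ ¬ IsSpecialPlane U}] i : Set (Submodule K (V K))),
      U ≤ hyp K := by
    intro i U hU
    match i, hU with
    | 0, hU => exact hU.1
    | 1, hU => exact hU.1.1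
    | 2, hU => exact hU.1.1.1
  obtain ⟨ρ, hρ⟩ := exists_aut_hom (P := {U : Submodule K (V K) | IsPG 1 U})
    (L := {U | IsNonsymplecticLine U}) (E := {U | IsNonsingularPlane U ∧ ¬ IsSpecialPlane U})
    (R := fun p e => ∃ l, IsNonsymplecticLine l ∧ p ≤ l ∧ l ≤ e)
    (fun (g : G2 K) U => U.map (G2.map g))
    (by
      intro g i U hU
      match i, hU with
      | 0, hU => exact IsPG.map hU g
      | 1, hU => exact IsNonsymplecticLine.map hU g
      | 2, hU => exact ⟨hU.1.map g, not_isSpecialPlane_map hU.1.1.1 hU.2 g⟩)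
    (fun i U hU => submodule_map_one (hle i U hU))
    (fun g h _ U _ => submodule_map_mul g h U)
    (fun g U W h => Submodule.map_mono h)
    (fun g p _ e _ ⟨l, hl, h1, h2⟩ =>
      ⟨_, hl.map g, Submodule.map_mono h1, Submodule.map_mono h2⟩)
  refine ⟨ρ, hρ, (isRankThree_nonspecial hs).flagTransitive ρ ?_⟩
  intro p hp l hl e he p' hp' l' hl' e' he' hpl hle hpl' hle'
  obtain ⟨g, h1, h2, h3⟩ := exists_act_chamber hs hp hl he.1 he.2 hpl hle
  obtain ⟨g', h1', h2', h3'⟩ := exists_act_chamber hs hp' hl' he'.1 he'.2 hpl' hle'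
  have key : ∀ U : Submodule K (V K), (U.map (G2.map g)).map (G2.map (g' * g⁻¹)) =
      U.map (G2.map g') := fun U => by
    rw [← submodule_map_mul, inv_mul_cancel_right]
  refine ⟨g' * g⁻¹, fun x => ⟨fun hx => ?_, fun hx => ?_, fun hx => ?_⟩⟩
  · rw [hρ, hx, h1, h1', key]
  · rw [hρ, hx, h2, h2', key]
  · rw [hρ, hx, h3, h3', key]

end CharTwo

end Cayley

theorem mainTheorem3 (K : Type u) [Field K] :
    (CharP K 2 → Function.Surjective (fun x : K => x ^ 2) →
      ((Cayley.Gamma0 K).IsGeometry ∧ (Cayley.Gamma0 K).SimplyConnected) ∧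
      ((Cayley.Gamma1 K).IsGeometry ∧
        (∃ ρ : Cayley.G2 K →* (Cayley.Gamma1 K).Aut,
          (∀ (g : Cayley.G2 K) (x : (Cayley.Gamma1 K).X),
            Cayley.Gamma1.subspace K ((ρ g : Equiv.Perm (Cayley.Gamma1 K).X) x) =
              (Cayley.Gamma1.subspace K x).map (Cayley.G2.map g)) ∧
          (Cayley.Gamma1 K).FlagTransitive ρ) ∧
        (2 < Cardinal.mk K → (Cayley.Gamma1 K).SimplyConnected)) ∧
      ((Cayley.Gamma2 K).IsGeometry ∧ (Cayley.Gamma2 K).SimplyConnected)) ∧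
    ((Cayley.Gamma3 K).IsGeometry ∧ (Cayley.Gamma3 K).SimplyConnected) := by
  refine ⟨fun _ hs => ⟨⟨(Cayley.isRankThree_nonsingular hs).isGeometry,
    Cayley.gamma0_simplyConnected hs⟩, ⟨(Cayley.isRankThree_nonspecial hs).isGeometry,
    Cayley.exists_gamma1_action hs, fun hK => ?_⟩, (Cayley.isRankThree_special hs).isGeometry,
    Cayley.gamma2_simplyConnected hs⟩, Cayley.gamma3_isGeometry K, Cayley.gamma3_simplyConnected K⟩
  obtain ⟨a, a0, a1⟩ : ∃ a : K, a ≠ 0 ∧ a ≠ 1 := by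
    by_contra! h
    have hle : Cardinal.mk K ≤ 2 := by
      have hu : (Set.univ : Set K) ⊆ {0, 1} := fun a _ => by
        by_cases h0 : a = 0
        · exact Or.inl h0
        · exact Or.inr (h a h0)
      calc Cardinal.mk K = Cardinal.mk (Set.univ : Set K) := Cardinal.mk_univ.symm
        _ ≤ Cardinal.mk ({0, 1} : Set K) := Cardinal.mk_le_mk_of_subset hu
        _ ≤ 2 := Cardinal.mk_insert_le.trans (by rw [Cardinal.mk_singleton]; norm_num)
    exact absurd hK (not_lt.2 hle)
  exact Cayley.gamma1_simplyConnected hs a0 a1
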